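/- Let $n\ge 1$, let $\mathbb B^n=\{z\in\mathbb C^n:|z|<1\}$ and let $dv$ be Lebesgue measure on $\mathbb B^n$ normalized to total mass one. For $\lambda>n$ let $dv_\lambda=c_\lambda(1-|z|^2)^{\lambda-n-1}dv$ with $c_\lambda$ such that $v_\lambda(\mathbb B^n)=1$. Let $\mathcal A^2_\lambda$ be the (closed) subspace of holomorphic functions in $L^2(\mathbb B^n,dv_\lambda)$, and let $P_\lambda$ be the orthogonal projection of $L^2(\mathbb B^n,dv_\lambda)$ onto $\mathcal A^2_\lambda$. For $f\in L^\infty(\mathbb B^n)$ define $T_f^\lambda u=P_\lambda(fu)$ and $H_f^\lambda u=(I-P_\lambda)(fu)$ for $u\in\mathcal A^2_\lambda$, and let $\|\cdot\|_\lambda$ denote the operator norm. Let $\beta$ be the Bergman distance on $\mathbb B^n$, i.e. the distance function induced by the metric tensor $g_{ij}(z)=\frac{\partial^2}{\partial z_i\,\partial\bar z_j}\log\big((1-|z|^2)^{-(n+1)}\big)$. Let $\mathrm{UC}(\mathbb B^n)$ be the space of (possibly unbounded) functions $g:\mathbb B^n\to\mathbb C$ that are uniformly continuous with respect to $\beta$.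 For $x\in\mathbb B^n$ and $\rho>0$ let $E(x,\rho)=\{y\in\mathbb B^n:\beta(x,y)<\rho\}$ and $|E(x,\rho)|=v(E(x,\rho))$. Let $\mathrm{VMO}(\mathbb B^n)$ be the space of all $f\in L^\infty(\mathbb B^n)$ such that $$\frac1{|E(x,\rho)|}\int_{E(x,\rho)}\Big|f(y)-\frac1{|E(x,\rho)|}\int_{E(x,\rho)}f\,dv\Big|^2dv(y)\longrightarrow 0\quad\text{as }\rho\to0,\text{ uniformly in }x\in\mathbb B^n.$$ **Theorem.** Let $f\in\mathrm{VMO}(\mathbb B^n)$. Then: 1. $\lim_{\lambda\to\infty}\|H_f^\lambda\|_\lambda=0$. 2. $\lim_{\lambda\to\infty}\|T_f^\lambda T_g^\lambda-T_{fg}^\lambda\|_\lambda=0$ for every $g\in L^\infty(\mathbb B^n)$. 3. $\lim_{\lambda\to\infty}\|T_f^\lambda T_g^\lambda-T_{fg}^\lambda\|_\lambda=0$ for every $g\in\mathrm{UC}(\mathbb B^n)$. Here $T_g^\lambda u=P_\lambda(gu)$, $T_{fg}^\lambda u=P_\lambda(fgu)$ and the semi-commutator act on the domain $\mathcal D$ of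 all $u\in\mathcal A^2_\lambda$ such that for every $\rho>0$ there is $C$ with $|u(z)|\le C(1-|z|^2)^{-\rho}$ on $\mathbb B^n$. For every $\lambda>n$ this domain is dense in $\mathcal A_\lambda^2$, and $gu,fgu\in L^2(\mathbb B^n,dv_\lambda)$ for all $u\in\mathcal D$. The norm is the (possibly infinite) operator norm of this densely defined operator. -/

import Mathlib

open MeasureTheory Metric Filter Topology
open scoped ENNReal

namespace BergmanBall

/-- `ℂⁿ` with its Euclidean (Hermitian) norm. -/
abbrev Cn (n : ℕ) : Type := EuclideanSpace ℂ (Fin n)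

/-- The open unit ball `Bⁿ`. -/
abbrev unitBall (n : ℕ) : Set (Cn n) := ball (0 : Cn n) 1

/-- Lebesgue measure on `Bⁿ`, normalized to total mass one. -/
noncomputable def ballMeasure (n : ℕ) : Measure (Cn n) :=
  (volume (unitBall n))⁻¹ • volume.restrict (unitBall n)

/-- The weight `h(z,z)^(λ-p) = (1 - |z|²)^(λ-p)`, where the genus of `Bⁿ` is `p = n + 1`. -/
noncomputable def bergmanWeight (n : ℕ) (lam : ℝ) (z : Cn n) : ℝ≥0∞ :=
  ENNReal.ofReal ((1 - ‖z‖ ^ 2) ^ (lam - (n + 1)))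

/-- The normalizing constant `c_λ`, which for `λ > n` makes `v_λ` a probability measure. -/
noncomputable def normConst (n : ℕ) (lam : ℝ) : ℝ≥0∞ :=
  (∫⁻ z, bergmanWeight n lam z ∂(ballMeasure n))⁻¹

/-- The weighted measure `dv_λ = c_λ (1 - |z|²)^(λ-p) dv`. Only `λ > n` is meaningful. -/
noncomputable def bergmanMeasure (n : ℕ) (lam : ℝ) : Measure (Cn n) :=
  normConst n lam • (ballMeasure n).withDensity (bergmanWeight n lam)

theorem measurable_bergmanWeight (n : ℕ) (lam : ℝ) : Measurable (bergmanWeight n lam) := by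
  unfold bergmanWeight
  fun_prop

theorem bergmanMeasure_absolutelyContinuous (n : ℕ) (lam : ℝ) :
    bergmanMeasure n lam ≪ ballMeasure n :=
  Measure.smul_absolutelyContinuous.trans (withDensity_absolutelyContinuous _ _)

theorem measurePreserving_smul (n : ℕ) (c : ℂ) (hc : ‖c‖ = 1) :
    MeasurePreserving (fun w : Cn n => c • w) volume volume := by
  have h0 : c ≠ 0 := by rintro rfl; simp at hc
  let e : Cn n ≃ₗᵢ[ℝ] Cn n :=
    { (LinearEquiv.smulOfNeZero ℂ (Cn n) c h0).restrictScalars ℝ with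
      norm_map' := fun x => by
        change ‖c • x‖ = ‖x‖
        rw [norm_smul, hc, one_mul] }
  exact e.measurePreserving

/-- Mean value inequality over circles. -/
theorem enorm_le_circle {n : ℕ} {u : Cn n → ℂ} {z w : Cn n} {r : ℝ}
    (hu : DifferentiableOn ℂ u (ball z r)) (hw : w ∈ ball (0 : Cn n) r) :
    ‖u z‖ₑ ≤ (ENNReal.ofReal (2 * Real.pi))⁻¹ *
      ∫⁻ θ in Set.Ioc 0 (2 * Real.pi), ‖u (z + circleMap 0 1 θ • w)‖ₑ := by
  have hmem : ∀ ζ : ℂ, ‖ζ‖ ≤ 1 → z + ζ • w ∈ ball z r := by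
    intro ζ hζ
    rw [mem_ball, dist_eq_norm, add_sub_cancel_left, norm_smul]
    rw [mem_ball_zero_iff] at hw
    calc ‖ζ‖ * ‖w‖ ≤ 1 * ‖w‖ := by gcongr
      _ < r := by simpa using hw
  have hd : DifferentiableOn ℂ (fun ζ : ℂ => u (z + ζ • w)) (closedBall 0 1) := by
    refine hu.comp ?_ fun ζ hζ => hmem ζ (by simpa using hζ)
    fun_prop
  have hd' : DiffContOnCl ℂ (fun ζ : ℂ => u (z + ζ • w)) (ball 0 |(1 : ℝ)|) := by
    rw [abs_one]
    exact (hd.mono (closure_ball_subset_closedBall)).diffContOnCl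
  have h := hd'.circleAverage
  simp only [zero_smul, add_zero] at h
  rw [← h, Real.circleAverage_def, enorm_smul, intervalIntegral.integral_of_le (by positivity)]
  have hpi : ‖(2 * Real.pi)⁻¹‖ₑ = (ENNReal.ofReal (2 * Real.pi))⁻¹ := by
    rw [Real.enorm_eq_ofReal (by positivity), ENNReal.ofReal_inv_of_pos (by positivity)]
  rw [hpi]
  gcongr
  exact enorm_integral_le_lintegral_enorm _

/-- Sub-mean-value inequality on Euclidean balls. -/
theorem enorm_mul_volume_le {n : ℕ} {u : Cn n → ℂ} {z : Cn n} {r : ℝ}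
    (hu : DifferentiableOn ℂ u (ball z r)) :
    ‖u z‖ₑ * volume (ball (0 : Cn n) r) ≤ ∫⁻ w in ball z r, ‖u w‖ₑ := by
  have hmeas : Measurable ((ball z r).indicator fun w => ‖u w‖ₑ) := by
    have h1 : ContinuousOn (fun w => ‖u w‖ₑ) (ball z r) := hu.continuousOn.enorm
    classical
    have := h1.measurable_piecewise (g := fun _ => (0 : ℝ≥0∞)) continuousOn_const measurableSet_ball
    rwa [← Set.piecewise_eq_indicator]
  set v : Cn n → ℝ≥0∞ := (ball z r).indicator fun w => ‖u w‖ₑ with hv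
  have hvrot : ∀ θ : ℝ, ∫⁻ w, v (z + circleMap 0 1 θ • w) = ∫⁻ w, v w := by
    intro θ
    have h1 := (measurePreserving_smul n (circleMap 0 1 θ) (by simp)).lintegral_comp
      (f := fun w => v (z + w)) (by fun_prop)
    rw [h1, lintegral_add_left_eq_self]
  have hbd : ∀ w ∈ ball (0 : Cn n) r, ‖u z‖ₑ ≤ (ENNReal.ofReal (2 * Real.pi))⁻¹ *
      ∫⁻ θ in Set.Ioc 0 (2 * Real.pi), v (z + circleMap 0 1 θ • w) := by
    intro w hw
    refine (enorm_le_circle hu hw).trans (le_of_eq ?_)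
    congr 1
    refine lintegral_congr fun θ => ?_
    rw [hv, Set.indicator_of_mem]
    rw [mem_ball, dist_eq_norm, add_sub_cancel_left, norm_smul]
    simpa using hw
  have hpi0 : ENNReal.ofReal (2 * Real.pi) ≠ 0 := by
    simpa using Real.pi_pos
  calc ‖u z‖ₑ * volume (ball (0 : Cn n) r)
      = ∫⁻ w in ball (0 : Cn n) r, ‖u z‖ₑ := by rw [setLIntegral_const]
    _ ≤ ∫⁻ w in ball (0 : Cn n) r, (ENNReal.ofReal (2 * Real.pi))⁻¹ *
          ∫⁻ θ in Set.Ioc 0 (2 * Real.pi), v (z + circleMap 0 1 θ • w) :=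
        setLIntegral_mono' measurableSet_ball hbd
    _ ≤ ∫⁻ w, (ENNReal.ofReal (2 * Real.pi))⁻¹ *
          ∫⁻ θ in Set.Ioc 0 (2 * Real.pi), v (z + circleMap 0 1 θ • w) :=
        setLIntegral_le_lintegral _ _
    _ = (ENNReal.ofReal (2 * Real.pi))⁻¹ *
          ∫⁻ w, ∫⁻ θ in Set.Ioc 0 (2 * Real.pi), v (z + circleMap 0 1 θ • w) := by
        rw [lintegral_const_mul' _ _ (ENNReal.inv_ne_top.2 hpi0)]
    _ = (ENNReal.ofReal (2 * Real.pi))⁻¹ *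
          ∫⁻ θ in Set.Ioc 0 (2 * Real.pi), ∫⁻ w, v (z + circleMap 0 1 θ • w) := by
        rw [lintegral_lintegral_swap]
        apply Measurable.aemeasurable
        apply hmeas.comp
        have : Measurable (circleMap 0 1) := (continuous_circleMap 0 1).measurable
        fun_prop
    _ = ∫⁻ w, v w := by
        simp only [hvrot]
        rw [setLIntegral_const, Real.volume_Ioc, sub_zero, mul_comm, mul_assoc,
          ENNReal.mul_inv_cancel hpi0 ENNReal.ofReal_ne_top, mul_one]
    _ = ∫⁻ w in ball z r, ‖u w‖ₑ := by rw [hv, lintegral_indicator measurableSet_ball]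

/-- On compact sub-balls Lebesgue measure is dominated by a multiple of `v_λ`. -/
theorem exists_volume_restrict_le (n : ℕ) (lam : ℝ) (h0 : normConst n lam ≠ 0) {s : ℝ}
    (hs1 : s < 1) :
    ∃ κ : ℝ≥0∞, κ ≠ ∞ ∧ volume.restrict (closedBall (0 : Cn n) s) ≤ κ • bergmanMeasure n lam := by
  have hsub : closedBall (0 : Cn n) s ⊆ unitBall n := closedBall_subset_ball hs1
  have hVpos : volume (unitBall n) ≠ 0 := (measure_ball_pos _ _ one_pos).ne'
  have hVfin : volume (unitBall n) ≠ ∞ := measure_ball_lt_top.ne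
  obtain ⟨m, hm0, hm⟩ : ∃ m : ℝ, 0 < m ∧ ∀ z ∈ closedBall (0 : Cn n) s,
      m ≤ (1 - ‖z‖ ^ 2) ^ (lam - (n + 1)) := by
    have hpos : ∀ z ∈ closedBall (0 : Cn n) s, 0 < 1 - ‖z‖ ^ 2 := by
      intro z hz
      have h1 : ‖z‖ < 1 := by simpa using hsub hz
      nlinarith [norm_nonneg z]
    rcases (closedBall (0 : Cn n) s).eq_empty_or_nonempty with he | hne
    · exact ⟨1, one_pos, by simp [he]⟩
    · have hc : ContinuousOn (fun z : Cn n => (1 - ‖z‖ ^ 2) ^ (lam - (n + 1)))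
          (closedBall (0 : Cn n) s) := by
        refine ContinuousOn.rpow_const (by fun_prop) fun z hz => Or.inl (hpos z hz).ne'
      obtain ⟨z₀, hz₀, hmin⟩ := (isCompact_closedBall (0 : Cn n) s).exists_isMinOn hne hc
      exact ⟨_, Real.rpow_pos_of_pos (hpos z₀ hz₀) _, fun z hz => hmin hz⟩
  set κ' : ℝ≥0∞ := normConst n lam * (ENNReal.ofReal m * (volume (unitBall n))⁻¹) with hκ'
  have hκ0 : κ' ≠ 0 := by
    refine mul_ne_zero h0 (mul_ne_zero (by simpa using hm0) (ENNReal.inv_ne_zero.2 hVfin))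
  have hle : κ' • volume.restrict (closedBall (0 : Cn n) s) ≤ bergmanMeasure n lam := by
    rw [hκ', bergmanMeasure, mul_smul]
    gcongr
    refine Measure.le_iff.2 fun t ht => ?_
    rw [withDensity_apply _ ht, Measure.smul_apply, Measure.restrict_apply ht, smul_eq_mul]
    calc ENNReal.ofReal m * (volume (unitBall n))⁻¹ * volume (t ∩ closedBall 0 s)
        = ENNReal.ofReal m * ballMeasure n (t ∩ closedBall 0 s) := by
          rw [ballMeasure, Measure.smul_apply,
            Measure.restrict_apply (ht.inter measurableSet_closedBall), smul_eq_mul, mul_assoc,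
            Set.inter_eq_self_of_subset_left (Set.inter_subset_right.trans hsub)]
      _ = ∫⁻ z in t ∩ closedBall 0 s, ENNReal.ofReal m ∂(ballMeasure n) := by
          rw [setLIntegral_const]
      _ ≤ ∫⁻ z in t ∩ closedBall 0 s, bergmanWeight n lam z ∂(ballMeasure n) :=
          setLIntegral_mono' (ht.inter measurableSet_closedBall) fun z hz =>
            ENNReal.ofReal_le_ofReal (hm z hz.2)
      _ ≤ ∫⁻ z in t, bergmanWeight n lam z ∂(ballMeasure n) :=
          lintegral_mono_set Set.inter_subset_left
  by_cases htop : κ' = ∞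
  · refine ⟨1, by simp, ?_⟩
    rw [one_smul]
    refine le_trans ?_ hle
    rw [htop]
    refine Measure.le_iff.2 fun t ht => ?_
    rw [Measure.smul_apply, smul_eq_mul]
    exact le_mul_of_one_le_left' le_top
  · refine ⟨κ'⁻¹, ENNReal.inv_ne_top.2 hκ0, ?_⟩
    calc volume.restrict (closedBall (0 : Cn n) s)
        = κ'⁻¹ • κ' • volume.restrict (closedBall (0 : Cn n) s) := by
          rw [smul_smul, ENNReal.inv_mul_cancel hκ0 htop, one_smul]
      _ ≤ κ'⁻¹ • bergmanMeasure n lam := by gcongr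

/-- Point evaluations are bounded, locally uniformly, in the `L²` norm. -/
theorem exists_norm_le (n : ℕ) (lam : ℝ) (h0 : normConst n lam ≠ 0) {s : ℝ} (hs1 : s < 1) :
    ∃ C : ℝ, 0 ≤ C ∧ ∀ F : Lp ℂ 2 (bergmanMeasure n lam), ∀ u : Cn n → ℂ,
      DifferentiableOn ℂ u (unitBall n) → F =ᵐ[bergmanMeasure n lam] u →
      ∀ z ∈ closedBall (0 : Cn n) s, ‖u z‖ ≤ C * ‖F‖ := by
  obtain ⟨κ, hκ, hle⟩ := exists_volume_restrict_le n lam h0 (s := (1 + s) / 2) (by linarith)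
  set r : ℝ := (1 - s) / 2 with hr
  have hr0 : 0 < r := by rw [hr]; linarith
  have hVpos : volume (ball (0 : Cn n) r) ≠ 0 := (measure_ball_pos _ _ hr0).ne'
  have hVfin : volume (ball (0 : Cn n) r) ≠ ∞ := measure_ball_lt_top.ne
  set D : ℝ≥0∞ := (volume (ball (0 : Cn n) r))⁻¹ * κ with hD
  have hDtop : D ≠ ∞ := ENNReal.mul_ne_top (ENNReal.inv_ne_top.2 hVpos) hκ
  refine ⟨Real.sqrt D.toReal, Real.sqrt_nonneg _, fun F u hu hFu z hz => ?_⟩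
  have hzs : ‖z‖ ≤ s := by simpa using hz
  have hsub : ball z r ⊆ closedBall (0 : Cn n) ((1 + s) / 2) := by
    intro w hw
    rw [mem_ball, dist_eq_norm] at hw
    rw [mem_closedBall_zero_iff]
    have := norm_add_le (w - z) z
    rw [sub_add_cancel] at this
    rw [hr] at hw
    linarith
  have hsub' : ball z r ⊆ unitBall n := hsub.trans (closedBall_subset_ball (by linarith))
  have hu2 : DifferentiableOn ℂ (fun w => u w ^ 2) (ball z r) := (hu.mono hsub').pow 2
  have h1 := enorm_mul_volume_le hu2
  have h2 : ∫⁻ w in ball z r, ‖u w ^ 2‖ₑ ≤ κ * ‖F‖ₑ ^ 2 := by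
    calc ∫⁻ w in ball z r, ‖u w ^ 2‖ₑ
        ≤ ∫⁻ w in closedBall (0 : Cn n) ((1 + s) / 2), ‖u w ^ 2‖ₑ := lintegral_mono_set hsub
      _ ≤ ∫⁻ w, ‖u w ^ 2‖ₑ ∂(κ • bergmanMeasure n lam) := lintegral_mono' hle le_rfl
      _ = κ * ∫⁻ w, ‖F w‖ₑ ^ 2 ∂(bergmanMeasure n lam) := by
          rw [lintegral_smul_measure, smul_eq_mul]
          congr 1
          refine lintegral_congr_ae ?_
          filter_upwards [hFu] with w hw
          rw [hw, enorm_pow]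
      _ = κ * ‖F‖ₑ ^ 2 := by
          rw [Lp.enorm_def, eLpNorm_eq_lintegral_rpow_enorm_toReal (by simp) (by simp)]
          simp only [ENNReal.toReal_ofNat, ENNReal.rpow_ofNat]
          rw [← ENNReal.rpow_natCast, ← ENNReal.rpow_mul]
          simp
  have h3 : ‖u z‖ₑ ^ 2 ≤ D * ‖F‖ₑ ^ 2 := by
    rw [enorm_pow] at h1
    have h4 := h1.trans h2
    calc ‖u z‖ₑ ^ 2
        = (volume (ball (0 : Cn n) r))⁻¹ * (‖u z‖ₑ ^ 2 * volume (ball (0 : Cn n) r)) := by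
          rw [mul_comm, mul_assoc, ENNReal.mul_inv_cancel hVpos hVfin, mul_one]
      _ ≤ (volume (ball (0 : Cn n) r))⁻¹ * (κ * ‖F‖ₑ ^ 2) := by gcongr
      _ = D * ‖F‖ₑ ^ 2 := by rw [hD, mul_assoc]
  have h5 : ‖u z‖ ^ 2 ≤ D.toReal * ‖F‖ ^ 2 := by
    have := ENNReal.toReal_mono (ENNReal.mul_ne_top hDtop (by simp)) h3
    simpa using this
  calc ‖u z‖ = Real.sqrt (‖u z‖ ^ 2) := by rw [Real.sqrt_sq (norm_nonneg _)]
    _ ≤ Real.sqrt (D.toReal * ‖F‖ ^ 2) := Real.sqrt_le_sqrt h5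
    _ = Real.sqrt D.toReal * ‖F‖ := by
        rw [Real.sqrt_mul ENNReal.toReal_nonneg, Real.sqrt_sq (norm_nonneg _)]

/-- Cauchy estimate for the total derivative. -/
theorem norm_fderiv_le {n : ℕ} {u : Cn n → ℂ} {z : Cn n} {r M : ℝ} (hr : 0 < r)
    (hu : DifferentiableOn ℂ u (ball z r)) (hM : ∀ w ∈ ball z r, ‖u w‖ ≤ M) :
    ‖fderiv ℂ u z‖ ≤ M / (r / 2) := by
  have hM0 : 0 ≤ M := (norm_nonneg _).trans (hM z (mem_ball_self hr))
  have hdz : DifferentiableAt ℂ u z := hu.differentiableAt (ball_mem_nhds z hr)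
  refine ContinuousLinearMap.opNorm_le_of_unit_norm (by positivity) fun v hv => ?_
  have hmem : ∀ ζ ∈ closedBall (0 : ℂ) (r / 2), z + ζ • v ∈ ball z r := by
    intro ζ hζ
    rw [mem_closedBall_zero_iff] at hζ
    rw [mem_ball, dist_eq_norm, add_sub_cancel_left, norm_smul, hv, mul_one]
    linarith
  have hd : DifferentiableOn ℂ (fun ζ : ℂ => u (z + ζ • v)) (closedBall 0 (r / 2)) := by
    refine hu.comp ?_ hmem
    fun_prop
  have hderiv : HasDerivAt (fun ζ : ℂ => u (z + ζ • v)) (fderiv ℂ u z v) 0 := by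
    have h1 : HasDerivAt (fun ζ : ℂ => z + ζ • v) v 0 := by
      simpa using ((hasDerivAt_id (0 : ℂ)).smul_const v).const_add z
    have h2 : HasFDerivAt u (fderiv ℂ u z) (z + (0 : ℂ) • v) := by
      simpa using hdz.hasFDerivAt
    exact h2.comp_hasDerivAt 0 h1
  rw [← hderiv.deriv]
  exact Complex.norm_deriv_le_of_forall_mem_sphere_norm_le (by positivity)
    (hd.mono closure_ball_subset_closedBall).diffContOnCl
    fun ζ hζ => hM _ (hmem ζ (sphere_subset_closedBall hζ))

/-- The weighted Bergman space `A²_λ(Bⁿ)`: the classes in `L²(v_λ)` that have a representative which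
is holomorphic on the open unit ball. -/
noncomputable def bergmanSpace (n : ℕ) (lam : ℝ) :
    Submodule ℂ (Lp ℂ 2 (bergmanMeasure n lam)) where
  carrier := {F | ∃ u : Cn n → ℂ, DifferentiableOn ℂ u (unitBall n) ∧
    F =ᵐ[bergmanMeasure n lam] u}
  add_mem' := by
    rintro F G ⟨u, hu, hFu⟩ ⟨v, hv, hGv⟩
    refine ⟨u + v, hu.add hv, ?_⟩
    exact (Lp.coeFn_add F G).trans (hFu.add hGv)
  zero_mem' := ⟨0, differentiableOn_const 0, Lp.coeFn_zero _ _ _⟩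
  smul_mem' := by
    rintro c F ⟨u, hu, hFu⟩
    exact ⟨c • u, hu.const_smul c, (Lp.coeFn_smul c F).trans (hFu.const_smul c)⟩

/-- The Bergman space is closed, so that the orthogonal projection onto it exists. -/
theorem isClosed_bergmanSpace (n : ℕ) (lam : ℝ) :
    IsClosed (bergmanSpace n lam : Set (Lp ℂ 2 (bergmanMeasure n lam))) := by
  by_cases h0 : normConst n lam = 0
  · have hz : bergmanMeasure n lam = 0 := by rw [bergmanMeasure, h0, zero_smul]
    convert isClosed_univ
    refine Set.eq_univ_of_forall fun F => ⟨0, differentiableOn_const 0, ?_⟩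
    have hbot : ae (bergmanMeasure n lam) = ⊥ := by rw [hz, ae_zero]
    simp [Filter.EventuallyEq, hbot]
  refine isClosed_of_closure_subset fun F hF => ?_
  obtain ⟨G, hG, hGF⟩ := mem_closure_iff_seq_limit.1 hF
  choose u hu hGu using hG
  -- uniform estimates for the functions and their derivatives
  have hdiff : ∀ j k, DifferentiableOn ℂ (u j - u k) (unitBall n) := fun j k => (hu j).sub (hu k)
  have hae : ∀ j k, (G j - G k : Lp ℂ 2 (bergmanMeasure n lam)) =ᵐ[bergmanMeasure n lam]
      u j - u k := fun j k => (Lp.coeFn_sub _ _).trans ((hGu j).sub (hGu k))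
  have hcau : CauchySeq G := hGF.cauchySeq
  have hest : ∀ s < 1, ∃ C : ℝ, 0 ≤ C ∧ ∀ j k, ∀ z ∈ ball (0 : Cn n) s,
      ‖u j z - u k z‖ ≤ C * ‖G j - G k‖ ∧
      ‖fderiv ℂ (u j) z - fderiv ℂ (u k) z‖ ≤ C * ‖G j - G k‖ := by
    intro s hs
    obtain ⟨C, hC, hb⟩ := exists_norm_le n lam h0 (s := (1 + s) / 2) (by linarith)
    refine ⟨max C (C / ((1 - s) / 2 / 2)), le_max_of_le_left hC, fun j k z hz => ?_⟩
    have hzs : ‖z‖ < s := by simpa using hz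
    have hsub : ball z ((1 - s) / 2) ⊆ closedBall (0 : Cn n) ((1 + s) / 2) := by
      intro w hw
      rw [mem_ball, dist_eq_norm] at hw
      rw [mem_closedBall_zero_iff]
      have := norm_add_le (w - z) z
      rw [sub_add_cancel] at this
      linarith
    have hsub' : ball z ((1 - s) / 2) ⊆ unitBall n :=
      hsub.trans (closedBall_subset_ball (by linarith))
    have hzU : unitBall n ∈ 𝓝 z := isOpen_ball.mem_nhds (hsub' (mem_ball_self (by linarith)))
    have hbd : ∀ w ∈ closedBall (0 : Cn n) ((1 + s) / 2), ‖(u j - u k) w‖ ≤ C * ‖G j - G k‖ :=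
      hb _ _ (hdiff j k) (hae j k)
    constructor
    · refine (hbd z (hsub (mem_ball_self (by linarith)))).trans ?_
      gcongr
      exact le_max_left _ _
    · rw [← fderiv_sub ((hu j).differentiableAt hzU) ((hu k).differentiableAt hzU)]
      refine (norm_fderiv_le (by linarith) ((hdiff j k).mono hsub')
        fun w hw => hbd w (hsub hw)).trans ?_
      rw [mul_div_right_comm]
      gcongr
      exact le_max_right _ _
  have hucs : ∀ s < 1, UniformCauchySeqOn u atTop (ball (0 : Cn n) s) ∧
      UniformCauchySeqOn (fun j => fderiv ℂ (u j)) atTop (ball (0 : Cn n) s) := by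
    intro s hs
    obtain ⟨C, hC, hb⟩ := hest s hs
    have key : ∀ ε > 0, ∃ N, ∀ j ≥ N, ∀ k ≥ N, C * ‖G j - G k‖ < ε := by
      intro ε hε
      obtain ⟨N, hN⟩ := Metric.cauchySeq_iff.1 hcau (ε / (C + 1)) (by positivity)
      refine ⟨N, fun j hj k hk => ?_⟩
      have := hN j hj k hk
      rw [dist_eq_norm, lt_div_iff₀ (by positivity)] at this
      nlinarith [norm_nonneg (G j - G k)]
    constructor <;> rw [Metric.uniformCauchySeqOn_iff] <;> intro ε hε <;>
      obtain ⟨N, hN⟩ := key ε hε <;> refine ⟨N, fun j hj k hk z hz => ?_⟩ <;> rw [dist_eq_norm]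
    · exact (hb j k z hz).1.trans_lt (hN j hj k hk)
    · exact (hb j k z hz).2.trans_lt (hN j hj k hk)
  have hmem : ∀ z ∈ unitBall n, ∃ s < 1, z ∈ ball (0 : Cn n) s := by
    intro z hz
    have : ‖z‖ < 1 := by simpa using hz
    obtain ⟨s, h1, h2⟩ := exists_between this
    exact ⟨s, h2, by simpa using h1⟩
  have hlim : ∀ z ∈ unitBall n, ∃ a, Tendsto (fun j => u j z) atTop (𝓝 a) := by
    intro z hz
    obtain ⟨s, hs, hzs⟩ := hmem z hz
    exact cauchySeq_tendsto_of_complete ((hucs s hs).1.cauchySeq hzs)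
  have hlim' : ∀ z ∈ unitBall n, ∃ a, Tendsto (fun j => fderiv ℂ (u j) z) atTop (𝓝 a) := by
    intro z hz
    obtain ⟨s, hs, hzs⟩ := hmem z hz
    exact cauchySeq_tendsto_of_complete ((hucs s hs).2.cauchySeq hzs)
  choose! g hg using hlim
  choose! g' hg' using hlim'
  refine ⟨g, fun z hz => ?_, ?_⟩
  · obtain ⟨s, hs, hzs⟩ := hmem z hz
    have hsub : ball (0 : Cn n) s ⊆ unitBall n := ball_subset_ball hs.le
    have := hasFDerivAt_of_tendstoUniformlyOn (𝕜 := ℂ) (f := u) (g := g) (g' := g')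
      (f' := fun j => fderiv ℂ (u j)) (l := atTop) isOpen_ball
      ((hucs s hs).2.tendstoUniformlyOn_of_tendsto fun w hw => hg' w (hsub hw))
      (fun j w hw => ((hu j).differentiableAt (isOpen_ball.mem_nhds (hsub hw))).hasFDerivAt)
      (fun w hw => hg w (hsub hw)) hzs
    exact this.differentiableAt.differentiableWithinAt
  · obtain ⟨ns, hns, hae'⟩ := (tendstoInMeasure_of_tendsto_Lp hGF).exists_seq_tendsto_ae
    have hball : ∀ᵐ z ∂(bergmanMeasure n lam), z ∈ unitBall n := by
      refine (bergmanMeasure_absolutelyContinuous n lam).ae_le ?_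
      refine Measure.ae_smul_measure ?_ _
      exact ae_restrict_mem measurableSet_ball
    filter_upwards [hae', hball, ae_all_iff.2 hGu] with z h1 h2 h3
    have h4 := (hg z h2).comp hns.tendsto_atTop
    refine tendsto_nhds_unique h1 (h4.congr fun i => ?_)
    exact (h3 (ns i)).symm

noncomputable instance instCompleteSpaceBergmanSpace (n : ℕ) (lam : ℝ) :
    CompleteSpace (bergmanSpace n lam) :=
  (isClosed_bergmanSpace n lam).completeSpace_coe

theorem memLp_top_bergmanMeasure {n : ℕ} {f : Cn n → ℂ} (hf : MemLp f ∞ (ballMeasure n))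
    (lam : ℝ) : MemLp f ∞ (bergmanMeasure n lam) := by
  have hac := bergmanMeasure_absolutelyContinuous n lam
  refine ⟨hf.1.mono_ac hac, ?_⟩
  rw [eLpNorm_exponent_top]
  refine (eLpNormEssSup_mono_measure f hac).trans_lt ?_
  rw [← eLpNorm_exponent_top]
  exact hf.2

theorem memLp_top_mul {n : ℕ} {f g : Cn n → ℂ} (hf : MemLp f ∞ (ballMeasure n))
    (hg : MemLp g ∞ (ballMeasure n)) : MemLp (fun z => f z * g z) ∞ (ballMeasure n) :=
  hg.mul hf

/-- Multiplication `M_f` on `L²(v_λ)` by a function `f ∈ L^∞(Bⁿ)`. -/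
noncomputable def mulOp (n : ℕ) (lam : ℝ) (f : Cn n → ℂ) (hf : MemLp f ∞ (ballMeasure n)) :
    Lp ℂ 2 (bergmanMeasure n lam) →L[ℂ] Lp ℂ 2 (bergmanMeasure n lam) :=
  (ContinuousLinearMap.mul ℂ ℂ).holderL (bergmanMeasure n lam) ∞ 2 2
    ((memLp_top_bergmanMeasure hf lam).toLp f)

/-- `M_f` is pointwise multiplication. -/
theorem coeFn_mulOp (n : ℕ) (lam : ℝ) (f : Cn n → ℂ) (hf : MemLp f ∞ (ballMeasure n))
    (F : Lp ℂ 2 (bergmanMeasure n lam)) :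
    mulOp n lam f hf F =ᵐ[bergmanMeasure n lam] fun z => f z * F z := by
  have h1 := (ContinuousLinearMap.mul ℂ ℂ).coeFn_holder (r := 2)
    ((memLp_top_bergmanMeasure hf lam).toLp f) F
  filter_upwards [h1, (memLp_top_bergmanMeasure hf lam).coeFn_toLp] with z hz hz'
  rw [← hz', ← ContinuousLinearMap.mul_apply' ℂ ℂ, ← hz]
  rfl

/-- The orthogonal projection `P_λ : L²(v_λ) → A²_λ`. -/
noncomputable def bergmanProj (n : ℕ) (lam : ℝ) :
    Lp ℂ 2 (bergmanMeasure n lam) →L[ℂ] bergmanSpace n lam :=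
  (bergmanSpace n lam).orthogonalProjectionOnto

/-- The Toeplitz operator `T_f^λ = P_λ M_f` on `A²_λ`, for `f ∈ L^∞(Bⁿ)`. -/
noncomputable def toeplitz (n : ℕ) (lam : ℝ) (f : Cn n → ℂ) (hf : MemLp f ∞ (ballMeasure n)) :
    bergmanSpace n lam →L[ℂ] bergmanSpace n lam :=
  bergmanProj n lam ∘L mulOp n lam f hf ∘L (bergmanSpace n lam).subtypeL

/-- The Hankel operator `H_f^λ = (I - P_λ) M_f : A²_λ → L²(v_λ)`, for `f ∈ L^∞(Bⁿ)`. -/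
noncomputable def hankel (n : ℕ) (lam : ℝ) (f : Cn n → ℂ) (hf : MemLp f ∞ (ballMeasure n)) :
    bergmanSpace n lam →L[ℂ] Lp ℂ 2 (bergmanMeasure n lam) :=
  (ContinuousLinearMap.id ℂ _ - (bergmanSpace n lam).subtypeL ∘L bergmanProj n lam) ∘L
    mulOp n lam f hf ∘L (bergmanSpace n lam).subtypeL

/-- For an arbitrary symbol `g`, the `u ∈ A²_λ` with `g u ∈ L²(v_λ)`. -/
noncomputable def toeplitzMaxDomain (n : ℕ) (lam : ℝ) (g : Cn n → ℂ) :
    Submodule ℂ (bergmanSpace n lam) where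
  carrier := {u | MemLp (fun z => g z * (u : Lp ℂ 2 (bergmanMeasure n lam)) z) 2
    (bergmanMeasure n lam)}
  add_mem' := by
    intro u v hu hv
    refine (MemLp.add hu hv).ae_eq ?_
    filter_upwards [Lp.coeFn_add (u : Lp ℂ 2 (bergmanMeasure n lam)) v] with z hz
    rw [Submodule.coe_add, hz]
    simp [mul_add]
  zero_mem' := by
    refine (MemLp.zero (ε := ℂ)).ae_eq ?_
    filter_upwards [Lp.coeFn_zero ℂ 2 (bergmanMeasure n lam)] with z hz
    rw [Submodule.coe_zero, hz]
    simp
  smul_mem' := by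
    intro c u hu
    refine (MemLp.const_smul hu c).ae_eq ?_
    filter_upwards [Lp.coeFn_smul c (u : Lp ℂ 2 (bergmanMeasure n lam))] with z hz
    rw [Submodule.coe_smul, hz]
    simp [mul_left_comm]

/-- `u ↦ g u`, from the `u ∈ A²_λ` with `g u ∈ L²(v_λ)` to `L²(v_λ)`. -/
noncomputable def mulOn (n : ℕ) (lam : ℝ) (g : Cn n → ℂ) :
    toeplitzMaxDomain n lam g →ₗ[ℂ] Lp ℂ 2 (bergmanMeasure n lam) where
  toFun u := MemLp.toLp (fun z => g z * (u.1 : Lp ℂ 2 (bergmanMeasure n lam)) z) u.2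
  map_add' u v := by
    refine Lp.ext ?_
    filter_upwards [MemLp.coeFn_toLp u.2, MemLp.coeFn_toLp v.2, MemLp.coeFn_toLp (u + v).2,
      Lp.coeFn_add (MemLp.toLp _ u.2) (MemLp.toLp _ v.2),
      Lp.coeFn_add (u.1 : Lp ℂ 2 (bergmanMeasure n lam)) v.1] with z h1 h2 h3 h4 h5
    rw [h3, h4, Pi.add_apply, h1, h2, Submodule.coe_add, Submodule.coe_add, h5, Pi.add_apply,
      mul_add]
  map_smul' c u := by
    refine Lp.ext ?_
    filter_upwards [MemLp.coeFn_toLp u.2, MemLp.coeFn_toLp (c • u).2,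
      Lp.coeFn_smul c (MemLp.toLp _ u.2),
      Lp.coeFn_smul c (u.1 : Lp ℂ 2 (bergmanMeasure n lam))] with z h1 h2 h3 h4
    rw [RingHom.id_apply, h2, h3, Pi.smul_apply, h1, Submodule.coe_smul, Submodule.coe_smul, h4,
      Pi.smul_apply, smul_eq_mul, smul_eq_mul, mul_left_comm]

/-- The possibly unbounded Toeplitz operator `u ↦ P_λ (g u)`, on its maximal domain. -/
noncomputable def toeplitzPMap (n : ℕ) (lam : ℝ) (g : Cn n → ℂ) :
    bergmanSpace n lam →ₗ.[ℂ] bergmanSpace n lam where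
  domain := toeplitzMaxDomain n lam g
  toFun := (bergmanProj n lam : Lp ℂ 2 (bergmanMeasure n lam) →ₗ[ℂ] bergmanSpace n lam) ∘ₗ
    mulOn n lam g

/-- The common domain `𝒟` for Toeplitz operators with unbounded symbols: all `u ∈ A²_λ` with
`|u(z)| ≤ C_ρ (1 - |z|²)^(-ρ)` on `Bⁿ` for every `ρ > 0`. -/
noncomputable def commonDomain (n : ℕ) (lam : ℝ) : Submodule ℂ (bergmanSpace n lam) where
  carrier := {u | ∃ F : Cn n → ℂ, DifferentiableOn ℂ F (unitBall n) ∧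
    (∀ ρ : ℝ, 0 < ρ → ∃ C : ℝ, ∀ z ∈ unitBall n, ‖F z‖ ≤ C * (1 - ‖z‖ ^ 2) ^ (-ρ)) ∧
    (u : Lp ℂ 2 (bergmanMeasure n lam)) =ᵐ[bergmanMeasure n lam] F}
  add_mem' := by
    rintro u v ⟨F, hF, hFb, huF⟩ ⟨G, hG, hGb, hvG⟩
    refine ⟨F + G, hF.add hG, fun ρ hρ => ?_, (Lp.coeFn_add _ _).trans (huF.add hvG)⟩
    obtain ⟨C, hC⟩ := hFb ρ hρ
    obtain ⟨D, hD⟩ := hGb ρ hρ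
    refine ⟨C + D, fun z hz => ?_⟩
    rw [add_mul]
    exact (norm_add_le _ _).trans (add_le_add (hC z hz) (hD z hz))
  zero_mem' := ⟨0, differentiableOn_const 0, fun ρ _ => ⟨0, by simp⟩, Lp.coeFn_zero _ _ _⟩
  smul_mem' := by
    rintro c u ⟨F, hF, hFb, huF⟩
    refine ⟨c • F, hF.const_smul c, fun ρ hρ => ?_, (Lp.coeFn_smul c _).trans (huF.const_smul c)⟩
    obtain ⟨C, hC⟩ := hFb ρ hρ
    refine ⟨‖c‖ * C, fun z hz => ?_⟩
    rw [Pi.smul_apply, norm_smul, mul_assoc]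
    gcongr
    exact hC z hz

/-- The semi-commutator `T_f^λ T_g^λ - T_{fg}^λ`, with `f` bounded and `g` possibly unbounded, as an
operator on the domain `𝒟` (intersected with the maximal domains of `T_g` and `T_{fg}`). -/
noncomputable def semiCommutatorOn (n : ℕ) (lam : ℝ) (f : Cn n → ℂ)
    (hf : MemLp f ∞ (ballMeasure n)) (g : Cn n → ℂ) :
    bergmanSpace n lam →ₗ.[ℂ] bergmanSpace n lam :=
  ((toeplitz n lam f hf : bergmanSpace n lam →ₗ[ℂ] bergmanSpace n lam).compPMap
      (toeplitzPMap n lam g) - toeplitzPMap n lam (fun z => f z * g z)).domRestrict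
    (commonDomain n lam)

/-- The operator norm of a partially defined linear operator, with value `∞` if it is unbounded. -/
noncomputable def opENorm {X Y : Type*} [NormedAddCommGroup X] [NormedSpace ℂ X]
    [NormedAddCommGroup Y] [NormedSpace ℂ Y] (T : X →ₗ.[ℂ] Y) : ℝ≥0∞ :=
  ⨆ (u : T.domain) (_ : ‖(u : X)‖ ≤ 1), ‖T u‖ₑ

/-- The reproducing kernel `K_λ(z,w) = (1 - ⟨z,w⟩)^(-λ)` of `A²_λ(Bⁿ)`; here `⟨z,w⟩ = ∑ z_j conj(w_j)`,
which is `inner ℂ w z` in Mathlib's convention. -/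
noncomputable def bergmanKernel (n : ℕ) (lam : ℝ) (z w : Cn n) : ℂ :=
  (1 - inner ℂ w z) ^ (-(lam : ℂ))

/-- `log K_p(z,z)` with `p = n + 1`; on the ball `K_p(z,z)` is a positive real number. -/
noncomputable def logKernel (n : ℕ) (z : Cn n) : ℂ :=
  (Real.log ‖bergmanKernel n (n + 1) z z‖ : ℝ)

/-- The Wirtinger derivative `∂/∂z_j = (∂/∂x_j - i ∂/∂y_j) / 2`. -/
noncomputable def wirtinger {n : ℕ} (j : Fin n) (F : Cn n → ℂ) (z : Cn n) : ℂ :=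
  (lineDeriv ℝ F z (EuclideanSpace.single j 1) -
    Complex.I * lineDeriv ℝ F z (EuclideanSpace.single j Complex.I)) / 2

/-- The Wirtinger derivative `∂/∂z̄_j = (∂/∂x_j + i ∂/∂y_j) / 2`. -/
noncomputable def wirtingerBar {n : ℕ} (j : Fin n) (F : Cn n → ℂ) (z : Cn n) : ℂ :=
  (lineDeriv ℝ F z (EuclideanSpace.single j 1) +
    Complex.I * lineDeriv ℝ F z (EuclideanSpace.single j Complex.I)) / 2

/-- The Bergman metric tensor `g_ij(z) = ∂²/∂z_i ∂z̄_j log K_p(z,z)`. -/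
noncomputable def metricTensor (n : ℕ) (z : Cn n) : Matrix (Fin n) (Fin n) ℂ :=
  Matrix.of fun i j => wirtinger i (wirtingerBar j (logKernel n)) z

/-- The length of the tangent vector `v` at `z` in the Bergman metric. -/
noncomputable def bergmanNorm (n : ℕ) (z v : Cn n) : ℝ :=
  Real.sqrt (∑ i, ∑ j, metricTensor n z i j * v i * star (v j)).re

/-- The Bergman length of a curve parametrized by `[0,1]`. -/
noncomputable def bergmanLength (n : ℕ) (γ : ℝ → Cn n) : ℝ :=
  ∫ t in (0 : ℝ)..1, bergmanNorm n (γ t) (derivWithin γ (Set.Icc 0 1) t)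

/-- The Bergman distance `β(z,w)`: the infimum of the lengths of `C¹` curves in `Bⁿ` from `z` to `w`. -/
noncomputable def bergmanDist (n : ℕ) (z w : Cn n) : ℝ :=
  sInf {L | ∃ γ : ℝ → Cn n, ContDiffOn ℝ 1 γ (Set.Icc 0 1) ∧
    (∀ t ∈ Set.Icc (0 : ℝ) 1, γ t ∈ unitBall n) ∧ γ 0 = z ∧ γ 1 = w ∧ L = bergmanLength n γ}

/-- `g ∈ UC(Bⁿ)`: `g` is uniformly continuous on `Bⁿ` with respect to `β` (possibly unbounded).
Functions on `Bⁿ` are given by functions on `ℂⁿ` whose values off the ball play no role. -/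
def IsUC (n : ℕ) (g : Cn n → ℂ) : Prop :=
  ∀ ε > 0, ∃ δ > 0, ∀ z ∈ unitBall n, ∀ w ∈ unitBall n, bergmanDist n z w < δ → ‖g z - g w‖ < ε

/-- The Bergman ball `E(x,ρ)`. -/
def bergmanBall (n : ℕ) (x : Cn n) (ρ : ℝ) : Set (Cn n) :=
  {y ∈ unitBall n | bergmanDist n x y < ρ}

/-- The average of `f` over `E(x,ρ)`. -/
noncomputable def ballAverage (n : ℕ) (f : Cn n → ℂ) (x : Cn n) (ρ : ℝ) : ℂ :=
  ⨍ y in bergmanBall n x ρ, f y ∂(ballMeasure n)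

/-- The mean oscillation `A₂(f,ρ,x)`. -/
noncomputable def meanOsc (n : ℕ) (f : Cn n → ℂ) (ρ : ℝ) (x : Cn n) : ℝ :=
  ⨍ y in bergmanBall n x ρ, ‖f y - ballAverage n f x ρ‖ ^ 2 ∂(ballMeasure n)

/-- `f ∈ VMO(Bⁿ)`: `f ∈ L^∞(Bⁿ)` and `A₂(f,ρ,x) → 0` as `ρ → 0`, uniformly in `x ∈ Bⁿ`. -/
structure IsVMO (n : ℕ) (f : Cn n → ℂ) : Prop where
  memLp : MemLp f ∞ (ballMeasure n)
  tendsto : TendstoUniformlyOn (meanOsc n f) (fun _ => 0) (𝓝[>] 0) (unitBall n)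

end BergmanBall

open BergmanBall

/-! The reproducing kernel of A²_λ concentrates at pseudohyperbolic distance of order r = λ^(-1/2),
so for large λ the Hankel operator feels only the oscillation of f at that scale. Write d(z,w) =
‖`mob z w`‖ and let μ be the Möbius invariant measure `invMeasure`. The exact identity |K_λ(z,w)|
(1-|z|²)^(λ/2) (1-|w|²)^(λ/2) = (1-d²)^(λ/2) turns kernel estimates into one-variable estimates in
d.

The symbol is split as f = f_r + (f - f_r), where f_r is the mean of f over pseudohyperbolic balls
of radius r (`pmean`). If f oscillates by at most ε in mean square over balls of radius 4r, then f_r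
varies by O(ε) over distances r. Chaining along radii gives |f_r(z) - f_r(w)| ≤ Cε (1-d²)^(-λ/4).
Since (I-P)(f_r u)(z) is the integral of the conjugated kernel against (f_r(z) - f_r(w)) u(w),
Schur's test with the invariant kernel (1-d²)^(λ/4) bounds this part (`enorm_sub_bergmanProj_le`).
Its loss, `defInt n (lam/4)` over `defInt n lam`, is bounded because both masses are of order λ^(-n)
(`exists_defInt_le`). The remainder f - f_r has mean square O(ε²) on balls of radius r. The
sub-mean-value inequality for |u|² (1-|z|²)^λ at that scale and a Carleson argument give ‖(f -
f_r)u‖ ≤ Cε‖u‖ (`lintegral_enorm_sq_mul_le`).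

The VMO condition is stated with Bergman balls and Lebesgue measure. An explicit computation of the
metric shows that small Bergman and pseudohyperbolic balls of comparable radii are nested, and the
density of μ is almost constant on them, so the condition passes to μ and d.

Finally T_f T_g - T_{fg} = -P M_f (I-P) M_g, and P M_f on the orthogonal complement of A²_λ is the
adjoint of the Hankel operator of the conjugate of f, which is again VMO. So this factor tends to 0,
while (I-P) M_g stays bounded as λ → ∞: trivially for bounded g, and for uniformly continuous g by
the Schur estimate at a fixed radius. -/

namespace BergmanBall

variable {n : ℕ}

/-! ### Möbius automorphisms of the ball and the pseudohyperbolic distance -/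

/-- The involutive automorphism of the unit ball that exchanges `0` and `x`. -/
noncomputable def mob (x w : Cn n) : Cn n :=
  -- With s = √(1-|x|²), the usual formula involves (1-s)/|x|² times the component along x. Writing
  -- this factor as 1/(1+s) makes the formula valid at x = 0 as well.
  (1 - inner ℂ x w)⁻¹ •
    ((1 - inner ℂ x w / (1 + (Real.sqrt (1 - ‖x‖ ^ 2) : ℂ))) • x - (Real.sqrt (1 - ‖x‖ ^ 2) : ℂ) • w)

theorem one_sub_normSq_pos {x : Cn n} (hx : ‖x‖ < 1) : 0 < 1 - ‖x‖ ^ 2 := by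
  nlinarith [norm_nonneg x]

theorem norm_inner_lt_one {x w : Cn n} (hx : ‖x‖ < 1) (hw : ‖w‖ < 1) : ‖inner ℂ x w‖ < 1 :=
  (norm_inner_le_norm x w).trans_lt
    ((mul_le_mul_of_nonneg_left hw.le (norm_nonneg _)).trans_lt (by linarith))

theorem one_sub_inner_re_pos {x w : Cn n} (hx : ‖x‖ < 1) (hw : ‖w‖ < 1) :
    0 < (1 - inner ℂ x w).re := by
  have h := (Complex.re_le_norm (inner ℂ x w)).trans_lt (norm_inner_lt_one hx hw)
  rw [Complex.sub_re, Complex.one_re]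
  linarith

theorem one_sub_inner_ne_zero {x w : Cn n} (hx : ‖x‖ < 1) (hw : ‖w‖ < 1) :
    (1 - inner ℂ x w : ℂ) ≠ 0 := fun h => by
  have := one_sub_inner_re_pos hx hw
  simp [h] at this

theorem norm_one_sub_inner_comm (x w : Cn n) :
    ‖(1 - inner ℂ x w : ℂ)‖ = ‖(1 - inner ℂ w x : ℂ)‖ := by
  rw [← inner_conj_symm x w, ← RCLike.norm_conj (1 - inner ℂ w x : ℂ)]
  simp

theorem sqrt_sq_eq {x : Cn n} (hx : ‖x‖ < 1) :
    (Real.sqrt (1 - ‖x‖ ^ 2) : ℂ) ^ 2 = 1 - (‖x‖ : ℂ) ^ 2 := by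
  rw [← Complex.ofReal_pow, Real.sq_sqrt (one_sub_normSq_pos hx).le]
  push_cast
  rfl

theorem one_add_sqrt_ne_zero (x : Cn n) : (1 + (Real.sqrt (1 - ‖x‖ ^ 2) : ℂ)) ≠ 0 := by
  have : (1 + Real.sqrt (1 - ‖x‖ ^ 2)) ≠ 0 := by positivity
  exact_mod_cast this

theorem sqrt_ne_zero' {x : Cn n} (hx : ‖x‖ < 1) : (Real.sqrt (1 - ‖x‖ ^ 2) : ℂ) ≠ 0 := by
  have : Real.sqrt (1 - ‖x‖ ^ 2) ≠ 0 := (Real.sqrt_pos.2 (one_sub_normSq_pos hx)).ne'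
  exact_mod_cast this

/-- The basic identity of the automorphism. After substituting |x|² = 1 - s² both sides are rational
in s and the three inner products, so the claim is pure algebra. Invariance of the distance, of the
measure and of the kernel all come from it. -/
theorem one_sub_inner_mob {x w z : Cn n} (hx : ‖x‖ < 1) (hw : ‖w‖ < 1) (hz : ‖z‖ < 1) :
    1 - inner ℂ (mob x w) (mob x z) =
      (1 - (‖x‖ : ℂ) ^ 2) * (1 - inner ℂ w z) / ((1 - inner ℂ w x) * (1 - inner ℂ x z)) := by
  have h1 := one_sub_inner_ne_zero hx hz
  have h2 := one_sub_inner_ne_zero hw hx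
  have h3 := one_add_sqrt_ne_zero x
  have h4 := sqrt_sq_eq hx
  have h5 : (‖x‖ : ℂ) ^ 2 = 1 - (Real.sqrt (1 - ‖x‖ ^ 2) : ℂ) ^ 2 := by rw [h4]; ring
  simp only [mob, inner_smul_left, inner_smul_right, inner_sub_left, inner_sub_right, map_inv₀,
    map_sub, map_one, map_div₀, map_add, Complex.conj_ofReal, inner_conj_symm,
    inner_self_eq_norm_sq_to_K]
  have h6 : ((‖x‖ : ℝ) : ℂ) ^ 2 = ((RCLike.ofReal ‖x‖ : ℂ)) ^ 2 := rfl
  rw [← h6, h5]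
  field_simp
  ring

theorem one_sub_normSq_mob {x w : Cn n} (hx : ‖x‖ < 1) (hw : ‖w‖ < 1) :
    1 - ‖mob x w‖ ^ 2 = (1 - ‖x‖ ^ 2) * (1 - ‖w‖ ^ 2) / ‖(1 - inner ℂ x w : ℂ)‖ ^ 2 := by
  have h := one_sub_inner_mob hx hw hw
  have e1 : ∀ y : Cn n, (1 - inner ℂ y y : ℂ) = ((1 - ‖y‖ ^ 2 : ℝ) : ℂ) := fun y => by
    rw [inner_self_eq_norm_sq_to_K]; push_cast; rfl
  have e2 : (1 - inner ℂ w x : ℂ) * (1 - inner ℂ x w) = ((‖(1 - inner ℂ x w : ℂ)‖ ^ 2 : ℝ) : ℂ) := by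
    have : (1 - inner ℂ w x : ℂ) = (starRingEnd ℂ) (1 - inner ℂ x w) := by simp
    rw [this, Complex.conj_mul']
    push_cast; rfl
  rw [e1, e1, e2] at h
  have h7 : (1 - (‖x‖ : ℂ) ^ 2) = ((1 - ‖x‖ ^ 2 : ℝ) : ℂ) := by push_cast; rfl
  rw [h7] at h
  exact_mod_cast h

theorem norm_mob_lt_one {x w : Cn n} (hx : ‖x‖ < 1) (hw : ‖w‖ < 1) : ‖mob x w‖ < 1 := by
  have h := one_sub_normSq_mob hx hw
  have h1 : 0 < ‖(1 - inner ℂ x w : ℂ)‖ := norm_pos_iff.2 (one_sub_inner_ne_zero hx hw)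
  have h2 : 0 < 1 - ‖mob x w‖ ^ 2 := by
    rw [h]
    have := one_sub_normSq_pos hx
    have := one_sub_normSq_pos hw
    positivity
  nlinarith [norm_nonneg (mob x w)]

@[simp] theorem mob_zero (x : Cn n) : mob x 0 = x := by simp [mob]

@[simp] theorem mob_zero_left (w : Cn n) : mob 0 w = -w := by simp [mob]

theorem one_sub_inner_mob_left {x z : Cn n} (hx : ‖x‖ < 1) (hz : ‖z‖ < 1) :
    1 - inner ℂ x (mob x z) = (1 - (‖x‖ : ℂ) ^ 2) / (1 - inner ℂ x z) := by
  have h := one_sub_inner_mob hx (w := 0) (by simp) hz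
  simpa using h

theorem mob_mob {x w : Cn n} (hx : ‖x‖ < 1) (hw : ‖w‖ < 1) : mob x (mob x w) = w := by
  have h1 := one_sub_inner_ne_zero hx hw
  have h3 := one_add_sqrt_ne_zero x
  have h4 := sqrt_sq_eq hx
  have h5 := sqrt_ne_zero' hx
  have h6 := one_sub_inner_mob_left hx hw
  have h7 : inner ℂ x (mob x w) = 1 - (Real.sqrt (1 - ‖x‖ ^ 2) : ℂ) ^ 2 / (1 - inner ℂ x w) := by
    rw [h4, ← h6]; ring
  rw [mob, h7, mob]
  set s : ℂ := (Real.sqrt (1 - ‖x‖ ^ 2) : ℂ)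
  set α : ℂ := inner ℂ x w
  have h8 : (1 - (1 - s ^ 2 / (1 - α))) = s ^ 2 / (1 - α) := sub_sub_cancel _ _
  rw [h8]
  match_scalars
  · field_simp
    ring
  · field_simp

theorem norm_mob_comm {x w : Cn n} (hx : ‖x‖ < 1) (hw : ‖w‖ < 1) : ‖mob x w‖ = ‖mob w x‖ := by
  have h1 := one_sub_normSq_mob hx hw
  have h2 := one_sub_normSq_mob hw hx
  rw [norm_one_sub_inner_comm, mul_comm] at h1
  rw [← h2] at h1
  have : ‖mob x w‖ ^ 2 = ‖mob w x‖ ^ 2 := by linarith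
  exact (pow_left_inj₀ (norm_nonneg _) (norm_nonneg _) two_ne_zero).1 this

/-- Invariance of the pseudohyperbolic distance. Only 1 - ‖·‖² is compared, where all factors
involving x cancel; the unitary relating the two points never has to be identified. -/
theorem norm_mob_mob {x z w : Cn n} (hx : ‖x‖ < 1) (hz : ‖z‖ < 1) (hw : ‖w‖ < 1) :
    ‖mob (mob x z) (mob x w)‖ = ‖mob z w‖ := by
  have h1 := one_sub_normSq_mob (norm_mob_lt_one hx hz) (norm_mob_lt_one hx hw)
  have h2 := one_sub_normSq_mob hz hw
  have h3 : ‖((1 : ℂ) - (‖x‖ : ℂ) ^ 2)‖ = 1 - ‖x‖ ^ 2 := by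
    rw [← Complex.ofReal_pow, ← Complex.ofReal_one, ← Complex.ofReal_sub, Complex.norm_real,
      Real.norm_of_nonneg (one_sub_normSq_pos hx).le]
  rw [one_sub_inner_mob hx hz hw, norm_div, norm_mul, norm_mul, h3, one_sub_normSq_mob hx hz,
    one_sub_normSq_mob hx hw, norm_one_sub_inner_comm x z] at h1
  have p1 := (norm_pos_iff.2 (one_sub_inner_ne_zero hz hx)).ne'
  have p2 := (norm_pos_iff.2 (one_sub_inner_ne_zero hx hw)).ne'
  have p3 := (norm_pos_iff.2 (one_sub_inner_ne_zero hz hw)).ne'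
  have p4 := (one_sub_normSq_pos hx).ne'
  have : ‖mob (mob x z) (mob x w)‖ ^ 2 = ‖mob z w‖ ^ 2 := by
    have : 1 - ‖mob (mob x z) (mob x w)‖ ^ 2 = 1 - ‖mob z w‖ ^ 2 := by
      rw [h1, h2]
      field_simp
    linarith
  exact (pow_left_inj₀ (norm_nonneg _) (norm_nonneg _) two_ne_zero).1 this

/-- The pseudo-hyperbolic distance in terms of the radial and the full Euclidean displacement. -/
theorem normSq_mob_mul {x y : Cn n} (hx : ‖x‖ < 1) (hy : ‖y‖ < 1) :
    ‖mob x y‖ ^ 2 * ‖(1 - inner ℂ x y : ℂ)‖ ^ 2 =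
      (1 - ‖x‖ ^ 2) * ‖y - x‖ ^ 2 + ‖(inner ℂ x (y - x) : ℂ)‖ ^ 2 := by
  have h1 := one_sub_normSq_mob hx hy
  have p := (norm_pos_iff.2 (one_sub_inner_ne_zero hx hy)).ne'
  rw [eq_div_iff (pow_ne_zero 2 p)] at h1
  have e : (inner ℂ x (y - x) : ℂ) = inner ℂ x y - ((‖x‖ ^ 2 : ℝ) : ℂ) := by
    rw [inner_sub_right, inner_self_eq_norm_sq_to_K]; push_cast; rfl
  have e2 : ‖y - x‖ ^ 2 = ‖y‖ ^ 2 - 2 * (inner ℂ x y : ℂ).re + ‖x‖ ^ 2 := by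
    rw [norm_sub_sq (𝕜 := ℂ), ← inner_conj_symm y x]
    simp only [Complex.conj_re, RCLike.re_to_complex]
  rw [e, e2]
  rw [Complex.sq_norm, Complex.normSq_apply] at h1 ⊢
  rw [Complex.sq_norm, Complex.normSq_apply]
  simp only [Complex.sub_re, Complex.sub_im, Complex.one_re, Complex.one_im, Complex.ofReal_re,
    Complex.ofReal_im] at h1 ⊢
  linear_combination (-1) * h1

theorem norm_mob_le_of_norm_le {a b : Cn n} {r : ℝ} (hr : r ≤ 1 / 2) (ha : ‖a‖ ≤ r)
    (hb : ‖b‖ ≤ r) : ‖mob a b‖ ≤ 3 * r := by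
  have hr0 : 0 ≤ r := (norm_nonneg _).trans ha
  have ha1 : ‖a‖ < 1 := by linarith
  have hb1 : ‖b‖ < 1 := by linarith
  have h := normSq_mob_mul ha1 hb1
  have h1 : ‖(inner ℂ a (b - a) : ℂ)‖ ^ 2 ≤ ‖a‖ ^ 2 * ‖b - a‖ ^ 2 := by
    rw [← mul_pow]; gcongr; exact norm_inner_le_norm _ _
  have h2 : 3 / 4 ≤ ‖(1 - inner ℂ a b : ℂ)‖ := by
    have h3 : ‖(inner ℂ a b : ℂ)‖ ≤ 1 / 4 := by
      refine (norm_inner_le_norm _ _).trans ?_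
      calc ‖a‖ * ‖b‖ ≤ (1 / 2) * (1 / 2) := by gcongr <;> linarith
        _ = 1 / 4 := by norm_num
    have h4 := norm_sub_norm_le (1 : ℂ) (inner ℂ a b)
    rw [norm_one] at h4
    linarith
  have h5 : ‖b - a‖ ≤ 2 * r := (norm_sub_le _ _).trans (by linarith)
  have h6 : (‖mob a b‖ * ‖(1 - inner ℂ a b : ℂ)‖) ^ 2 ≤ (2 * r) ^ 2 := by
    rw [mul_pow, h]
    calc _ ≤ ‖b - a‖ ^ 2 := by linarith
      _ ≤ _ := by gcongr
  have h7 := abs_le_of_sq_le_sq' h6 (by linarith)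
  nlinarith [h7.2, norm_nonneg (mob a b)]

/-- A crude triangle inequality. Transport by `mob x` puts the common centre at the origin, where
pseudohyperbolic and Euclidean distances are comparable; the factor 3 leaves room for the
denominator |1 - ⟨a,b⟩| ≥ 3/4. -/
theorem norm_mob_le_of_norm_mob_le {x y z : Cn n} {r : ℝ} (hr : r ≤ 1 / 2) (hx : ‖x‖ < 1)
    (hy : ‖y‖ < 1) (hz : ‖z‖ < 1) (h1 : ‖mob x y‖ ≤ r) (h2 : ‖mob x z‖ ≤ r) :
    ‖mob y z‖ ≤ 3 * r := by
  rw [← norm_mob_mob hx hy hz]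
  exact norm_mob_le_of_norm_le hr h1 h2

/-! ### The Jacobian of the automorphisms and the invariant measure -/

theorem measurable_mob_uncurry : Measurable (fun p : Cn n × Cn n => mob p.1 p.2) := by
  unfold mob
  fun_prop

theorem measurable_mob (x : Cn n) : Measurable (mob x) := by
  unfold mob
  fun_prop

/-- The derivative is arranged as a scalar times (identity + rank one), so that its determinant can
be read off as that of a scaled transvection. -/
theorem hasFDerivAt_mob {x w : Cn n} (hx : ‖x‖ < 1) (hw : ‖w‖ < 1) :
    HasFDerivAt (mob x)
      ((-(Real.sqrt (1 - ‖x‖ ^ 2) : ℂ) / (1 - inner ℂ x w)) •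
        (ContinuousLinearMap.id ℂ (Cn n) + (innerSL ℂ x).smulRight
          ((-(Real.sqrt (1 - ‖x‖ ^ 2) : ℂ))⁻¹ •
            (mob x w - (1 + (Real.sqrt (1 - ‖x‖ ^ 2) : ℂ))⁻¹ • x)))) w := by
  have h1 := one_sub_inner_ne_zero hx hw
  have h5 := sqrt_ne_zero' hx
  have hi : HasFDerivAt (fun w : Cn n => (inner ℂ x w : ℂ)) (innerSL ℂ x) w :=
    (innerSL ℂ x).hasFDerivAt
  have hd : HasFDerivAt (fun w : Cn n => (1 - inner ℂ x w : ℂ)⁻¹)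
      (((1 - inner ℂ x w : ℂ) ^ 2)⁻¹ • innerSL ℂ x) w := by
    have := (hasDerivAt_inv h1).comp_hasFDerivAt w (hi.const_sub 1)
    refine HasFDerivAt.congr_fderiv this ?_
    ext1 v
    simp
  have hA : HasFDerivAt (fun w : Cn n =>
      (1 - inner ℂ x w / (1 + (Real.sqrt (1 - ‖x‖ ^ 2) : ℂ))) • x -
        (Real.sqrt (1 - ‖x‖ ^ 2) : ℂ) • w)
      ((-((1 + (Real.sqrt (1 - ‖x‖ ^ 2) : ℂ))⁻¹ • innerSL ℂ x)).smulRight x -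
        (Real.sqrt (1 - ‖x‖ ^ 2) : ℂ) • ContinuousLinearMap.id ℂ (Cn n)) w := by
    refine HasFDerivAt.sub ?_ ((ContinuousLinearMap.id ℂ (Cn n)).hasFDerivAt.const_smul (Real.sqrt (1 - ‖x‖ ^ 2) : ℂ))
    have := (((hi.mul_const (1 + (Real.sqrt (1 - ‖x‖ ^ 2) : ℂ))⁻¹)).const_sub 1).smul_const x
    simpa [div_eq_mul_inv] using this
  have := hd.smul hA
  refine this.congr_fderiv ?_
  ext1 v
  have h3 := one_add_sqrt_ne_zero x
  simp only [_root_.add_apply, _root_.smul_apply, _root_.sub_apply, _root_.neg_apply,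
    ContinuousLinearMap.smulRight_apply, ContinuousLinearMap.id_apply, innerSL_apply_apply, mob]
  set s : ℂ := (Real.sqrt (1 - ‖x‖ ^ 2) : ℂ)
  set α : ℂ := inner ℂ x w
  set b : ℂ := inner ℂ x v
  clear_value s α b
  simp only [smul_eq_mul]
  match_scalars <;> field_simp
  ring

/-- The scalar factor contributes n powers of s/|1 - ⟨w,x⟩| in modulus. The transvection contributes
one more, since 1 + ⟨v,x⟩ = s/(1 - ⟨w,x⟩) for its vector v. -/
theorem det_mob_fderiv {x w : Cn n} (hx : ‖x‖ < 1) (hw : ‖w‖ < 1) :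
    ∃ D : Cn n →L[ℂ] Cn n, HasFDerivAt (mob x) D w ∧
      ‖(D : Cn n →ₗ[ℂ] Cn n).det‖ = Real.sqrt (1 - ‖x‖ ^ 2) ^ (n + 1) / ‖(1 - inner ℂ x w : ℂ)‖ ^ (n + 1) := by
  refine ⟨_, hasFDerivAt_mob hx hw, ?_⟩
  have h1 := one_sub_inner_ne_zero hx hw
  have h3 := one_add_sqrt_ne_zero x
  have h4 := sqrt_sq_eq hx
  have h5 := sqrt_ne_zero' hx
  have h6 := one_sub_inner_mob_left hx hw
  set s' := Real.sqrt (1 - ‖x‖ ^ 2) with hs'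
  set s : ℂ := (s' : ℂ) with hs
  set v : Cn n := (-s)⁻¹ • (mob x w - (1 + s)⁻¹ • x) with hv
  have e : ((((-s) / (1 - inner ℂ x w)) • (ContinuousLinearMap.id ℂ (Cn n) +
      (innerSL ℂ x).smulRight v) : Cn n →L[ℂ] Cn n) : Cn n →ₗ[ℂ] Cn n) =
      ((-s) / (1 - inner ℂ x w)) • LinearMap.transvection (innerSL ℂ x : Cn n →ₗ[ℂ] ℂ) v := by
    ext1 y
    simp [LinearMap.transvection.apply]
  rw [e, LinearMap.det_smul, LinearMap.transvection.det]
  have h7 : inner ℂ x (mob x w) = 1 - s ^ 2 / (1 - inner ℂ x w) := by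
    rw [h4, ← h6]; ring
  have h8 : (1 : ℂ) + (innerSL ℂ x : Cn n →ₗ[ℂ] ℂ) v = s / (1 - inner ℂ x w) := by
    have : (innerSL ℂ x : Cn n →ₗ[ℂ] ℂ) v = inner ℂ x v := rfl
    rw [this, hv, inner_smul_right, inner_sub_right, inner_smul_right, h7,
      inner_self_eq_norm_sq_to_K]
    have h9 : ((RCLike.ofReal ‖x‖ : ℂ)) ^ 2 = 1 - s ^ 2 := by rw [h4]; simp
    rw [h9]
    field_simp
    ring
  have h10 : 0 ≤ s' := Real.sqrt_nonneg _
  rw [h8, finrank_euclideanSpace_fin, norm_mul, norm_pow, norm_div, norm_div, norm_neg, hs,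
    Complex.norm_real, Real.norm_of_nonneg h10, pow_succ,
    pow_succ, div_pow, mul_div_mul_comm]

/-- The Möbius invariant measure `(1 - |z|²)^(-(n+1)) dz` on the unit ball. -/
noncomputable def invMeasure (n : ℕ) : Measure (Cn n) :=
  (volume.restrict (unitBall n)).withDensity
    fun z => ENNReal.ofReal (((1 - ‖z‖ ^ 2) ^ (n + 1))⁻¹)

theorem mob_image_unitBall {x : Cn n} (hx : ‖x‖ < 1) : mob x '' unitBall n = unitBall n := by
  ext w
  constructor
  · rintro ⟨z, hz, rfl⟩
    simpa using norm_mob_lt_one hx (by simpa using hz)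
  · intro hw
    have hw' : ‖w‖ < 1 := by simpa using hw
    exact ⟨mob x w, by simpa using norm_mob_lt_one hx hw', mob_mob hx hw'⟩

/-- Change of variables. The real Jacobian is the squared modulus of the complex one,
((1-|x|²)/|1-⟨w,x⟩|²)^(n+1), and by `one_sub_normSq_mob` the density at `mob x w` cancels it
exactly. -/
theorem lintegral_mob {x : Cn n} (hx : ‖x‖ < 1) {F : Cn n → ℝ≥0∞} (hF : Measurable F) :
    ∫⁻ w, F (mob x w) ∂(invMeasure n) = ∫⁻ w, F w ∂(invMeasure n) := by
  have hm : Measurable fun z : Cn n => ENNReal.ofReal (((1 - ‖z‖ ^ 2) ^ (n + 1))⁻¹) := by fun_prop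
  rw [invMeasure, lintegral_withDensity_eq_lintegral_mul _ hm hF,
    lintegral_withDensity_eq_lintegral_mul _ hm (show Measurable fun w => F (mob x w) from
      hF.comp (measurable_mob x))]
  have hinj : Set.InjOn (mob x) (unitBall n) := by
    intro a ha b hb hab
    have := congrArg (mob x) hab
    rwa [mob_mob hx (by simpa using ha), mob_mob hx (by simpa using hb)] at this
  have hex : ∀ w ∈ unitBall n, ∃ D : Cn n →L[ℂ] Cn n, HasFDerivAt (mob x) D w ∧
      ‖(D : Cn n →ₗ[ℂ] Cn n).det‖ =
        Real.sqrt (1 - ‖x‖ ^ 2) ^ (n + 1) / ‖(1 - inner ℂ x w : ℂ)‖ ^ (n + 1) :=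
    fun w hw => det_mob_fderiv hx (by simpa using hw)
  choose! D hD hdet using hex
  have key := lintegral_image_eq_lintegral_abs_det_fderiv_mul volume
    (measurableSet_ball (x := (0 : Cn n)) (ε := 1)) (f := mob x)
    (f' := fun w => (D w).restrictScalars ℝ)
    (fun w hw => ((hD w hw).restrictScalars ℝ).hasFDerivWithinAt) hinj
    (fun z => ENNReal.ofReal (((1 - ‖z‖ ^ 2) ^ (n + 1))⁻¹) * F z)
  rw [mob_image_unitBall hx] at key
  simp only [Pi.mul_apply]
  rw [key]
  refine setLIntegral_congr_fun measurableSet_ball fun w hw => ?_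
  have hw' : ‖w‖ < 1 := by simpa using hw
  have hdR : |((D w).restrictScalars ℝ).det| =
      (Real.sqrt (1 - ‖x‖ ^ 2) ^ (n + 1) / ‖(1 - inner ℂ x w : ℂ)‖ ^ (n + 1)) ^ 2 := by
    have : ((D w).restrictScalars ℝ).det = Complex.normSq ((D w : Cn n →ₗ[ℂ] Cn n).det) := by
      rw [← Algebra.norm_complex_apply, ← LinearMap.det_restrictScalars]
      rfl
    rw [this, ← hdet w hw, Complex.normSq_eq_norm_sq, abs_of_nonneg (by positivity)]
  rw [hdR, one_sub_normSq_mob hx hw', ← mul_assoc, ← ENNReal.ofReal_mul (by positivity)]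
  congr 2
  have p := (norm_pos_iff.2 (one_sub_inner_ne_zero hx hw')).ne'
  have p1 := (one_sub_normSq_pos hw').ne'
  have p2 := (one_sub_normSq_pos hx).ne'
  rw [div_pow (Real.sqrt _ ^ _), ← pow_mul, mul_comm (n + 1) 2, pow_mul,
    Real.sq_sqrt (one_sub_normSq_pos hx).le, div_pow, mul_pow, ← pow_mul]
  field_simp
  ring

theorem measurePreserving_mob {x : Cn n} (hx : ‖x‖ < 1) :
    MeasurePreserving (mob x) (invMeasure n) (invMeasure n) := by
  refine ⟨measurable_mob x, ?_⟩
  refine Measure.ext fun s hs => ?_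
  rw [Measure.map_apply (measurable_mob x) hs, ← lintegral_indicator_one hs,
    ← lintegral_indicator_one (measurable_mob x hs), 
    ← lintegral_mob hx (measurable_one.indicator hs)]
  rfl

theorem ae_invMeasure_norm_lt (n : ℕ) : ∀ᵐ z ∂(invMeasure n), ‖z‖ < 1 := by
  refine (withDensity_absolutelyContinuous _ _).ae_le ?_
  filter_upwards [ae_restrict_mem measurableSet_ball] with z hz
  simpa using hz

instance : SFinite (invMeasure n) := by
  unfold invMeasure
  infer_instance

theorem finrank_real_Cn (n : ℕ) : Module.finrank ℝ (Cn n) = 2 * n := by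
  rw [finrank_real_of_complex, finrank_euclideanSpace_fin]

/-! ### Weighted total masses and their size for large λ -/

/-- The power `(1 - |z|²)^a` of the defining function. -/
noncomputable def defPow (a : ℝ) (z : Cn n) : ℝ≥0∞ := ENNReal.ofReal ((1 - ‖z‖ ^ 2) ^ a)

theorem measurable_defPow (a : ℝ) : Measurable (defPow a : Cn n → ℝ≥0∞) := by
  unfold defPow
  fun_prop

theorem defPow_ne_zero {a : ℝ} {z : Cn n} (hz : ‖z‖ < 1) : defPow a z ≠ 0 := by
  have := Real.rpow_pos_of_pos (one_sub_normSq_pos hz) a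
  simpa [defPow] using this

theorem defPow_ne_top {a : ℝ} {z : Cn n} : defPow a z ≠ ∞ := ENNReal.ofReal_ne_top

theorem defPow_add {a b : ℝ} {z : Cn n} (hz : ‖z‖ < 1) :
    defPow (a + b) z = defPow a z * defPow b z := by
  rw [defPow, defPow, defPow, Real.rpow_add (one_sub_normSq_pos hz),
    ENNReal.ofReal_mul (Real.rpow_nonneg (one_sub_normSq_pos hz).le _)]

theorem defPow_anti {a b : ℝ} (hab : a ≤ b) {z : Cn n} (hz : ‖z‖ < 1) :
    defPow b z ≤ defPow a z :=
  ENNReal.ofReal_le_ofReal (Real.rpow_le_rpow_of_exponent_ge (one_sub_normSq_pos hz)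
    (by nlinarith [norm_nonneg z]) hab)

/-- The total mass of `(1 - |z|²)^a` for the invariant measure. -/
noncomputable def defInt (n : ℕ) (a : ℝ) : ℝ≥0∞ := ∫⁻ z, defPow a z ∂(invMeasure n)

theorem invMeasure_eq (n : ℕ) :
    invMeasure n = (volume.restrict (unitBall n)).withDensity (defPow (-(n + 1))) := by
  rw [invMeasure]
  refine withDensity_congr_ae ?_
  filter_upwards [ae_restrict_mem measurableSet_ball] with z hz
  have hz' : ‖z‖ < 1 := by simpa using hz
  rw [defPow, Real.rpow_neg (one_sub_normSq_pos hz').le]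
  norm_cast

theorem withDensity_defPow_invMeasure (n : ℕ) (a : ℝ) :
    (invMeasure n).withDensity (defPow a) =
      (volume.restrict (unitBall n)).withDensity (defPow (a - (n + 1))) := by
  rw [invMeasure_eq, ← withDensity_mul _ (measurable_defPow _) (measurable_defPow _)]
  refine withDensity_congr_ae ?_
  filter_upwards [ae_restrict_mem measurableSet_ball] with z hz
  have hz' : ‖z‖ < 1 := by simpa using hz
  rw [Pi.mul_apply, ← defPow_add hz']
  congr 1
  ring

theorem defInt_eq (n : ℕ) (a : ℝ) :
    defInt n a = ∫⁻ z in unitBall n, defPow (a - (n + 1)) z := by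
  have h := congrArg (fun m : Measure (Cn n) => m Set.univ) (withDensity_defPow_invMeasure n a)
  simpa [withDensity_apply, defInt] using h

theorem defInt_ne_zero (n : ℕ) (a : ℝ) : defInt n a ≠ 0 := by
  rw [defInt_eq]
  intro h
  rw [lintegral_eq_zero_iff (measurable_defPow _)] at h
  have h1 : ∀ᵐ z ∂(volume.restrict (unitBall n)), False := by
    filter_upwards [h, ae_restrict_mem measurableSet_ball] with z hz hz'
    exact defPow_ne_zero (by simpa using hz') hz
  rw [ae_iff] at h1
  simp only [not_false_eq_true, Set.ofPred_true, Measure.restrict_apply_univ] at h1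
  exact (measure_ball_pos volume (0 : Cn n) one_pos).ne' h1

theorem bergmanMeasure_eq (n : ℕ) (lam : ℝ) :
    bergmanMeasure n lam = (defInt n lam)⁻¹ • (invMeasure n).withDensity (defPow lam) := by
  have hVpos : volume (unitBall n) ≠ 0 := (measure_ball_pos _ _ one_pos).ne'
  have hVfin : volume (unitBall n) ≠ ∞ := measure_ball_lt_top.ne
  have hw : bergmanWeight n lam = defPow (lam - (n + 1)) := rfl
  rw [bergmanMeasure, normConst, ballMeasure, hw, withDensity_defPow_invMeasure,
    withDensity_smul_measure, lintegral_smul_measure, smul_smul, smul_eq_mul, ← defInt_eq,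
    ENNReal.mul_inv (Or.inl (ENNReal.inv_ne_zero.2 hVfin)) (Or.inl (ENNReal.inv_ne_top.2 hVpos)),
    inv_inv, mul_right_comm, ENNReal.mul_inv_cancel hVpos hVfin, one_mul]

theorem lintegral_bergmanMeasure (n : ℕ) (lam : ℝ) (F : Cn n → ℝ≥0∞) :
    ∫⁻ z, F z ∂(bergmanMeasure n lam) =
      (defInt n lam)⁻¹ * ∫⁻ z, defPow lam z * F z ∂(invMeasure n) := by
  rw [bergmanMeasure_eq, lintegral_smul_measure, smul_eq_mul,
    lintegral_withDensity_eq_lintegral_mul_non_measurable _ (measurable_defPow _)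
      (Eventually.of_forall fun z => defPow_ne_top.lt_top)]
  rfl

theorem ae_bergmanMeasure_norm_lt (n : ℕ) (lam : ℝ) : ∀ᵐ z ∂(bergmanMeasure n lam), ‖z‖ < 1 := by
  rw [bergmanMeasure_eq]
  exact Measure.ae_smul_measure
    ((withDensity_absolutelyContinuous _ _).ae_le (ae_invMeasure_norm_lt n)) _

theorem invMeasure_ac_ballMeasure (n : ℕ) : invMeasure n ≪ ballMeasure n := by
  have hVfin : volume (unitBall n) ≠ ∞ := measure_ball_lt_top.ne
  rw [ballMeasure]
  exact (withDensity_absolutelyContinuous _ _).trans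
    (Measure.absolutelyContinuous_smul (ENNReal.inv_ne_zero.2 hVfin))

theorem defInt_ne_top (hn : 1 ≤ n) {a : ℝ} (ha : n < a) : defInt n a ≠ ∞ := by
  have : NeZero n := ⟨by omega⟩
  set e : ℝ := a - (n + 1) with he
  have he1 : -1 < e := by rw [he]; linarith
  have hI : IntegrableOn (fun z : Cn n => (1 - ‖z‖ ^ 2) ^ e) (ball 0 1) := by
    rw [integrableOn_fun_norm_addHaar volume (f := fun t : ℝ => (1 - t ^ 2) ^ e)]
    -- In the dominating function the summand 1 serves exponents e ≥ 0 and (1-t)^e serves -1 < e <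
    -- 0; both come from 1-t ≤ 1-t² ≤ 1.
    have h1 : IntegrableOn (fun t : ℝ => 1 + (1 - t) ^ e) (Set.Ioo 0 1) := by
      have h2 := ((intervalIntegral.intervalIntegrable_rpow' (a := 0) (b := 1) he1).comp_sub_left 1)
      rw [sub_zero, sub_self] at h2
      have h3 := (intervalIntegrable_iff_integrableOn_Ioc_of_le zero_le_one).1 h2.symm
      refine Integrable.add ?_ (h3.mono_set Set.Ioo_subset_Ioc_self)
      exact integrableOn_const (by simp)
    refine h1.mono' (by fun_prop) ?_
    filter_upwards [ae_restrict_mem measurableSet_Ioo] with t ht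
    obtain ⟨ht0, ht1⟩ := ht
    have h4 : 0 < 1 - t ^ 2 := by nlinarith
    rw [norm_smul, Real.norm_of_nonneg (by positivity), Real.norm_of_nonneg (by positivity)]
    have h5 : t ^ (Module.finrank ℝ (Cn n) - 1) ≤ 1 := pow_le_one₀ ht0.le ht1.le
    have h6 : (1 - t ^ 2) ^ e ≤ 1 + (1 - t) ^ e := by
      rcases le_total 0 e with h | h
      · have := Real.rpow_le_one h4.le (by nlinarith) h
        have := Real.rpow_nonneg (sub_pos.2 ht1).le e
        linarith
      · have := Real.rpow_le_rpow_of_nonpos (sub_pos.2 ht1) (show 1 - t ≤ 1 - t ^ 2 by nlinarith) h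
        linarith
    calc _ ≤ 1 * (1 - t ^ 2) ^ e := by gcongr
      _ ≤ _ := by linarith
  rw [defInt_eq]
  exact hI.lintegral_lt_top.ne

/-- `(1 - r)^(2p) ≥ 1/4` as long as `2 p r ≤ 1`. -/
theorem quarter_le_rpow {r p : ℝ} (hr1 : r ≤ 1) (hp : 1 ≤ p) (h : 2 * (p * r) ≤ 1) :
    1 / 4 ≤ (1 - r) ^ (2 * p) := by
  have h1 := one_add_mul_self_le_rpow_one_add (s := -r) (by linarith) hp
  have h2 : 1 / 2 ≤ (1 - r) ^ p := by
    rw [sub_eq_add_neg]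
    linarith
  rw [mul_comm, Real.rpow_mul (by linarith), Real.rpow_two]
  nlinarith

theorem quarter_le_defPow {lam : ℝ} (hlam : 2 ≤ lam) {z : Cn n} (hz : lam * ‖z‖ ^ 2 ≤ 1) :
    1 / 4 ≤ (1 - ‖z‖ ^ 2) ^ lam := by
  have h := quarter_le_rpow (r := ‖z‖ ^ 2) (p := lam / 2) (by nlinarith)
    (by linarith) (by linarith)
  rwa [mul_div_cancel₀ _ two_ne_zero] at h

/-- Both masses are of order λ^(-n). From below, the weight is at least 1/4 on the Euclidean ball of
radius λ^(-1/2), whose volume is λ^(-n) times that of the unit ball. From above, 1-t² ≤ 1/(1+t²) and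
Bernoulli's inequality dominate the weight by (1+c|z|²)^(-(n+1)), and rescaling by √c gives c^(-n).
-/
theorem exists_defInt_le (n : ℕ) : ∃ K : ℝ≥0∞, K ≠ ∞ ∧ ∀ lam : ℝ, 8 * (n + 1) ≤ lam →
    defInt n (lam / 4) ≤ K * defInt n lam := by
  set V := volume (unitBall n) with hV
  have hVpos : V ≠ 0 := (measure_ball_pos _ _ one_pos).ne'
  have hVfin : V ≠ ∞ := measure_ball_lt_top.ne
  have hGi : Integrable (fun z : Cn n => (1 + ‖z‖ ^ 2) ^ (-(2 * (n + 1) : ℝ) / 2)) volume := by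
    apply integrable_rpow_neg_one_add_norm_sq
    rw [finrank_real_Cn]
    push_cast
    linarith
  set G := ∫ z : Cn n, (1 + ‖z‖ ^ 2) ^ (-(2 * (n + 1) : ℝ) / 2) with hG
  have hG0 : 0 ≤ G := integral_nonneg fun z => by positivity
  refine ⟨ENNReal.ofReal ((8 * (n + 1)) ^ n * G) * (4 * V⁻¹), by
    exact ENNReal.mul_ne_top ENNReal.ofReal_ne_top
      (ENNReal.mul_ne_top (by simp) (ENNReal.inv_ne_top.2 hVpos)), fun lam hlam => ?_⟩
  have hn0 : (0 : ℝ) ≤ n := Nat.cast_nonneg n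
  have hlam0 : 0 < lam := by linarith
  have hlow : ENNReal.ofReal ((lam⁻¹) ^ n / 4) * V ≤ defInt n lam := by
    set r := Real.sqrt lam⁻¹ with hr
    have hr1 : r ≤ 1 := Real.sqrt_le_one.2 (inv_le_one_of_one_le₀ (by linarith))
    have hr2 : r ^ 2 = lam⁻¹ := Real.sq_sqrt (by positivity)
    rw [defInt_eq]
    have hvol : volume (ball (0 : Cn n) r) = ENNReal.ofReal (lam⁻¹ ^ n) * V := by
      rw [Measure.addHaar_ball_of_pos _ _ (Real.sqrt_pos.2 (by positivity)), finrank_real_Cn, pow_mul, hr2]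
    calc ENNReal.ofReal ((lam⁻¹) ^ n / 4) * V = ∫⁻ z in ball (0 : Cn n) r, ENNReal.ofReal (1 / 4) := by
          rw [setLIntegral_const, hvol, ← mul_assoc, ← ENNReal.ofReal_mul (by positivity)]
          congr 2
          ring
      _ ≤ ∫⁻ z in ball (0 : Cn n) r, defPow (lam - (n + 1)) z := by
          refine setLIntegral_mono' measurableSet_ball fun z hz => ?_
          have hz1 : ‖z‖ < r := by simpa using hz
          have hz2 : lam * ‖z‖ ^ 2 ≤ 1 := by
            calc lam * ‖z‖ ^ 2 ≤ lam * r ^ 2 := by gcongr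
              _ = 1 := by rw [hr2]; field_simp
          refine le_trans ?_ (defPow_anti (show lam - (n + 1) ≤ lam by linarith)
            (hz1.trans_le hr1))
          exact ENNReal.ofReal_le_ofReal (quarter_le_defPow (by linarith) hz2)
      _ ≤ _ := lintegral_mono_set (ball_subset_ball hr1)
  have hup : defInt n (lam / 4) ≤ ENNReal.ofReal (((8 * (n + 1)) ^ n * G) * lam⁻¹ ^ n) := by
    -- Chosen so that c(n+1) = λ/8, which is at most λ/4 - (n+1) exactly when λ ≥ 8(n+1); the same
    -- condition gives c ≥ 1, as Bernoulli's inequality requires.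
    set c : ℝ := lam / (8 * (n + 1)) with hc
    have hc1 : 1 ≤ c := by rw [hc, one_le_div (by positivity)]; exact hlam
    have hR : (Real.sqrt c) ^ 2 = c := Real.sq_sqrt (by positivity)
    have hs := Measure.integral_comp_smul (volume : Measure (Cn n))
      (fun z => (1 + ‖z‖ ^ 2) ^ (-(2 * (n + 1) : ℝ) / 2)) (Real.sqrt c)
    rw [finrank_real_Cn, pow_mul, hR, ← hG, abs_of_nonneg (by positivity), smul_eq_mul] at hs
    have hsi : Integrable (fun z : Cn n => (1 + ‖Real.sqrt c • z‖ ^ 2) ^ (-(2 * (n + 1) : ℝ) / 2))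
        volume := hGi.comp_smul (Real.sqrt_pos.2 (by positivity)).ne'
    have e : (8 * (n + 1)) ^ n * G * lam⁻¹ ^ n = (c ^ n)⁻¹ * G := by
      rw [hc, div_pow, inv_pow]
      field_simp
    rw [e, ← hs, ofReal_integral_eq_lintegral_ofReal hsi (Eventually.of_forall fun z => by positivity),
      defInt_eq]
    refine le_trans (setLIntegral_mono' measurableSet_ball fun z hz => ?_)
      (setLIntegral_le_lintegral (unitBall n) _)
    have hz' : ‖z‖ < 1 := by simpa using hz
    have hd := one_sub_normSq_pos hz'
    refine ENNReal.ofReal_le_ofReal ?_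
    rw [norm_smul, mul_pow, Real.norm_of_nonneg (Real.sqrt_nonneg _), hR]
    have hN : (0 : ℝ) < n + 1 := by positivity
    calc (1 - ‖z‖ ^ 2) ^ (lam / 4 - (n + 1)) ≤ (1 - ‖z‖ ^ 2) ^ (c * (n + 1)) := by
          refine Real.rpow_le_rpow_of_exponent_ge hd (by nlinarith [norm_nonneg z]) ?_
          rw [hc]
          have : lam / (8 * (n + 1)) * (n + 1) = lam / 8 := by field_simp
          rw [this]
          linarith
      _ ≤ ((1 + ‖z‖ ^ 2)⁻¹) ^ (c * (n + 1)) := by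
          refine Real.rpow_le_rpow hd.le ?_ (by positivity)
          rw [← one_div, le_div_iff₀ (by positivity)]
          nlinarith [sq_nonneg (‖z‖ ^ 2)]
      _ = (((1 + ‖z‖ ^ 2) ^ c) ^ ((n : ℝ) + 1))⁻¹ := by
          rw [Real.inv_rpow (by positivity), Real.rpow_mul (by positivity)]
      _ ≤ ((1 + c * ‖z‖ ^ 2) ^ ((n : ℝ) + 1))⁻¹ := by
          gcongr
          exact one_add_mul_self_le_rpow_one_add (by nlinarith [sq_nonneg ‖z‖]) hc1
      _ = (1 + c * ‖z‖ ^ 2) ^ (-(2 * (n + 1) : ℝ) / 2) := by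
          rw [← Real.rpow_neg (by positivity)]
          congr 1
          ring
  calc defInt n (lam / 4) ≤ ENNReal.ofReal ((8 * (n + 1)) ^ n * G) * ENNReal.ofReal (lam⁻¹ ^ n) := by
        rw [← ENNReal.ofReal_mul (by positivity)]
        exact hup
    _ = ENNReal.ofReal ((8 * (n + 1)) ^ n * G) * (4 * V⁻¹) * (ENNReal.ofReal ((lam⁻¹) ^ n / 4) * V) := by
        have h4 : ENNReal.ofReal (lam⁻¹ ^ n) = 4 * ENNReal.ofReal ((lam⁻¹) ^ n / 4) := by
          have : (4 : ℝ≥0∞) = ENNReal.ofReal 4 := by simp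
          rw [this, ← ENNReal.ofReal_mul (by norm_num)]
          congr 1
          ring
        have h5 : V⁻¹ * V = 1 := ENNReal.inv_mul_cancel hVpos hVfin
        rw [h4]
        calc _ = ENNReal.ofReal ((8 * (n + 1)) ^ n * G) * (4 * ENNReal.ofReal ((lam⁻¹) ^ n / 4)) * 1 := by
              rw [mul_one]
          _ = _ := by rw [← h5]; ring
    _ ≤ _ := by gcongr

/-! ### Pseudohyperbolic balls and their invariant volumes -/

/-- The pseudo-hyperbolic ball about `x`. -/
def pball (x : Cn n) (r : ℝ) : Set (Cn n) := {y | ‖mob x y‖ < r}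

theorem measurableSet_pball (x : Cn n) (r : ℝ) : MeasurableSet (pball x r) :=
  measurableSet_lt (measurable_mob x).norm measurable_const

theorem setLIntegral_pball {x : Cn n} (hx : ‖x‖ < 1) (r : ℝ) {F : Cn n → ℝ≥0∞}
    (hF : Measurable F) :
    ∫⁻ y in pball x r, F y ∂(invMeasure n) = ∫⁻ y in ball 0 r, F (mob x y) ∂(invMeasure n) := by
  rw [← lintegral_indicator (measurableSet_pball x r), ← lintegral_indicator measurableSet_ball,
    ← lintegral_mob hx (hF.indicator (measurableSet_pball x r))]
  refine lintegral_congr_ae ?_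
  filter_upwards [ae_invMeasure_norm_lt n] with y hy
  have : mob x y ∈ pball x r ↔ y ∈ ball (0 : Cn n) r := by
    simp [pball, mob_mob hx hy]
  by_cases h : y ∈ ball (0 : Cn n) r
  · rw [Set.indicator_of_mem h, Set.indicator_of_mem (this.2 h)]
  · rw [Set.indicator_of_notMem h, Set.indicator_of_notMem (fun h' => h (this.1 h'))]

theorem invMeasure_pball {x : Cn n} (hx : ‖x‖ < 1) (r : ℝ) :
    invMeasure n (pball x r) = invMeasure n (ball 0 r) := by
  have := setLIntegral_pball hx r (measurable_const (a := (1 : ℝ≥0∞)))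
  simpa using this

theorem setLIntegral_ball_invMeasure {r : ℝ} (hr : r ≤ 1) {F : Cn n → ℝ≥0∞} :
    ∫⁻ y in ball (0 : Cn n) r, F y ∂(invMeasure n) =
      ∫⁻ y in ball (0 : Cn n) r, defPow (-(n + 1)) y * F y := by
  rw [invMeasure_eq, restrict_withDensity measurableSet_ball, Measure.restrict_restrict measurableSet_ball,
    Set.inter_eq_self_of_subset_left (ball_subset_ball hr),
    lintegral_withDensity_eq_lintegral_mul_non_measurable _ (measurable_defPow _)
      (Eventually.of_forall fun z => defPow_ne_top.lt_top)]
  rfl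

theorem one_le_defPow_neg {a : ℝ} (ha : a ≤ 0) {z : Cn n} (hz : ‖z‖ < 1) : 1 ≤ defPow a z := by
  have := defPow_anti ha hz
  rwa [defPow, Real.rpow_zero, ENNReal.ofReal_one] at this

theorem volume_ball_le_invMeasure {r : ℝ} (hr : r ≤ 1) :
    volume (ball (0 : Cn n) r) ≤ invMeasure n (ball 0 r) := by
  have h := setLIntegral_ball_invMeasure (n := n) hr (F := fun _ => 1)
  rw [setLIntegral_one] at h
  rw [h, ← setLIntegral_one]
  refine setLIntegral_mono' measurableSet_ball fun z hz => ?_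
  rw [mul_one]
  exact one_le_defPow_neg (by linarith [(Nat.cast_nonneg n : (0 : ℝ) ≤ n)])
    ((mem_ball_zero_iff.1 hz).trans_le hr)

theorem invMeasure_ball_le {r : ℝ} (hr : r ≤ 1 / 2) :
    invMeasure n (ball 0 r) ≤ 2 ^ (n + 1) * volume (ball (0 : Cn n) r) := by
  have h := setLIntegral_ball_invMeasure (n := n) (by linarith : r ≤ 1) (F := fun _ => 1)
  rw [setLIntegral_one] at h
  rw [h, ← setLIntegral_const]
  refine setLIntegral_mono' measurableSet_ball fun z hz => ?_
  rw [mul_one, defPow]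
  have hz1 := mem_ball_zero_iff.1 hz
  have h1 : 1 / 2 ≤ 1 - ‖z‖ ^ 2 := by nlinarith [norm_nonneg z]
  have h2 : (1 - ‖z‖ ^ 2) ^ (-((n : ℝ) + 1)) ≤ 2 ^ (n + 1) := by
    rw [Real.rpow_neg (by linarith)]
    have : (1 - ‖z‖ ^ 2) ^ ((n : ℝ) + 1) = (1 - ‖z‖ ^ 2) ^ (n + 1) := by norm_cast
    rw [this, ← inv_pow]
    gcongr
    rw [inv_le_comm₀ (by linarith) (by norm_num)]
    linarith
  refine (ENNReal.ofReal_le_ofReal h2).trans (le_of_eq ?_)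
  rw [ENNReal.ofReal_pow (by norm_num)]
  simp

theorem invMeasure_ball_ne_zero {r : ℝ} (hr0 : 0 < r) (hr : r ≤ 1) :
    invMeasure n (ball 0 r) ≠ 0 :=
  ((measure_ball_pos volume (0 : Cn n) hr0).trans_le (volume_ball_le_invMeasure hr)).ne'

theorem invMeasure_ball_ne_top {r : ℝ} (hr : r ≤ 1 / 2) : invMeasure n (ball 0 r) ≠ ∞ :=
  ((invMeasure_ball_le hr).trans_lt
    (ENNReal.mul_lt_top (by simp) measure_ball_lt_top)).ne

/-- Doubling. Up to radius 1/2 the invariant density lies between 1 and 2^(n+1), so Euclidean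
scaling in real dimension 2n gives the constant. -/
theorem invMeasure_ball_mul_le {r k : ℝ} (hk : 0 < k) (hkr : k * r ≤ 1 / 2)
    (hr : r ≤ 1) :
    invMeasure n (ball 0 (k * r)) ≤
      2 ^ (n + 1) * ENNReal.ofReal (k ^ (2 * n)) * invMeasure n (ball 0 r) := by
  refine (invMeasure_ball_le hkr).trans ?_
  rw [mul_assoc]
  gcongr
  rw [← finrank_real_Cn n, Measure.addHaar_ball_mul_of_pos _ _ hk]
  exact mul_le_mul_right (volume_ball_le_invMeasure hr) _

/-! ### Sub-mean-value and Carleson estimates at the scale λ^(-1/2) -/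

/-- The transform `u ↦ (u ∘ mob x) (1 - ⟨·,x⟩)^(-λ)`, a multiple of a unitary operator. -/
noncomputable def transfer (lam : ℝ) (x : Cn n) (u : Cn n → ℂ) (w : Cn n) : ℂ :=
  u (mob x w) * (1 - inner ℂ x w) ^ (-lam : ℂ)

@[simp] theorem transfer_zero (lam : ℝ) (x : Cn n) (u : Cn n → ℂ) : transfer lam x u 0 = u x := by
  simp [transfer]

theorem differentiableOn_kernel (lam : ℝ) {x : Cn n} (hx : ‖x‖ < 1) :
    DifferentiableOn ℂ (fun w : Cn n => (1 - inner ℂ x w) ^ (-lam : ℂ)) (unitBall n) := by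
  intro w hw
  have hw' : ‖w‖ < 1 := by simpa using hw
  have hi : DifferentiableAt ℂ (fun w : Cn n => (1 - inner ℂ x w : ℂ)) w :=
    ((innerSL ℂ x).differentiableAt).const_sub 1
  exact (hi.cpow (differentiableAt_const _)
    (Or.inl (one_sub_inner_re_pos hx hw'))).differentiableWithinAt

theorem differentiableOn_comp_mob {x : Cn n} (hx : ‖x‖ < 1) {u : Cn n → ℂ}
    (hu : DifferentiableOn ℂ u (unitBall n)) :
    DifferentiableOn ℂ (fun w => u (mob x w)) (unitBall n) := by
  refine hu.comp (fun w hw => ?_) fun w hw => ?_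
  · exact (hasFDerivAt_mob hx (by simpa using hw)).differentiableAt.differentiableWithinAt
  · simpa using norm_mob_lt_one hx (by simpa using hw)

theorem differentiableOn_transfer (lam : ℝ) {x : Cn n} (hx : ‖x‖ < 1) {u : Cn n → ℂ}
    (hu : DifferentiableOn ℂ u (unitBall n)) :
    DifferentiableOn ℂ (transfer lam x u) (unitBall n) :=
  (differentiableOn_comp_mob hx hu).mul (differentiableOn_kernel lam hx)

theorem normSq_cpow (c : ℂ) (lam : ℝ) : ‖c ^ (-lam : ℂ)‖ ^ 2 = (‖c‖ ^ 2) ^ (-lam) := by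
  have : (-lam : ℂ) = ((-lam : ℝ) : ℂ) := by simp
  rw [this, Complex.norm_cpow_real, ← Real.rpow_natCast, ← Real.rpow_mul (norm_nonneg _),
    mul_comm, Real.rpow_mul (norm_nonneg _)]
  simp

/-- The pointwise form of unitarity: the factor (1-⟨w,x⟩)^(-λ) is exactly what turns the weight at w
into the weight at `mob x w`, up to the constant (1-|x|²)^λ. -/
theorem enorm_transfer_sq (lam : ℝ) {x w : Cn n} (hx : ‖x‖ < 1) (hw : ‖w‖ < 1) (u : Cn n → ℂ) :
    ‖transfer lam x u w‖ₑ ^ 2 * defPow lam w * defPow lam x =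
      ‖u (mob x w)‖ₑ ^ 2 * defPow lam (mob x w) := by
  have p := norm_pos_iff.2 (one_sub_inner_ne_zero hx hw)
  have p1 := one_sub_normSq_pos hx
  have p2 := one_sub_normSq_pos hw
  have h : ‖(1 - inner ℂ x w : ℂ) ^ (-lam : ℂ)‖ₑ ^ 2 * defPow lam w * defPow lam x =
      defPow lam (mob x w) := by
    rw [defPow, defPow, defPow, ← ofReal_norm, ← ENNReal.ofReal_pow (norm_nonneg _),
      ← ENNReal.ofReal_mul (by positivity), ← ENNReal.ofReal_mul (by positivity),
      one_sub_normSq_mob hx hw, normSq_cpow, Real.div_rpow (by positivity) (by positivity),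
      Real.mul_rpow p1.le p2.le, Real.rpow_neg (by positivity)]
    congr 1
    field_simp
  rw [transfer, enorm_mul, mul_pow, ← h]
  ring

/-- Sub-mean-value inequality at the scale `λ^(-1/2)`. -/
theorem enorm_sq_mul_le {lam r : ℝ} (hlam : 2 ≤ lam) (hr0 : 0 < r) (hr : r ≤ 1 / 2)
    (hlr : lam * r ^ 2 ≤ 1)
    {u : Cn n → ℂ} (hu : DifferentiableOn ℂ u (unitBall n))
    {G : Cn n → ℝ≥0∞} (hG : Measurable G) (hGu : ∀ z, ‖z‖ < 1 → G z = ‖u z‖ₑ ^ 2 * defPow lam z)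
    {x : Cn n} (hx : ‖x‖ < 1) :
    G x * invMeasure n (ball 0 r) ≤ 4 * 2 ^ (n + 1) * ∫⁻ y in pball x r, G y ∂(invMeasure n) := by
  have hr1 : r ≤ 1 := by linarith
  -- The transform moves x to the origin with value u(x), so the ordinary Euclidean mean value
  -- inequality for its square suffices.
  have hd := ((differentiableOn_transfer lam hx hu).mono (ball_subset_ball hr1)).pow 2
  have h := enorm_mul_volume_le hd
  rw [setLIntegral_pball hx r hG, setLIntegral_ball_invMeasure hr1, hGu x hx]
  have h1 : ‖u x‖ₑ ^ 2 * volume (ball (0 : Cn n) r) ≤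
      ∫⁻ w in ball (0 : Cn n) r, ‖transfer lam x u w‖ₑ ^ 2 := by
    simpa [enorm_pow] using h
  have h2 : defPow lam x * ∫⁻ w in ball (0 : Cn n) r, ‖transfer lam x u w‖ₑ ^ 2 ≤
      4 * ∫⁻ w in ball (0 : Cn n) r, defPow (-(n + 1)) w * G (mob x w) := by
    rw [← lintegral_const_mul' _ _ defPow_ne_top, ← lintegral_const_mul' _ _ (by simp)]
    refine setLIntegral_mono' measurableSet_ball fun w hw => ?_
    have hwr := mem_ball_zero_iff.1 hw
    have hw1 := hwr.trans_le hr1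
    rw [hGu _ (norm_mob_lt_one hx hw1), ← enorm_transfer_sq lam hx hw1]
    -- The scale enters here: λ|w|² ≤ 1 keeps the weight above 1/4, so it can be inserted at a cost
    -- independent of λ.
    have h3 : 1 ≤ 4 * defPow lam w := by
      have : (1 / 4 : ℝ) ≤ (1 - ‖w‖ ^ 2) ^ lam := by
        refine quarter_le_defPow hlam (le_trans ?_ hlr)
        gcongr
      have h5 : ENNReal.ofReal (4 * (1 / 4)) ≤ 4 * defPow lam w := by
        rw [ENNReal.ofReal_mul (by norm_num)]
        gcongr
        · simp
        · exact ENNReal.ofReal_le_ofReal this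
      simpa using h5
    have h4 : 1 ≤ defPow (-((n : ℝ) + 1)) w :=
      one_le_defPow_neg (by linarith [(Nat.cast_nonneg n : (0 : ℝ) ≤ n)]) hw1
    calc defPow lam x * ‖transfer lam x u w‖ₑ ^ 2
        = 1 * 1 * (defPow lam x * ‖transfer lam x u w‖ₑ ^ 2) := by ring
      _ ≤ (4 * defPow lam w) * defPow (-((n : ℝ) + 1)) w *
          (defPow lam x * ‖transfer lam x u w‖ₑ ^ 2) := by gcongr
      _ = _ := by ring
  calc ‖u x‖ₑ ^ 2 * defPow lam x * invMeasure n (ball 0 r)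
      ≤ ‖u x‖ₑ ^ 2 * defPow lam x * (2 ^ (n + 1) * volume (ball (0 : Cn n) r)) := by
        gcongr
        exact invMeasure_ball_le hr
    _ = 2 ^ (n + 1) * (defPow lam x * (‖u x‖ₑ ^ 2 * volume (ball (0 : Cn n) r))) := by ring
    _ ≤ 2 ^ (n + 1) * (4 * ∫⁻ w in ball (0 : Cn n) r, defPow (-(n + 1)) w * G (mob x w)) := by
        exact mul_le_mul_right ((mul_le_mul_right h1 _).trans h2) _
    _ = _ := by ring

theorem measurable_indicator_pball {r : ℝ} {F : Cn n → ℝ≥0∞} (hF : Measurable F) :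
    Measurable fun p : Cn n × Cn n => (pball p.1 r).indicator F p.2 := by
  have : (fun p : Cn n × Cn n => (pball p.1 r).indicator F p.2) =
      {p : Cn n × Cn n | ‖mob p.1 p.2‖ < r}.indicator fun p => F p.2 := by
    ext p
    rfl
  rw [this]
  exact (hF.comp measurable_snd).indicator
    (measurableSet_lt measurable_mob_uncurry.norm measurable_const)

/-- A Carleson type estimate. -/
theorem lintegral_mul_le_of_submean {r : ℝ} (hr0 : 0 < r) (hr : r ≤ 1 / 2) {K M : ℝ≥0∞}
    (hK : K ≠ ∞) {G Φ : Cn n → ℝ≥0∞} (hG : Measurable G) (hΦ : Measurable Φ)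
    (hsub : ∀ x, ‖x‖ < 1 →
      G x * invMeasure n (ball 0 r) ≤ K * ∫⁻ y in pball x r, G y ∂(invMeasure n))
    (hM : ∀ x, ‖x‖ < 1 →
      ∫⁻ y in pball x r, Φ y ∂(invMeasure n) ≤ M * invMeasure n (ball 0 r)) :
    ∫⁻ z, Φ z * G z ∂(invMeasure n) ≤ K * M * ∫⁻ z, G z ∂(invMeasure n) := by
  set m := invMeasure n (ball (0 : Cn n) r) with hm
  have hm0 : m ≠ 0 := invMeasure_ball_ne_zero hr0 (by linarith)
  have hmt : m ≠ ∞ := invMeasure_ball_ne_top hr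
  -- The claim is multiplied by the volume m, which is the same for all centres. The sub-mean-value
  -- bound then replaces G(z)m by an integral, and after Fubini `hM` gives back one factor m.
  rw [← ENNReal.mul_le_mul_iff_left hm0 hmt, ← lintegral_mul_const _ (show Measurable fun z => Φ z * G z from hΦ.mul hG)]
  calc ∫⁻ z, Φ z * G z * m ∂(invMeasure n)
      ≤ ∫⁻ z, K * ∫⁻ y, Φ z * (pball z r).indicator G y ∂(invMeasure n) ∂(invMeasure n) := by
        refine lintegral_mono_ae ?_
        filter_upwards [ae_invMeasure_norm_lt n] with z hz
        rw [lintegral_const_mul _ (hG.indicator (measurableSet_pball z r)),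
          lintegral_indicator (measurableSet_pball z r), mul_assoc, mul_left_comm K]
        exact mul_le_mul_right (hsub z hz) _
    _ = K * ∫⁻ y, ∫⁻ z, Φ z * (pball z r).indicator G y ∂(invMeasure n) ∂(invMeasure n) := by
        rw [lintegral_const_mul' _ _ hK, lintegral_lintegral_swap]
        exact ((hΦ.comp measurable_fst).mul (measurable_indicator_pball hG)).aemeasurable
    _ ≤ K * ∫⁻ y, G y * (M * m) ∂(invMeasure n) := by
        refine mul_le_mul_right (lintegral_mono_ae ?_) _
        filter_upwards [ae_invMeasure_norm_lt n] with y hy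
        calc ∫⁻ z, Φ z * (pball z r).indicator G y ∂(invMeasure n)
            = ∫⁻ z, G y * (pball y r).indicator Φ z ∂(invMeasure n) := by
              refine lintegral_congr_ae ?_
              filter_upwards [ae_invMeasure_norm_lt n] with z hz
              -- Symmetry of the distance lets the two integration variables exchange their roles as
              -- centre and point.
              have hiff : y ∈ pball z r ↔ z ∈ pball y r := by
                simp only [pball, Set.mem_ofPred_eq, norm_mob_comm hz hy]
              by_cases h : z ∈ pball y r
              · rw [Set.indicator_of_mem h, Set.indicator_of_mem (hiff.2 h), mul_comm]
              · rw [Set.indicator_of_notMem h, Set.indicator_of_notMem (mt hiff.1 h), mul_zero,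
                  mul_zero]
          _ = G y * ∫⁻ z in pball y r, Φ z ∂(invMeasure n) := by
              rw [lintegral_const_mul _ (hΦ.indicator (measurableSet_pball y r)),
                lintegral_indicator (measurableSet_pball y r)]
          _ ≤ _ := by
              exact mul_le_mul_right (hM y hy) _
    _ = K * M * (∫⁻ z, G z ∂(invMeasure n)) * m := by
        rw [lintegral_mul_const _ hG]
        ring

/-! ### The reproducing kernel, the projection and the common domain -/

theorem isProbabilityMeasure_bergmanMeasure (hn : 1 ≤ n) {lam : ℝ} (hlam : n < lam) :
    IsProbabilityMeasure (bergmanMeasure n lam) := by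
  refine ⟨?_⟩
  have h := lintegral_bergmanMeasure n lam fun _ => 1
  simp only [lintegral_const, one_mul, mul_one] at h
  rw [h]
  exact ENNReal.inv_mul_cancel (defInt_ne_zero n lam) (defInt_ne_top hn hlam)

theorem integral_bergmanMeasure (n : ℕ) (lam : ℝ) (F : Cn n → ℂ) :
    ∫ z, F z ∂(bergmanMeasure n lam) =
      ((defInt n lam)⁻¹.toReal : ℂ) * ∫ z, ((1 - ‖z‖ ^ 2) ^ lam : ℝ) * F z ∂(invMeasure n) := by
  rw [bergmanMeasure_eq, integral_smul_measure,
    integral_withDensity_eq_integral_toReal_smul (measurable_defPow _)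
      (Eventually.of_forall fun z => defPow_ne_top.lt_top), Complex.real_smul]
  congr 1
  refine integral_congr_ae ?_
  filter_upwards [ae_invMeasure_norm_lt n] with z hz
  rw [defPow, ENNReal.toReal_ofReal (Real.rpow_nonneg (one_sub_normSq_pos hz).le _),
    Complex.real_smul]

theorem measurePreserving_smul_bergmanMeasure (lam : ℝ) {c : ℂ} (hc : ‖c‖ = 1) :
    MeasurePreserving (fun w : Cn n => c • w) (bergmanMeasure n lam) (bergmanMeasure n lam) := by
  have hm : Measurable fun w : Cn n => c • w := by fun_prop
  refine ⟨hm, Measure.ext fun s hs => ?_⟩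
  rw [Measure.map_apply hm hs, bergmanMeasure_eq, withDensity_defPow_invMeasure,
    Measure.smul_apply, Measure.smul_apply, withDensity_apply _ hs, withDensity_apply _ (hm hs),
    Measure.restrict_restrict hs, Measure.restrict_restrict (hm hs),
    ← lintegral_indicator (hs.inter measurableSet_ball),
    ← lintegral_indicator ((hm hs).inter measurableSet_ball),
    ← (measurePreserving_smul n c hc).lintegral_comp
      ((measurable_defPow _).indicator (hs.inter measurableSet_ball))]
  congr 1
  refine lintegral_congr fun w => ?_
  have h1 : ‖c • w‖ = ‖w‖ := by rw [norm_smul, hc, one_mul]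
  by_cases h : w ∈ (fun w : Cn n => c • w) ⁻¹' s ∩ unitBall n
  · have h' : c • w ∈ s ∩ unitBall n := ⟨h.1, by simpa [h1] using h.2⟩
    rw [Set.indicator_of_mem h, Set.indicator_of_mem h', defPow, defPow, h1]
  · have h' : c • w ∉ s ∩ unitBall n := fun h' => h ⟨h'.1, by simpa [h1] using h'.2⟩
    rw [Set.indicator_of_notMem h, Set.indicator_of_notMem h']

theorem measurable_indicator_of_differentiableOn {F : Cn n → ℂ}
    (hF : DifferentiableOn ℂ F (unitBall n)) : Measurable ((unitBall n).indicator F) := by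
  classical
  have := hF.continuousOn.measurable_piecewise (g := fun _ => (0 : ℂ)) continuousOn_const
    measurableSet_ball
  rwa [← Set.piecewise_eq_indicator]

theorem aestronglyMeasurable_of_differentiableOn {F : Cn n → ℂ} (lam : ℝ)
    (hF : DifferentiableOn ℂ F (unitBall n)) : AEStronglyMeasurable F (bergmanMeasure n lam) := by
  refine (measurable_indicator_of_differentiableOn hF).aestronglyMeasurable.congr ?_
  filter_upwards [ae_bergmanMeasure_norm_lt n lam] with z hz
  exact Set.indicator_of_mem (by simpa using hz) _

theorem circleAverage_eq {F : Cn n → ℂ} (hF : DifferentiableOn ℂ F (unitBall n)) {w : Cn n}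
    (hw : ‖w‖ < 1) : Real.circleAverage (fun ζ => F (ζ • w)) 0 1 = F 0 := by
  have hmem : ∀ ζ ∈ closedBall (0 : ℂ) 1, ζ • w ∈ unitBall n := by
    intro ζ hζ
    rw [mem_closedBall_zero_iff] at hζ
    rw [mem_ball_zero_iff, norm_smul]
    nlinarith [norm_nonneg w]
  have hd : DifferentiableOn ℂ (fun ζ : ℂ => F (ζ • w)) (closedBall 0 1) :=
    hF.comp (by fun_prop) hmem
  have hd' : DiffContOnCl ℂ (fun ζ : ℂ => F (ζ • w)) (ball 0 |(1 : ℝ)|) := by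
    rw [abs_one]
    exact (hd.mono (closure_ball_subset_closedBall)).diffContOnCl
  simpa using hd'.circleAverage

/-- Mean value property for the radial probability measure `v_λ`. -/
theorem integral_eq_apply_zero (hn : 1 ≤ n) {lam : ℝ} (hlam : n < lam) {F : Cn n → ℂ}
    (hF : DifferentiableOn ℂ F (unitBall n)) (hFi : Integrable F (bergmanMeasure n lam)) :
    ∫ w, F w ∂(bergmanMeasure n lam) = F 0 := by
  have := isProbabilityMeasure_bergmanMeasure hn hlam
  set m := bergmanMeasure n lam with hm
  have hball := ae_bergmanMeasure_norm_lt n lam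
  set G : Cn n → ℂ := (unitBall n).indicator F with hG
  have hGm : Measurable G := measurable_indicator_of_differentiableOn hF
  have hGF : G =ᵐ[m] F := by
    filter_upwards [hball] with z hz
    exact Set.indicator_of_mem (by simpa using hz) _
  have hGi : Integrable G m := hFi.congr hGF.symm
  set ν : Measure ℝ := volume.restrict (Set.Ioc 0 (2 * Real.pi)) with hν
  have hrot : ∀ θ : ℝ, MeasurePreserving (fun w : Cn n => circleMap 0 1 θ • w) m m := fun θ =>
    measurePreserving_smul_bergmanMeasure lam (by simp)
  have hcm : Measurable (circleMap 0 1) := (continuous_circleMap 0 1).measurable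
  have hjm : Measurable (Function.uncurry fun (θ : ℝ) (w : Cn n) => G (circleMap 0 1 θ • w)) := by
    apply hGm.comp
    fun_prop
  have hint : ∀ θ : ℝ, ∫ w, G (circleMap 0 1 θ • w) ∂m = ∫ w, G w ∂m := fun θ => by
    have h := integral_map (hrot θ).measurable.aemeasurable
      (f := G) (by rw [(hrot θ).map_eq]; exact hGm.aestronglyMeasurable)
    rw [(hrot θ).map_eq] at h
    exact h.symm
  have hintn : ∀ θ : ℝ, ∫ w, ‖G (circleMap 0 1 θ • w)‖ ∂m = ∫ w, ‖G w‖ ∂m := fun θ => by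
    have h := integral_map (hrot θ).measurable.aemeasurable
      (f := fun w => ‖G w‖) (by rw [(hrot θ).map_eq]; exact hGm.norm.aestronglyMeasurable)
    rw [(hrot θ).map_eq] at h
    exact h.symm
  have hji : Integrable (Function.uncurry fun (θ : ℝ) (w : Cn n) => G (circleMap 0 1 θ • w))
      (ν.prod m) := by
    rw [integrable_prod_iff hjm.aestronglyMeasurable]
    refine ⟨Eventually.of_forall fun θ =>
      ((hrot θ).integrable_comp hGm.aestronglyMeasurable).2 hGi, ?_⟩
    simp only [Function.uncurry, hintn]
    exact integrable_const _
  have hswap := integral_integral_swap hji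
  simp only [hint] at hswap
  have h1 : ∀ᵐ w ∂m, ∫ θ, G (circleMap 0 1 θ • w) ∂ν = (2 * Real.pi : ℝ) * F 0 := by
    filter_upwards [hball] with w hw
    rw [← circleAverage_eq hF hw, Real.circleAverage_def,
      intervalIntegral.integral_of_le (by positivity), Complex.real_smul, ← mul_assoc,
      ← Complex.ofReal_mul, mul_inv_cancel₀ (by positivity), Complex.ofReal_one, one_mul]
    refine integral_congr_ae (Eventually.of_forall fun θ => ?_)
    refine Set.indicator_of_mem ?_ _
    simpa [norm_smul] using hw
  rw [integral_congr_ae h1, integral_const, integral_const] at hswap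
  have h2 : ν.real Set.univ = 2 * Real.pi := by
    rw [hν, measureReal_restrict_apply_univ, Real.volume_real_Ioc_of_le (by positivity), sub_zero]
  rw [h2, probReal_univ, one_smul, Complex.real_smul] at hswap
  rw [← integral_congr_ae hGF]
  have h3 : ((2 * Real.pi : ℝ) : ℂ) ≠ 0 := by
    exact_mod_cast (by positivity : (2 * Real.pi : ℝ) ≠ 0)
  exact mul_left_cancel₀ h3 hswap

theorem arg_ne_pi_of_re_pos {c : ℂ} (hc : 0 < c.re) : c.arg ≠ Real.pi := fun h => by
  have := (Complex.arg_eq_pi_iff.1 h).1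
  linarith

/-- Used with a = 1-|x|², b = 1-|w|², c = 1-⟨w,x⟩: the weight times the conjugate kernel at `mob x
w` equals the weight at w times c^(-λ). The principal branches agree because Re c > 0 keeps arg c
away from π, so log(1/c) = -log c. -/
theorem conj_cpow_div_mul {a : ℝ} (ha : 0 < a) {c : ℂ} (hc : 0 < c.re) (lam : ℝ) {b : ℝ} (hb : 0 < b) :
    ((a * b / ‖c‖ ^ 2) ^ lam : ℝ) * (starRingEnd ℂ) (((a : ℂ) / c) ^ (-lam : ℂ)) =
      (b ^ lam : ℝ) * c ^ (-lam : ℂ) := by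
  have hc0 : c ≠ 0 := by rintro rfl; simp at hc
  have harg := arg_ne_pi_of_re_pos hc
  have h1 : ((a : ℂ) / c) ^ (-lam : ℂ) = ((a ^ (-lam) : ℝ) : ℂ) * c ^ (lam : ℂ) := by
    have harg' : (c⁻¹).arg = -c.arg := by rw [Complex.arg_inv, if_neg harg]
    rw [div_eq_mul_inv, Complex.cpow_def_of_ne_zero (by
      exact mul_ne_zero (by exact_mod_cast ha.ne') (inv_ne_zero hc0)),
      Complex.log_ofReal_mul ha (inv_ne_zero hc0), add_mul, Complex.exp_add,
      Complex.log_inv _ harg, Complex.cpow_def_of_ne_zero hc0, Complex.ofReal_cpow ha.le,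
      Complex.cpow_def_of_ne_zero (by exact_mod_cast ha.ne'), Complex.ofReal_log ha.le]
    push_cast
    congr 2
    ring
  have h2 : (starRingEnd ℂ) (c ^ (lam : ℂ)) * c ^ (lam : ℂ) = (((‖c‖ ^ 2) ^ lam : ℝ) : ℂ) := by
    rw [Complex.conj_mul']
    have := normSq_cpow c (-lam)
    rw [neg_neg] at this
    rw [← this]
    push_cast
    simp
  have h3 : c ^ (lam : ℂ) ≠ 0 := by simp [Complex.cpow_eq_zero_iff, hc0]
  have hn : 0 < ‖c‖ := norm_pos_iff.2 hc0
  rw [h1, map_mul, Complex.conj_ofReal, Complex.cpow_neg, Real.div_rpow (by positivity) (by positivity),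
    Real.mul_rpow ha.le hb.le, Real.rpow_neg ha.le, ← div_eq_mul_inv, eq_div_iff h3, mul_assoc,
    mul_assoc, h2, ← Complex.ofReal_mul, ← Complex.ofReal_mul]
  congr 1
  have : 0 < (‖c‖ ^ 2) ^ lam := by positivity
  have : 0 < a ^ lam := by positivity
  field_simp

/-- The reproducing kernel at `x`, as a function of the holomorphic variable. -/
noncomputable def kern (lam : ℝ) (x w : Cn n) : ℂ := (1 - inner ℂ x w) ^ (-lam : ℂ)

theorem memLp_transfer {lam : ℝ} {x : Cn n} (hx : ‖x‖ < 1) {u : Cn n → ℂ}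
    (hu : DifferentiableOn ℂ u (unitBall n)) (hu2 : MemLp u 2 (bergmanMeasure n lam)) :
    MemLp (transfer lam x u) 2 (bergmanMeasure n lam) := by
  refine ⟨aestronglyMeasurable_of_differentiableOn lam (differentiableOn_transfer lam hx hu), ?_⟩
  rw [eLpNorm_lt_top_iff_lintegral_rpow_enorm_lt_top (by simp) (by simp)]
  have h2 := (eLpNorm_lt_top_iff_lintegral_rpow_enorm_lt_top (by simp) (by simp)).1 hu2.2
  simp only [ENNReal.toReal_ofNat, ENNReal.rpow_ofNat, lintegral_bergmanMeasure] at h2 ⊢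
  have hUm : Measurable fun z : Cn n => defPow lam z * ‖(unitBall n).indicator u z‖ₑ ^ 2 :=
    (measurable_defPow _).mul ((measurable_indicator_of_differentiableOn hu).enorm.pow_const 2)
  have h3 : ∫⁻ z, defPow lam z * ‖transfer lam x u z‖ₑ ^ 2 ∂(invMeasure n) =
      (defPow lam x)⁻¹ * ∫⁻ z, defPow lam z * ‖u z‖ₑ ^ 2 ∂(invMeasure n) := by
    have e1 : ∫⁻ z, defPow lam z * ‖u z‖ₑ ^ 2 ∂(invMeasure n) =
        ∫⁻ z, defPow lam z * ‖(unitBall n).indicator u z‖ₑ ^ 2 ∂(invMeasure n) := by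
      refine lintegral_congr_ae ?_
      filter_upwards [ae_invMeasure_norm_lt n] with z hz
      rw [Set.indicator_of_mem (by simpa using hz)]
    rw [e1, ← lintegral_mob hx hUm, ← lintegral_const_mul' _ _ (ENNReal.inv_ne_top.2 (defPow_ne_zero hx))]
    refine lintegral_congr_ae ?_
    filter_upwards [ae_invMeasure_norm_lt n] with z hz
    rw [Set.indicator_of_mem (by simpa using norm_mob_lt_one hx hz), mul_comm (defPow lam (mob x z)),
      ← enorm_transfer_sq lam hx hz, mul_comm (_ * _) (defPow lam x), ← mul_assoc,
      ENNReal.inv_mul_cancel (defPow_ne_zero hx) defPow_ne_top, one_mul, mul_comm]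
  rw [h3, mul_left_comm]
  exact ENNReal.mul_lt_top (ENNReal.inv_lt_top.2 (pos_iff_ne_zero.2 (defPow_ne_zero hx))) h2

/-- The reproducing formula. -/
theorem integral_conj_kern_mul (hn : 1 ≤ n) {lam : ℝ} (hlam : n < lam) {x : Cn n} (hx : ‖x‖ < 1)
    {u : Cn n → ℂ} (hu : DifferentiableOn ℂ u (unitBall n))
    (hu2 : MemLp u 2 (bergmanMeasure n lam)) :
    ∫ w, (starRingEnd ℂ) (kern lam x w) * u w ∂(bergmanMeasure n lam) = u x := by
  have := isProbabilityMeasure_bergmanMeasure hn hlam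
  have hti : Integrable (transfer lam x u) (bergmanMeasure n lam) :=
    (memLp_transfer hx hu hu2).integrable (by norm_num)
  -- The reproducing formula at x is the mean value property at 0 of the transform of u, after the
  -- substitution w ↦ `mob x w`.
  have h := integral_eq_apply_zero hn hlam (differentiableOn_transfer lam hx hu) hti
  rw [transfer_zero] at h
  rw [← h, integral_bergmanMeasure, integral_bergmanMeasure]
  congr 1
  set F : Cn n → ℂ := (unitBall n).indicator
    fun w => ((1 - ‖w‖ ^ 2) ^ lam : ℝ) * ((starRingEnd ℂ) (kern lam x w) * u w) with hF
  have hFm : Measurable F := by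
    have hd := ((Complex.continuous_conj.comp_continuousOn
      (differentiableOn_kernel lam hx).continuousOn)).mul hu.continuousOn
    have hc : ContinuousOn (fun w : Cn n => ((1 - ‖w‖ ^ 2) ^ lam : ℝ)) (unitBall n) :=
      ContinuousOn.rpow_const (by fun_prop) fun w hw =>
        Or.inl (one_sub_normSq_pos (by simpa using hw)).ne'
    classical
    have := ((Complex.continuous_ofReal.comp_continuousOn hc).mul hd).measurable_piecewise
      (g := fun _ => (0 : ℂ)) continuousOn_const measurableSet_ball
    rw [hF, ← Set.piecewise_eq_indicator]
    exact this
  have e1 : ∫ z, ((1 - ‖z‖ ^ 2) ^ lam : ℝ) * ((starRingEnd ℂ) (kern lam x z) * u z) ∂(invMeasure n) =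
      ∫ z, F z ∂(invMeasure n) := by
    refine integral_congr_ae ?_
    filter_upwards [ae_invMeasure_norm_lt n] with z hz
    rw [hF, Set.indicator_of_mem (by simpa using hz)]
  have hmp := measurePreserving_mob hx
  have e2 : ∫ z, F z ∂(invMeasure n) = ∫ z, F (mob x z) ∂(invMeasure n) := by
    have h := integral_map hmp.measurable.aemeasurable
      (f := F) (by rw [hmp.map_eq]; exact hFm.aestronglyMeasurable)
    rwa [hmp.map_eq] at h
  rw [e1, e2]
  refine integral_congr_ae ?_
  filter_upwards [ae_invMeasure_norm_lt n] with w hw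
  rw [hF, Set.indicator_of_mem (by simpa using norm_mob_lt_one hx hw), kern,
    one_sub_inner_mob_left hx hw, one_sub_normSq_mob hx hw, ← mul_assoc]
  have e3 : (1 - (‖x‖ : ℂ) ^ 2) = ((1 - ‖x‖ ^ 2 : ℝ) : ℂ) := by push_cast; rfl
  rw [e3, conj_cpow_div_mul (one_sub_normSq_pos hx) (one_sub_inner_re_pos hx hw) lam
    (one_sub_normSq_pos hw), transfer]
  ring

theorem norm_kern_le {lam : ℝ} (hlam : 0 ≤ lam) {x w : Cn n} (hx : ‖x‖ < 1) (hw : ‖w‖ < 1) :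
    ‖kern lam x w‖ ≤ (1 - ‖x‖) ^ (-lam) := by
  have h1 : (-lam : ℂ) = ((-lam : ℝ) : ℂ) := by simp
  rw [kern, h1, Complex.norm_cpow_real]
  refine Real.rpow_le_rpow_of_nonpos (by linarith) ?_ (by linarith)
  have h2 : ‖(inner ℂ x w : ℂ)‖ ≤ ‖x‖ := (norm_inner_le_norm x w).trans
    (mul_le_of_le_one_right (norm_nonneg _) hw.le)
  have h3 := norm_sub_norm_le (1 : ℂ) (inner ℂ x w)
  rw [norm_one] at h3
  linarith

theorem memLp_kern (hn : 1 ≤ n) {lam : ℝ} (hlam : n < lam) {x : Cn n} (hx : ‖x‖ < 1) :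
    MemLp (kern lam x) 2 (bergmanMeasure n lam) := by
  have := isProbabilityMeasure_bergmanMeasure hn hlam
  have hn0 : (0 : ℝ) ≤ n := Nat.cast_nonneg n
  refine MemLp.of_bound (aestronglyMeasurable_of_differentiableOn lam (differentiableOn_kernel lam hx))
    ((1 - ‖x‖) ^ (-lam)) ?_
  filter_upwards [ae_bergmanMeasure_norm_lt n lam] with w hw
  exact norm_kern_le (by linarith) hx hw

/-- The reproducing kernel as an element of the Bergman space. -/
noncomputable def kernVec (hn : 1 ≤ n) {lam : ℝ} (hlam : n < lam) {x : Cn n} (hx : ‖x‖ < 1) :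
    bergmanSpace n lam :=
  ⟨(memLp_kern hn hlam hx).toLp, kern lam x, differentiableOn_kernel lam hx,
    (memLp_kern hn hlam hx).coeFn_toLp⟩

theorem kernVec_ae (hn : 1 ≤ n) {lam : ℝ} (hlam : n < lam) {x : Cn n} (hx : ‖x‖ < 1) :
    (kernVec hn hlam hx : Lp ℂ 2 (bergmanMeasure n lam)) =ᵐ[bergmanMeasure n lam] kern lam x :=
  (memLp_kern hn hlam hx).coeFn_toLp

/-- For fixed x the kernel is bounded on the ball, so it satisfies every growth condition defining
𝒟. -/
theorem kernVec_mem_commonDomain (hn : 1 ≤ n) {lam : ℝ} (hlam : n < lam) {x : Cn n}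
    (hx : ‖x‖ < 1) : kernVec hn hlam hx ∈ commonDomain n lam := by
  have hn0 : (0 : ℝ) ≤ n := Nat.cast_nonneg n
  refine ⟨kern lam x, differentiableOn_kernel lam hx, fun ρ hρ => ⟨(1 - ‖x‖) ^ (-lam), fun w hw => ?_⟩,
    kernVec_ae hn hlam hx⟩
  have hw' : ‖w‖ < 1 := by simpa using hw
  have h1 : 1 ≤ (1 - ‖w‖ ^ 2) ^ (-ρ) :=
    Real.one_le_rpow_of_pos_of_le_one_of_nonpos (one_sub_normSq_pos hw')
      (by nlinarith [norm_nonneg w]) (by linarith)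
  have h2 : 0 ≤ (1 - ‖x‖) ^ (-lam) := Real.rpow_nonneg (by linarith) _
  exact (norm_kern_le (by linarith) hx hw').trans (le_mul_of_one_le_right h2 h1)

theorem inner_kernVec (hn : 1 ≤ n) {lam : ℝ} (hlam : n < lam) {x : Cn n} (hx : ‖x‖ < 1)
    (h : Lp ℂ 2 (bergmanMeasure n lam)) :
    inner ℂ (kernVec hn hlam hx : Lp ℂ 2 (bergmanMeasure n lam)) h =
      ∫ w, (starRingEnd ℂ) (kern lam x w) * h w ∂(bergmanMeasure n lam) := by
  rw [L2.inner_def]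
  refine integral_congr_ae ?_
  filter_upwards [kernVec_ae hn hlam hx] with w hw
  rw [hw, RCLike.inner_apply, mul_comm]

theorem inner_kernVec_of_ae (hn : 1 ≤ n) {lam : ℝ} (hlam : n < lam) {x : Cn n} (hx : ‖x‖ < 1)
    {h : Lp ℂ 2 (bergmanMeasure n lam)} {u : Cn n → ℂ} (hu : DifferentiableOn ℂ u (unitBall n))
    (hhu : h =ᵐ[bergmanMeasure n lam] u) :
    inner ℂ (kernVec hn hlam hx : Lp ℂ 2 (bergmanMeasure n lam)) h = u x := by
  rw [inner_kernVec, ← integral_conj_kern_mul hn hlam hx hu ((Lp.memLp h).ae_eq hhu)]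
  refine integral_congr_ae ?_
  filter_upwards [hhu] with w hw
  rw [hw]

/-- An element orthogonal to 𝒟 is orthogonal to all kernels, hence its holomorphic representative
vanishes at every point. -/
theorem dense_commonDomain (hn : 1 ≤ n) {lam : ℝ} (hlam : n < lam) :
    Dense (commonDomain n lam : Set (bergmanSpace n lam)) := by
  rw [Submodule.dense_iff_topologicalClosure_eq_top, Submodule.topologicalClosure_eq_top_iff,
    Submodule.eq_bot_iff]
  rintro ⟨v, u, hu, hvu⟩ hv
  rw [Submodule.mem_orthogonal] at hv
  have h0 : ∀ x : Cn n, ‖x‖ < 1 → u x = 0 := fun x hx => by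
    rw [← inner_kernVec_of_ae hn hlam hx hu hvu]
    exact hv _ (kernVec_mem_commonDomain hn hlam hx)
  refine Subtype.ext (Lp.ext ?_)
  filter_upwards [hvu, ae_bergmanMeasure_norm_lt n lam,
    Lp.coeFn_zero ℂ 2 (bergmanMeasure n lam)] with x h1 h2 h3
  change v x = (0 : Lp ℂ 2 (bergmanMeasure n lam)) x
  rw [h1, h0 x h2, h3]
  rfl

theorem coeFn_bergmanProj (hn : 1 ≤ n) {lam : ℝ} (hlam : n < lam)
    (h : Lp ℂ 2 (bergmanMeasure n lam)) :
    (bergmanProj n lam h : Lp ℂ 2 (bergmanMeasure n lam)) =ᵐ[bergmanMeasure n lam]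
      fun x => ∫ w, (starRingEnd ℂ) (kern lam x w) * h w ∂(bergmanMeasure n lam) := by
  obtain ⟨u, hu, hhu⟩ := (bergmanProj n lam h).2
  filter_upwards [hhu, ae_bergmanMeasure_norm_lt n lam] with x h1 h2
  rw [h1, ← inner_kernVec_of_ae hn hlam h2 hu hhu, ← inner_kernVec hn hlam h2]
  exact Submodule.inner_orthogonalProjectionOnto_eq_of_mem_left (kernVec hn hlam h2) h

/-! ### Schur's test and Hankel operators of slowly varying symbols -/

/-- Cauchy–Schwarz against the constant function. -/
theorem sq_lintegral_le {α : Type*} [MeasurableSpace α] (ν : Measure α) {U : α → ℝ≥0∞}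
    (hU : AEMeasurable U ν) : (∫⁻ a, U a ∂ν) ^ 2 ≤ ν Set.univ * ∫⁻ a, U a ^ 2 ∂ν := by
  have h := ENNReal.lintegral_mul_le_Lp_mul_Lq ν (p := 2) (q := 2) Real.HolderConjugate.two_two
    hU (aemeasurable_const (b := (1 : ℝ≥0∞)))
  simp only [Pi.mul_apply, mul_one, ENNReal.rpow_ofNat, one_pow, lintegral_const, one_mul] at h
  have h2 := pow_le_pow_left' h 2
  have h3 : ∀ a : ℝ≥0∞, (a ^ (1 / 2 : ℝ)) ^ 2 = a := fun a => by
    rw [← ENNReal.rpow_natCast, ← ENNReal.rpow_mul]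
    simp
  rwa [mul_pow, h3, h3, mul_comm] at h2

/-- Schur's test with constant test functions. -/
theorem lintegral_sq_lintegral_le {k : Cn n → Cn n → ℝ≥0∞} (hk : Measurable (Function.uncurry k))
    {S : ℝ≥0∞} (hS : ∀ x, ‖x‖ < 1 → ∫⁻ w, k x w ∂(invMeasure n) ≤ S)
    (hsymm : ∀ x w, ‖x‖ < 1 → ‖w‖ < 1 → k x w = k w x) {U : Cn n → ℝ≥0∞} (hU : Measurable U) :
    ∫⁻ x, (∫⁻ w, k x w * U w ∂(invMeasure n)) ^ 2 ∂(invMeasure n) ≤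
      S ^ 2 * ∫⁻ w, U w ^ 2 ∂(invMeasure n) := by
  have hk1 : ∀ x, Measurable (k x) := fun x => hk.comp measurable_prodMk_left
  calc ∫⁻ x, (∫⁻ w, k x w * U w ∂(invMeasure n)) ^ 2 ∂(invMeasure n)
      ≤ ∫⁻ x, S * ∫⁻ w, k x w * U w ^ 2 ∂(invMeasure n) ∂(invMeasure n) := by
        refine lintegral_mono_ae ?_
        filter_upwards [ae_invMeasure_norm_lt n] with x hx
        -- Cauchy–Schwarz for the measure with density k(x,·), whose total mass is at most S.
        have h := sq_lintegral_le ((invMeasure n).withDensity (k x)) hU.aemeasurable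
        rw [lintegral_withDensity_eq_lintegral_mul _ (hk1 x) hU,
          lintegral_withDensity_eq_lintegral_mul _ (hk1 x) (hU.pow_const 2),
          withDensity_apply _ MeasurableSet.univ, Measure.restrict_univ] at h
        exact h.trans (mul_le_mul_left (hS x hx) _)
    _ = S * ∫⁻ w, ∫⁻ x, k x w * U w ^ 2 ∂(invMeasure n) ∂(invMeasure n) := by
        have hj : Measurable (Function.uncurry fun x w => k x w * U w ^ 2) :=
          hk.mul ((hU.comp measurable_snd).pow_const 2)
        rw [lintegral_const_mul _ (show Measurable fun x => ∫⁻ w, k x w * U w ^ 2 ∂(invMeasure n) from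
          hj.lintegral_prod_right'), lintegral_lintegral_swap hj.aemeasurable]
    _ ≤ S * ∫⁻ w, S * U w ^ 2 ∂(invMeasure n) := by
        refine mul_le_mul_right (lintegral_mono_ae ?_) _
        filter_upwards [ae_invMeasure_norm_lt n] with w hw
        have h1 : ∫⁻ x, k x w ∂(invMeasure n) ≤ S := by
          refine le_trans (lintegral_mono_ae ?_) (hS w hw)
          filter_upwards [ae_invMeasure_norm_lt n] with x hx
          rw [hsymm x w hx hw]
        rw [lintegral_mul_const _ (show Measurable fun x => k x w from hk.comp measurable_prodMk_right)]
        exact mul_le_mul_left h1 _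
    _ = S ^ 2 * ∫⁻ w, U w ^ 2 ∂(invMeasure n) := by
        rw [lintegral_const_mul _ (hU.pow_const 2)]
        ring

theorem enorm_sq_eq_lintegral {lam : ℝ} (F : Lp ℂ 2 (bergmanMeasure n lam)) :
    ‖F‖ₑ ^ 2 = ∫⁻ w, ‖F w‖ₑ ^ 2 ∂(bergmanMeasure n lam) := by
  rw [Lp.enorm_def, eLpNorm_eq_lintegral_rpow_enorm_toReal (by simp) (by simp)]
  simp only [ENNReal.toReal_ofNat, ENNReal.rpow_ofNat]
  rw [← ENNReal.rpow_natCast, ← ENNReal.rpow_mul]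
  simp

theorem defPow_mob (lam : ℝ) {x w : Cn n} (hx : ‖x‖ < 1) (hw : ‖w‖ < 1) :
    defPow lam (mob x w) = ‖kern lam x w‖ₑ ^ 2 * defPow lam w * defPow lam x := by
  have h := enorm_transfer_sq lam hx hw fun _ => 1
  simpa [transfer, kern] using h.symm

theorem defPow_half_sq (lam : ℝ) {w : Cn n} (hw : ‖w‖ < 1) : defPow (lam / 2) w ^ 2 = defPow lam w := by
  rw [sq, ← defPow_add hw, add_halves]

theorem defPow_half_mob (lam : ℝ) {x w : Cn n} (hx : ‖x‖ < 1) (hw : ‖w‖ < 1) :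
    defPow (lam / 2) (mob x w) = ‖kern lam x w‖ₑ * defPow (lam / 2) w * defPow (lam / 2) x := by
  have h := defPow_mob lam hx hw
  rw [← defPow_half_sq lam hx, ← defPow_half_sq lam hw,
    ← defPow_half_sq lam (norm_mob_lt_one hx hw), ← mul_pow, ← mul_pow] at h
  exact (ENNReal.pow_right_strictMono two_ne_zero).injective h

theorem invMeasure_ac_bergmanMeasure (hn : 1 ≤ n) {lam : ℝ} (hlam : n < lam) :
    invMeasure n ≪ bergmanMeasure n lam := by
  rw [bergmanMeasure_eq]
  refine (withDensity_absolutelyContinuous' (measurable_defPow _).aemeasurable ?_).trans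
    (Measure.absolutelyContinuous_smul (ENNReal.inv_ne_zero.2 (defInt_ne_top hn hlam)))
  filter_upwards [ae_invMeasure_norm_lt n] with z hz
  exact defPow_ne_zero hz

theorem enorm_sq_eq_lintegral_invMeasure {lam : ℝ} (F : Lp ℂ 2 (bergmanMeasure n lam)) :
    ‖F‖ₑ ^ 2 = (defInt n lam)⁻¹ * ∫⁻ w, (‖F w‖ₑ * defPow (lam / 2) w) ^ 2 ∂(invMeasure n) := by
  rw [enorm_sq_eq_lintegral, lintegral_bergmanMeasure]
  congr 1
  refine lintegral_congr_ae ?_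
  filter_upwards [ae_invMeasure_norm_lt n] with w hw
  rw [mul_pow, defPow_half_sq lam hw, mul_comm]

/-- Multiplying by (1-|x|²)^(λ/2) turns |K_λ| into (1-d²)^(λ/2), and the permitted growth
(1-d²)^(-λ/4) leaves (1-d²)^(λ/4). This kernel is symmetric and Möbius invariant, so all its row
integrals equal `defInt n (lam / 4)` and constant test functions suffice. -/
theorem enorm_le_of_kern_bound (hn : 1 ≤ n) {lam : ℝ} (hlam : n < lam) {A : ℝ≥0∞}
    {F v : Lp ℂ 2 (bergmanMeasure n lam)}
    (hpt : ∀ᵐ x ∂(bergmanMeasure n lam), ‖F x‖ₑ ≤ ∫⁻ w, ‖kern lam x w‖ₑ * ‖v w‖ₑ *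
      (A * defPow (-(lam / 4)) (mob x w)) ∂(bergmanMeasure n lam)) :
    ‖F‖ₑ ≤ A * ((defInt n lam)⁻¹ * defInt n (lam / 4)) * ‖v‖ₑ := by
  set μ := invMeasure n with hμ
  set C := (defInt n lam)⁻¹ with hC
  have hvm : Measurable fun w => ‖v w‖ₑ := (Lp.stronglyMeasurable v).measurable.enorm
  set U : Cn n → ℝ≥0∞ := fun w => ‖v w‖ₑ * defPow (lam / 2) w with hU
  have hUm : Measurable U := hvm.mul (measurable_defPow _)
  set k : Cn n → Cn n → ℝ≥0∞ := fun x w => defPow (lam / 4) (mob x w) with hk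
  have hkm : Measurable (Function.uncurry k) := (measurable_defPow _).comp measurable_mob_uncurry
  have hkx : ∀ x, Measurable (k x) := fun x => (measurable_defPow _).comp (measurable_mob x)
  have hschur := lintegral_sq_lintegral_le hkm (S := defInt n (lam / 4))
    (fun x hx => (lintegral_mob hx (measurable_defPow _)).le)
    (fun x w hx hw => by simp only [hk, defPow, norm_mob_comm hx hw]) hUm
  have hVU : ∀ᵐ x ∂μ, ‖F x‖ₑ * defPow (lam / 2) x ≤ C * (A * ∫⁻ w, k x w * U w ∂μ) := by
    refine (invMeasure_ac_bergmanMeasure hn hlam).ae_le ?_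
    filter_upwards [hpt, ae_bergmanMeasure_norm_lt n lam] with x h1 hx
    have h2 := lintegral_bergmanMeasure n lam fun w =>
      ‖kern lam x w‖ₑ * ‖v w‖ₑ * (A * defPow (-(lam / 4)) (mob x w))
    rw [h2] at h1
    refine (mul_le_mul_left h1 _).trans ?_
    rw [mul_assoc]
    refine mul_le_mul_right ?_ _
    rw [← lintegral_const_mul _ (show Measurable fun w => k x w * U w from (hkx x).mul hUm),
      ← lintegral_mul_const' _ _ defPow_ne_top]
    refine lintegral_mono_ae ?_
    filter_upwards [ae_invMeasure_norm_lt n] with w hw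
    have e1 : defPow lam w = defPow (lam / 2) w * defPow (lam / 2) w := by
      rw [← sq, defPow_half_sq lam hw]
    have e2 : defPow (lam / 4) (mob x w) =
        defPow (lam / 2) (mob x w) * defPow (-(lam / 4)) (mob x w) := by
      rw [← defPow_add (norm_mob_lt_one hx hw)]
      congr 1
      ring
    simp only [hk, hU, e2, defPow_half_mob lam hx hw, e1]
    exact le_of_eq (by ring)
  have hfin : ‖F‖ₑ ^ 2 ≤ (A * (C * defInt n (lam / 4)) * ‖v‖ₑ) ^ 2 := by
    rw [mul_pow, enorm_sq_eq_lintegral_invMeasure, enorm_sq_eq_lintegral_invMeasure]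
    calc C * ∫⁻ w, (‖F w‖ₑ * defPow (lam / 2) w) ^ 2 ∂μ
        ≤ C * ∫⁻ x, (C * A) ^ 2 * (∫⁻ w, k x w * U w ∂μ) ^ 2 ∂μ := by
          refine mul_le_mul_right (lintegral_mono_ae ?_) _
          filter_upwards [hVU] with x hx
          rw [← mul_pow, mul_assoc]
          exact pow_le_pow_left' hx 2
      _ ≤ C * ((C * A) ^ 2 * (defInt n (lam / 4) ^ 2 * ∫⁻ w, U w ^ 2 ∂μ)) := by
          have hj1 : Measurable (Function.uncurry fun x w => k x w * U w) :=
            hkm.mul (hUm.comp measurable_snd)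
          have hj : Measurable fun x => (∫⁻ w, k x w * U w ∂μ) ^ 2 :=
            (show Measurable fun x => ∫⁻ w, k x w * U w ∂μ from
              hj1.lintegral_prod_right').pow_const 2
          rw [lintegral_const_mul _ hj]
          exact mul_le_mul_right (mul_le_mul_right hschur _) _
      _ = _ := by ring
  exact (ENNReal.pow_right_strictMono two_ne_zero).le_iff_le.1 hfin

/-- The Hankel operator is controlled by the oscillation of the symbol. -/
theorem enorm_sub_bergmanProj_le (hn : 1 ≤ n) {lam : ℝ} (hlam : n < lam) {A : ℝ≥0∞}
    {g : Cn n → ℂ}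
    (hg : ∀ z w, ‖z‖ < 1 → ‖w‖ < 1 → ‖g z - g w‖ₑ ≤ A * defPow (-(lam / 4)) (mob z w))
    (u : bergmanSpace n lam) (h : Lp ℂ 2 (bergmanMeasure n lam))
    (hh : h =ᵐ[bergmanMeasure n lam] fun z => g z * (u : Lp ℂ 2 (bergmanMeasure n lam)) z) :
    ‖h - bergmanProj n lam h‖ₑ ≤ A * ((defInt n lam)⁻¹ * defInt n (lam / 4)) * ‖u‖ₑ := by
  refine enorm_le_of_kern_bound hn hlam (v := u) ?_
  obtain ⟨f, hf, hvf⟩ := u.2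
  have hint : ∀ y : Lp ℂ 2 (bergmanMeasure n lam), ∀ x, ‖x‖ < 1 →
      Integrable (fun w => (starRingEnd ℂ) (kern lam x w) * y w) (bergmanMeasure n lam) :=
    fun y x hx => by
      have h1 : MemLp (fun w => (starRingEnd ℂ) (kern lam x w)) 2 (bergmanMeasure n lam) :=
        (memLp_kern hn hlam hx).star
      exact h1.integrable_mul (Lp.memLp y)
  filter_upwards [Lp.coeFn_sub h (bergmanProj n lam h), coeFn_bergmanProj hn hlam h, hh, hvf,
    ae_bergmanMeasure_norm_lt n lam] with x h1 h2 h3 h4 hx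
  have h5 := inner_kernVec_of_ae hn hlam hx hf hvf
  rw [← h4, inner_kernVec hn hlam hx] at h5
  -- The value u(x) is itself written by the reproducing formula, so that g(x)u(x) - P(gu)(x)
  -- becomes one integral against g(x) - g(w).
  rw [h1, Pi.sub_apply, h2, h3, ← h5, ← integral_const_mul,
    ← integral_sub ((hint u x hx).const_mul _) (hint h x hx)]
  refine (enorm_integral_le_lintegral_enorm _).trans (lintegral_mono_ae ?_)
  filter_upwards [hh, ae_bergmanMeasure_norm_lt n lam] with w hw hw1
  have e : g x * ((starRingEnd ℂ) (kern lam x w) * (u : Lp ℂ 2 (bergmanMeasure n lam)) w) -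
      (starRingEnd ℂ) (kern lam x w) * h w =
      (starRingEnd ℂ) (kern lam x w) * (u : Lp ℂ 2 (bergmanMeasure n lam)) w * (g x - g w) := by
    rw [hw]
    ring
  rw [e, enorm_mul, enorm_mul, RCLike.enorm_conj]
  exact mul_le_mul_right (hg x w hx hw1) _

/-! ### Chaining: from oscillation at one scale to global growth -/

theorem norm_mob_smul {y : Cn n} {t : ℝ} (ht0 : 0 ≤ t) (ht1 : t ≤ 1) (hy : ‖y‖ < 1) :
    ‖mob ((t : ℂ) • y) y‖ * (1 - t * ‖y‖ ^ 2) = (1 - t) * ‖y‖ := by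
  have hty : ‖(t : ℂ) • y‖ = t * ‖y‖ := by
    rw [norm_smul, Complex.norm_real, Real.norm_of_nonneg ht0]
  have hty1 : ‖(t : ℂ) • y‖ < 1 := by
    rw [hty]
    nlinarith [norm_nonneg y]
  have h := normSq_mob_mul hty1 hy
  have hyy : (inner ℂ y y : ℂ) = ((‖y‖ ^ 2 : ℝ) : ℂ) := by
    rw [inner_self_eq_norm_sq_to_K]; push_cast; rfl
  have hp : 0 < 1 - t * ‖y‖ ^ 2 := by nlinarith [norm_nonneg y]
  have e1 : ‖(1 - inner ℂ ((t : ℂ) • y) y : ℂ)‖ = 1 - t * ‖y‖ ^ 2 := by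
    rw [inner_smul_left, Complex.conj_ofReal, hyy, ← Complex.ofReal_mul, ← Complex.ofReal_one,
      ← Complex.ofReal_sub, Complex.norm_real, Real.norm_of_nonneg hp.le]
  have e2 : y - (t : ℂ) • y = ((1 - t : ℝ) : ℂ) • y := by
    push_cast
    rw [sub_smul, one_smul]
  have e3 : ‖y - (t : ℂ) • y‖ = (1 - t) * ‖y‖ := by
    rw [e2, norm_smul, Complex.norm_real, Real.norm_of_nonneg (by linarith)]
  have e4 : ‖(inner ℂ ((t : ℂ) • y) (y - (t : ℂ) • y) : ℂ)‖ = t * (1 - t) * ‖y‖ ^ 2 := by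
    rw [e2, inner_smul_left, inner_smul_right, Complex.conj_ofReal, hyy, ← Complex.ofReal_mul,
      ← Complex.ofReal_mul, Complex.norm_real, Real.norm_of_nonneg]
    · ring
    · have : 0 ≤ 1 - t := by linarith
      positivity
  rw [e1, e3, e4, hty, ← mul_pow] at h
  have h2 : (‖mob ((t : ℂ) • y) y‖ * (1 - t * ‖y‖ ^ 2)) ^ 2 = ((1 - t) * ‖y‖) ^ 2 := by
    rw [h]; ring
  exact (pow_left_inj₀ (mul_nonneg (norm_nonneg _) hp.le)
    (mul_nonneg (by linarith) (norm_nonneg _)) two_ne_zero).1 h2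

/-- The point y is joined to 0 by radial steps of pseudohyperbolic length at most r. Each step
inwards divides 1-|y| by 1-r, so N steps reach the origin once (1-r)^N ≤ 1-|y|. -/
theorem norm_sub_zero_le_of_chain {E : Type*} [SeminormedAddCommGroup E] {g : Cn n → E} {r A : ℝ}
    (hr0 : 0 < r) (hr1 : r < 1)
    (hA : ∀ z w, ‖z‖ < 1 → ‖w‖ < 1 → ‖mob z w‖ ≤ r → ‖g z - g w‖ ≤ A) (N : ℕ) :
    ∀ y : Cn n, ‖y‖ < 1 → (1 - r) ^ N ≤ 1 - ‖y‖ → ‖g 0 - g y‖ ≤ N * A := by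
  have hA0 : 0 ≤ A := (norm_nonneg _).trans (hA 0 0 (by simp) (by simp) (by simpa using hr0.le))
  induction N with
  | zero =>
    intro y _ hN
    have : y = 0 := norm_le_zero_iff.1 (by simpa using hN)
    simp [this]
  | succ N ih =>
    intro y hy hN
    set s := ‖y‖ with hs
    have h1r : 0 < 1 - r := by linarith
    rcases le_or_gt s r with hsr | hsr
    · have := hA 0 y (by simp) hy (by simpa using hsr)
      push_cast
      nlinarith [(Nat.cast_nonneg N : (0 : ℝ) ≤ N)]
    · have hs0 : 0 < s := hr0.trans hsr
      -- The new radius p satisfies 1-p = (1-s)/(1-r). The step has length (s-p)/(1-ps) =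
      -- r(1-p)/(1-ps), which is at most r since ps ≤ p.
      set p := (s - r) / (1 - r) with hp
      have hp0 : 0 ≤ p := div_nonneg (by linarith) h1r.le
      have hps : p ≤ s := by
        rw [hp, div_le_iff₀ h1r]
        nlinarith
      set t := p / s with ht
      have ht0 : 0 ≤ t := div_nonneg hp0 hs0.le
      have ht1 : t ≤ 1 := div_le_one_of_le₀ hps hs0.le
      have hts : t * s = p := div_mul_cancel₀ _ hs0.ne'
      have hty : ‖(t : ℂ) • y‖ = p := by
        rw [norm_smul, Complex.norm_real, Real.norm_of_nonneg ht0, ← hs, hts]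
      have h1p : 1 - p = (1 - s) / (1 - r) := by
        rw [hp]
        field_simp
        ring
      have h2 := ih ((t : ℂ) • y) (by rw [hty]; linarith) (by
        rw [hty, h1p, le_div_iff₀ h1r, ← pow_succ]
        exact hN)
      have h3 := norm_mob_smul ht0 ht1 hy
      rw [← hs] at h3
      have h4 : (1 - t) * s ≤ r * (1 - t * s ^ 2) := by
        have e1 : (1 - t) * s = r * (1 - p) := by
          rw [sub_mul, hts, h1p, hp]
          field_simp
          ring
        have e2 : t * s ^ 2 = p * s := by rw [← hts]; ring
        rw [e1, e2]
        have : p * s ≤ p := mul_le_of_le_one_right hp0 hy.le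
        gcongr
      have h5 : 0 < 1 - t * s ^ 2 := by nlinarith
      have h6 : ‖mob ((t : ℂ) • y) y‖ ≤ r := by
        rw [← h3] at h4
        exact le_of_mul_le_mul_right h4 h5
      have h7 := hA ((t : ℂ) • y) y (by rw [hty]; linarith) hy h6
      calc ‖g 0 - g y‖ ≤ ‖g 0 - g ((t : ℂ) • y)‖ + ‖g ((t : ℂ) • y) - g y‖ := norm_sub_le_norm_sub_add_norm_sub _ _ _
        _ ≤ N * A + A := add_le_add h2 h7
        _ = _ := by push_cast; ring

/-- Functions of bounded oscillation at a fixed scale grow at most logarithmically. -/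
theorem norm_sub_le_of_chain {E : Type*} [SeminormedAddCommGroup E] {g : Cn n → E} {r A : ℝ}
    (hr0 : 0 < r) (hr1 : r < 1)
    (hA : ∀ z w, ‖z‖ < 1 → ‖w‖ < 1 → ‖mob z w‖ ≤ r → ‖g z - g w‖ ≤ A) {z w : Cn n}
    (hz : ‖z‖ < 1) (hw : ‖w‖ < 1) :
    ‖g z - g w‖ ≤ A * (1 + -Real.log (1 - ‖mob z w‖) / r) := by
  have hA0 : 0 ≤ A := (norm_nonneg _).trans (hA 0 0 (by simp) (by simp) (by simpa using hr0.le))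
  have hd := norm_mob_lt_one hz hw
  set d := ‖mob z w‖ with hdd
  have hlog : 0 ≤ -Real.log (1 - d) / r := by
    have := Real.log_nonpos (by linarith : 0 ≤ 1 - d) (by linarith [norm_nonneg (mob z w)])
    exact div_nonneg (by linarith) hr0.le
  set N := ⌈-Real.log (1 - d) / r⌉₊ with hN
  have h1 : (1 - r) ^ N ≤ 1 - d := by
    have h2 : -Real.log (1 - d) / r ≤ N := Nat.le_ceil _
    rw [div_le_iff₀ hr0] at h2
    calc (1 - r) ^ N ≤ (Real.exp (-r)) ^ N := by
          gcongr
          exact Real.one_sub_le_exp_neg r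
      _ = Real.exp (N * -r) := (Real.exp_nat_mul _ _).symm
      _ ≤ Real.exp (Real.log (1 - d)) := Real.exp_le_exp.2 (by linarith)
      _ = 1 - d := Real.exp_log (by linarith)
  -- Composition with `mob z` preserves the hypothesis and reduces the pair z, w to the pair 0, `mob
  -- z w`.
  have h3 := norm_sub_zero_le_of_chain (g := fun y => g (mob z y)) hr0 hr1
    (fun a b ha hb hab => hA _ _ (norm_mob_lt_one hz ha) (norm_mob_lt_one hz hb)
      (by rwa [norm_mob_mob hz ha hb])) N (mob z w) hd h1
  simp only [mob_zero, mob_mob hz hw] at h3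
  refine h3.trans ?_
  rw [mul_comm]
  gcongr
  linarith [(Nat.ceil_lt_add_one hlog).le]

theorem neg_log_le_aux {d : ℝ} (hd0 : 0 ≤ d) (hd1 : d < 1) {ρ : ℝ} (hρ : 0 < ρ) :
    -Real.log (1 - d) ≤ (1 + 1 / ρ) * (1 - d ^ 2) ^ (-ρ) := by
  have hq : 0 < 1 - d ^ 2 := by nlinarith
  have h1 : 1 - d ^ 2 ≤ 2 * (1 - d) := by nlinarith
  have h2 : Real.log (1 - d ^ 2) ≤ Real.log 2 + Real.log (1 - d) := by
    rw [← Real.log_mul (by norm_num) (by linarith)]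
    exact Real.log_le_log hq h1
  have h3 : Real.log 2 ≤ 1 := by linarith [Real.log_two_lt_d9]
  have h4 : 1 ≤ (1 - d ^ 2) ^ (-ρ) :=
    Real.one_le_rpow_of_pos_of_le_one_of_nonpos hq (by nlinarith) (by linarith)
  have h5 : -Real.log (1 - d ^ 2) ≤ 1 / ρ * (1 - d ^ 2) ^ (-ρ) := by
    have h6 := Real.log_le_sub_one_of_pos (x := (1 - d ^ 2) ^ (-ρ)) (by linarith)
    rw [Real.log_rpow hq] at h6
    rw [div_mul_eq_mul_div, one_mul, le_div_iff₀ hρ]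
    linarith
  linarith

/-- Logarithmic growth is dominated by every negative power of 1-|z|². This is what makes gu square
integrable for uniformly continuous g and u in 𝒟. -/
theorem exists_norm_le_of_chain {g : Cn n → ℂ} {r A : ℝ} (hr0 : 0 < r) (hr1 : r < 1)
    (hA : ∀ z w, ‖z‖ < 1 → ‖w‖ < 1 → ‖mob z w‖ ≤ r → ‖g z - g w‖ ≤ A) {ρ : ℝ} (hρ : 0 < ρ) :
    ∃ C : ℝ, 0 ≤ C ∧ ∀ z : Cn n, ‖z‖ < 1 → ‖g z‖ ≤ C * (1 - ‖z‖ ^ 2) ^ (-ρ) := by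
  have hA0 : 0 ≤ A := (norm_nonneg _).trans (hA 0 0 (by simp) (by simp) (by simpa using hr0.le))
  refine ⟨‖g 0‖ + A * (1 + (1 + 1 / ρ) / r), by positivity, fun z hz => ?_⟩
  have h1 := norm_sub_le_of_chain hr0 hr1 hA (z := 0) (by simp) hz
  rw [mob_zero_left, norm_neg] at h1
  have h2 := neg_log_le_aux (norm_nonneg z) hz hρ
  have h4 : 1 ≤ (1 - ‖z‖ ^ 2) ^ (-ρ) :=
    Real.one_le_rpow_of_pos_of_le_one_of_nonpos (one_sub_normSq_pos hz)
      (by nlinarith [norm_nonneg z]) (by linarith)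
  have h3 : ‖g z‖ ≤ ‖g 0‖ + ‖g 0 - g z‖ := by
    have := norm_sub_norm_le (g z) (g 0)
    rw [norm_sub_rev] at this
    linarith
  set q := (1 - ‖z‖ ^ 2) ^ (-ρ)
  calc ‖g z‖ ≤ ‖g 0‖ + A * (1 + -Real.log (1 - ‖z‖) / r) := by linarith
    _ ≤ ‖g 0‖ * q + A * (1 * q + ((1 + 1 / ρ) * q) / r) := by
        gcongr
        · exact le_mul_of_one_le_right (norm_nonneg _) h4
        · linarith
    _ = _ := by ring

/-- The logarithm is at most 2d/(1-d²), and 2√λ d ≤ 1+λd² by AM–GM. Half of the exponent absorbs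
1+λd² through Bernoulli's inequality, with factor 8; the other half absorbs 1/(1-d²) because λ ≥ 8.
The remaining summand 1 makes the constant 9, independent of λ. -/
theorem osc_aux {d lam : ℝ} (hd0 : 0 ≤ d) (hd1 : d < 1) (hlam : 8 ≤ lam) :
    1 + Real.sqrt lam * -Real.log (1 - d) ≤ 9 * (1 - d ^ 2) ^ (-(lam / 4)) := by
  have hq : 0 < 1 - d ^ 2 := by nlinarith
  have hs := Real.sq_sqrt (by linarith : (0 : ℝ) ≤ lam)
  have hs0 := Real.sqrt_nonneg lam
  set s := Real.sqrt lam
  have h1 : -Real.log (1 - d) ≤ 2 * d / (1 - d ^ 2) := by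
    have h2 := Real.log_le_sub_one_of_pos (x := (1 - d)⁻¹) (by
      have : 0 < 1 - d := by linarith
      positivity)
    rw [Real.log_inv] at h2
    refine h2.trans ?_
    have h3 : 0 < 1 - d := by linarith
    have e : (1 - d)⁻¹ - 1 = d / (1 - d) := by field_simp; ring
    rw [e, div_le_div_iff₀ h3 hq]
    nlinarith [mul_nonneg hd0 h3.le]
  have h4 : s * -Real.log (1 - d) ≤ (1 + lam * d ^ 2) * (1 - d ^ 2)⁻¹ := by
    calc s * -Real.log (1 - d) ≤ s * (2 * d / (1 - d ^ 2)) := by gcongr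
      _ = (2 * (s * d)) * (1 - d ^ 2)⁻¹ := by rw [div_eq_mul_inv]; ring
      _ ≤ _ := by
          gcongr
          nlinarith [sq_nonneg (s * d - 1)]
  have h5 : 1 + lam * d ^ 2 ≤ 8 * (1 - d ^ 2) ^ (-(lam / 8)) := by
    have h6 := one_add_mul_self_le_rpow_one_add (s := d ^ 2) (by nlinarith) (p := lam / 8) (by linarith)
    have h7 : (1 + d ^ 2) ^ (lam / 8) ≤ (1 - d ^ 2) ^ (-(lam / 8)) := by
      rw [Real.rpow_neg hq.le, ← Real.inv_rpow hq.le]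
      refine Real.rpow_le_rpow (by positivity) ?_ (by linarith)
      rw [← one_div, le_div_iff₀ hq]
      nlinarith [sq_nonneg (d ^ 2)]
    linarith
  have h8 : (1 - d ^ 2)⁻¹ ≤ (1 - d ^ 2) ^ (-(lam / 8)) := by
    rw [← Real.rpow_neg_one]
    exact Real.rpow_le_rpow_of_exponent_ge hq (by nlinarith) (by linarith)
  have h9 : (1 - d ^ 2) ^ (-(lam / 4)) = (1 - d ^ 2) ^ (-(lam / 8)) * (1 - d ^ 2) ^ (-(lam / 8)) := by
    rw [← Real.rpow_add hq]
    congr 1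
    ring
  have h10 : 1 ≤ (1 - d ^ 2) ^ (-(lam / 8)) :=
    Real.one_le_rpow_of_pos_of_le_one_of_nonpos hq (by nlinarith) (by linarith)
  rw [h9]
  have h11 : (1 + lam * d ^ 2) * (1 - d ^ 2)⁻¹ ≤
      8 * (1 - d ^ 2) ^ (-(lam / 8)) * (1 - d ^ 2) ^ (-(lam / 8)) := by gcongr
  nlinarith

theorem enorm_sub_le_defPow {g : Cn n → ℂ} {r A lam : ℝ} (hr0 : 0 < r) (hr1 : r < 1)
    (hlam : 8 ≤ lam) (hrl : 1 ≤ lam * r ^ 2)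
    (hA : ∀ z w, ‖z‖ < 1 → ‖w‖ < 1 → ‖mob z w‖ ≤ r → ‖g z - g w‖ ≤ A) {z w : Cn n}
    (hz : ‖z‖ < 1) (hw : ‖w‖ < 1) :
    ‖g z - g w‖ₑ ≤ ENNReal.ofReal (9 * A) * defPow (-(lam / 4)) (mob z w) := by
  have hA0 : 0 ≤ A := (norm_nonneg _).trans (hA 0 0 (by simp) (by simp) (by simpa using hr0.le))
  have hd := norm_mob_lt_one hz hw
  have h1 := norm_sub_le_of_chain hr0 hr1 hA hz hw
  have h2 := osc_aux (norm_nonneg _) hd hlam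
  rw [defPow, ← ENNReal.ofReal_mul (by positivity), ← ofReal_norm]
  refine ENNReal.ofReal_le_ofReal (h1.trans ?_)
  have hlog : 0 ≤ -Real.log (1 - ‖mob z w‖) := by
    have := Real.log_nonpos (by linarith : 0 ≤ 1 - ‖mob z w‖) (by linarith [norm_nonneg (mob z w)])
    linarith
  have h3 : -Real.log (1 - ‖mob z w‖) / r ≤ Real.sqrt lam * -Real.log (1 - ‖mob z w‖) := by
    rw [div_eq_mul_inv, mul_comm]
    refine mul_le_mul_of_nonneg_right ?_ hlog
    refine Real.le_sqrt_of_sq_le ?_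
    rw [inv_pow, inv_le_iff_one_le_mul₀ (by positivity)]
    exact hrl
  calc A * (1 + -Real.log (1 - ‖mob z w‖) / r)
      ≤ A * (9 * (1 - ‖mob z w‖ ^ 2) ^ (-(lam / 4))) := by
        gcongr
        linarith
    _ = _ := by ring

/-- Hankel operators with symbols of small oscillation at the scale `λ^(-1/2)` are small. -/
theorem exists_enorm_sub_bergmanProj_le (hn : 1 ≤ n) : ∃ K : ℝ≥0∞, K ≠ ∞ ∧
    ∀ (lam r A : ℝ) (g : Cn n → ℂ), 8 * (n + 1) ≤ lam → 0 < r → r < 1 → 1 ≤ lam * r ^ 2 →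
      (∀ z w, ‖z‖ < 1 → ‖w‖ < 1 → ‖mob z w‖ ≤ r → ‖g z - g w‖ ≤ A) →
      ∀ (u : bergmanSpace n lam) (h : Lp ℂ 2 (bergmanMeasure n lam)),
        h =ᵐ[bergmanMeasure n lam] (fun z => g z * (u : Lp ℂ 2 (bergmanMeasure n lam)) z) →
        ‖h - bergmanProj n lam h‖ₑ ≤ K * ENNReal.ofReal A * ‖u‖ₑ := by
  obtain ⟨K, hK, hKb⟩ := exists_defInt_le n
  refine ⟨9 * K, ENNReal.mul_ne_top (by simp) hK, fun lam r A g hlam hr0 hr1 hrl hA u h hh => ?_⟩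
  have hn0 : (0 : ℝ) ≤ n := Nat.cast_nonneg n
  have hlam' : (n : ℝ) < lam := by linarith
  refine (enorm_sub_bergmanProj_le hn hlam' (fun z w hz hw =>
    enorm_sub_le_defPow hr0 hr1 (by linarith) hrl hA hz hw) u h hh).trans ?_
  refine mul_le_mul_left ?_ _
  rw [ENNReal.ofReal_mul (by norm_num), ENNReal.ofReal_ofNat]
  have h1 : (defInt n lam)⁻¹ * defInt n (lam / 4) ≤ K := by
    rw [mul_comm, ← div_eq_mul_inv]
    exact ENNReal.div_le_of_le_mul (hKb lam hlam)
  calc 9 * ENNReal.ofReal A * ((defInt n lam)⁻¹ * defInt n (lam / 4))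
      ≤ 9 * ENNReal.ofReal A * K := mul_le_mul_right h1 _
    _ = _ := by ring

/-! ### The Bergman metric computed explicitly -/

theorem hasDerivAt_normSq_line (z v : Cn n) :
    HasDerivAt (fun t : ℝ => 1 - ‖z + t • v‖ ^ 2) (-(2 * (inner ℂ z v : ℂ).re)) 0 := by
  have e : (fun t : ℝ => 1 - ‖z + t • v‖ ^ 2) =
      fun t : ℝ => 1 - (‖z‖ ^ 2 + 2 * (inner ℂ z v : ℂ).re * t + t ^ 2 * ‖v‖ ^ 2) := by
    ext t
    have h1 : (t • v : Cn n) = (t : ℂ) • v := (Complex.coe_smul t v).symm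
    rw [norm_add_sq (𝕜 := ℂ), h1, inner_smul_right, norm_smul, Complex.norm_real, Real.norm_eq_abs,
      mul_pow, sq_abs]
    simp only [RCLike.re_to_complex, Complex.re_ofReal_mul]
    ring
  rw [e]
  have h2 : HasDerivAt (fun t : ℝ => 2 * (inner ℂ z v : ℂ).re * t) (2 * (inner ℂ z v : ℂ).re) 0 := by
    simpa using (hasDerivAt_id (0 : ℝ)).const_mul (2 * (inner ℂ z v : ℂ).re)
  have h3 : HasDerivAt (fun t : ℝ => t ^ 2 * ‖v‖ ^ 2) 0 0 := by
    simpa using (hasDerivAt_pow 2 (0 : ℝ)).mul_const (‖v‖ ^ 2)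
  simpa using ((h2.const_add (‖z‖ ^ 2)).add h3).const_sub 1

theorem logKernel_eq {z : Cn n} (hz : ‖z‖ < 1) :
    logKernel n z = ((-(n + 1) * Real.log (1 - ‖z‖ ^ 2) : ℝ) : ℂ) := by
  have hp := one_sub_normSq_pos hz
  have e : (1 - inner ℂ z z : ℂ) = ((1 - ‖z‖ ^ 2 : ℝ) : ℂ) := by
    rw [inner_self_eq_norm_sq_to_K]; push_cast; rfl
  have e2 : (-(((n : ℝ) + 1 : ℝ) : ℂ)) = ((-(n + 1) : ℝ) : ℂ) := by push_cast; ring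
  rw [logKernel, bergmanKernel, e, e2, Complex.norm_cpow_real, Complex.norm_real,
    Real.norm_of_nonneg hp.le, Real.log_rpow hp]

theorem lineDeriv_logKernel {z : Cn n} (hz : ‖z‖ < 1) (v : Cn n) :
    lineDeriv ℝ (logKernel n) z v =
      ((2 * (n + 1) * (inner ℂ z v : ℂ).re / (1 - ‖z‖ ^ 2) : ℝ) : ℂ) := by
  have hp := one_sub_normSq_pos hz
  have hev : logKernel n =ᶠ[𝓝 z] fun z => ((-(n + 1) * Real.log (1 - ‖z‖ ^ 2) : ℝ) : ℂ) := by
    filter_upwards [isOpen_ball.mem_nhds (show z ∈ unitBall n by simpa using hz)] with w hw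
    exact logKernel_eq (by simpa using hw)
  rw [hev.lineDeriv_eq]
  refine HasLineDerivAt.lineDeriv ?_
  have h1 := (hasDerivAt_normSq_line z v).log (by simpa using hp.ne')
  have h2 := (h1.const_mul (-((n : ℝ) + 1))).ofReal_comp
  unfold HasLineDerivAt
  refine h2.congr_deriv ?_
  simp only [zero_smul, add_zero]
  congr 1
  field_simp

theorem wirtingerBar_logKernel {z : Cn n} (hz : ‖z‖ < 1) (j : Fin n) :
    wirtingerBar j (logKernel n) z = (n + 1) * z j / ((1 - ‖z‖ ^ 2 : ℝ) : ℂ) := by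
  have hp : ((1 - ‖z‖ ^ 2 : ℝ) : ℂ) ≠ 0 := by exact_mod_cast (one_sub_normSq_pos hz).ne'
  rw [wirtingerBar, lineDeriv_logKernel hz, lineDeriv_logKernel hz, EuclideanSpace.inner_single_right,
    EuclideanSpace.inner_single_right]
  have h1 : ((1 : ℂ) * (starRingEnd ℂ) (z j)).re = (z j).re := by simp
  have h2 : (Complex.I * (starRingEnd ℂ) (z j)).re = (z j).im := by simp
  rw [h1, h2]
  rw [Complex.ofReal_div, Complex.ofReal_div]
  field_simp
  push_cast
  have := Complex.re_add_im (z j)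
  linear_combination (2 * ((n : ℂ) + 1)) * this

theorem lineDeriv_wirtingerBar {z : Cn n} (hz : ‖z‖ < 1) (j : Fin n) (v : Cn n) :
    lineDeriv ℝ (wirtingerBar j (logKernel n)) z v =
      (n + 1) * (v j / ((1 - ‖z‖ ^ 2 : ℝ) : ℂ) +
        z j * (2 * (inner ℂ z v : ℂ).re : ℝ) / ((1 - ‖z‖ ^ 2 : ℝ) : ℂ) ^ 2) := by
  have hp0 := one_sub_normSq_pos hz
  have hp : ((1 - ‖z‖ ^ 2 : ℝ) : ℂ) ≠ 0 := by exact_mod_cast hp0.ne'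
  have hev : wirtingerBar j (logKernel n) =ᶠ[𝓝 z]
      fun z => (n + 1) * z j / ((1 - ‖z‖ ^ 2 : ℝ) : ℂ) := by
    filter_upwards [isOpen_ball.mem_nhds (show z ∈ unitBall n by simpa using hz)] with w hw
    exact wirtingerBar_logKernel (by simpa using hw) j
  rw [hev.lineDeriv_eq]
  refine HasLineDerivAt.lineDeriv ?_
  unfold HasLineDerivAt
  have h1 := (hasDerivAt_normSq_line z v).ofReal_comp
  have h2 : HasDerivAt (fun t : ℝ => ((n : ℂ) + 1) * (z + t • v) j) ((n + 1) * v j) 0 := by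
    have e : (fun t : ℝ => ((n : ℂ) + 1) * (z + t • v) j) = fun t : ℝ => ((n : ℂ) + 1) * (z j + t * v j) := by
      ext t
      simp
    rw [e]
    have h3 : HasDerivAt (fun t : ℝ => (t : ℂ) * v j) (v j) 0 := by
      simpa using (Complex.ofRealCLM.hasDerivAt (x := (0 : ℝ))).mul_const (v j)
    exact (h3.const_add (z j)).const_mul _
  have h4 := h2.div h1 (by simpa using hp)
  refine h4.congr_deriv ?_
  simp only [zero_smul, add_zero]
  push_cast at hp ⊢
  field_simp
  ring

theorem metricTensor_eq {z : Cn n} (hz : ‖z‖ < 1) (i j : Fin n) :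
    metricTensor n z i j = (n + 1) * ((if i = j then 1 else 0) / ((1 - ‖z‖ ^ 2 : ℝ) : ℂ) +
      (starRingEnd ℂ) (z i) * z j / ((1 - ‖z‖ ^ 2 : ℝ) : ℂ) ^ 2) := by
  have hp : ((1 - ‖z‖ ^ 2 : ℝ) : ℂ) ≠ 0 := by exact_mod_cast (one_sub_normSq_pos hz).ne'
  rw [metricTensor, Matrix.of_apply, wirtinger, lineDeriv_wirtingerBar hz, lineDeriv_wirtingerBar hz,
    EuclideanSpace.inner_single_right, EuclideanSpace.inner_single_right]
  have h1 : ((1 : ℂ) * (starRingEnd ℂ) (z i)).re = (z i).re := by simp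
  have h2 : (Complex.I * (starRingEnd ℂ) (z i)).re = (z i).im := by simp
  have h3 : (starRingEnd ℂ) (z i) = (z i).re - (z i).im * Complex.I := by
    apply Complex.ext <;> simp
  rw [h1, h2, h3]
  set q : ℂ := ((1 - ‖z‖ ^ 2 : ℝ) : ℂ)
  have hI := Complex.I_sq
  by_cases hij : i = j
  · subst hij
    simp only [PiLp.single_apply, if_true]
    field_simp
    push_cast
    linear_combination (-q) * hI
  · have hji : ¬ j = i := fun h => hij h.symm
    simp only [PiLp.single_apply, if_neg hij, if_neg hji]
    field_simp
    push_cast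
    ring

/-- The Bergman metric of the ball. -/
theorem bergmanNorm_sq {z : Cn n} (hz : ‖z‖ < 1) (v : Cn n) :
    (∑ i, ∑ j, metricTensor n z i j * v i * star (v j)).re =
      (n + 1) * (‖v‖ ^ 2 / (1 - ‖z‖ ^ 2) + ‖(inner ℂ z v : ℂ)‖ ^ 2 / (1 - ‖z‖ ^ 2) ^ 2) := by
  have hin : (inner ℂ z v : ℂ) = ∑ i, (starRingEnd ℂ) (z i) * v i := by
    rw [PiLp.inner_apply]
    exact Finset.sum_congr rfl fun i _ => by rw [RCLike.inner_apply, mul_comm]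
  have hv : ((‖v‖ ^ 2 : ℝ) : ℂ) = ∑ i, v i * (starRingEnd ℂ) (v i) := by
    rw [EuclideanSpace.norm_sq_eq]
    push_cast
    exact Finset.sum_congr rfl fun i _ => by rw [Complex.mul_conj']
  have key : (∑ i, ∑ j, metricTensor n z i j * v i * star (v j)) =
      (((n + 1) * (‖v‖ ^ 2 / (1 - ‖z‖ ^ 2) +
        ‖(inner ℂ z v : ℂ)‖ ^ 2 / (1 - ‖z‖ ^ 2) ^ 2) : ℝ) : ℂ) := by
    have h1 : ((‖(inner ℂ z v : ℂ)‖ ^ 2 : ℝ) : ℂ) =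
        ∑ i, ∑ j, ((starRingEnd ℂ) (z i) * v i) * (z j * (starRingEnd ℂ) (v j)) := by
      rw [← Finset.sum_mul_sum, Complex.ofReal_pow, ← Complex.mul_conj', hin, map_sum]
      congr 1
      exact Finset.sum_congr rfl fun i _ => by simp
    have h2 : ((‖v‖ ^ 2 : ℝ) : ℂ) =
        ∑ i, ∑ j, (if i = j then (1 : ℂ) else 0) * (v i * (starRingEnd ℂ) (v j)) := by
      rw [hv]
      refine Finset.sum_congr rfl fun i _ => ?_
      simp
    have h3 : (((n + 1) * (‖v‖ ^ 2 / (1 - ‖z‖ ^ 2) +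
        ‖(inner ℂ z v : ℂ)‖ ^ 2 / (1 - ‖z‖ ^ 2) ^ 2) : ℝ) : ℂ) =
        ((n : ℂ) + 1) * (((‖v‖ ^ 2 : ℝ) : ℂ) / ((1 - ‖z‖ ^ 2 : ℝ) : ℂ) +
          ((‖(inner ℂ z v : ℂ)‖ ^ 2 : ℝ) : ℂ) / ((1 - ‖z‖ ^ 2 : ℝ) : ℂ) ^ 2) := by
      push_cast; ring
    rw [h3, h1, h2, Finset.sum_div, Finset.sum_div, ← Finset.sum_add_distrib, Finset.mul_sum]
    refine Finset.sum_congr rfl fun i _ => ?_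
    rw [Finset.sum_div, Finset.sum_div, ← Finset.sum_add_distrib, Finset.mul_sum]
    refine Finset.sum_congr rfl fun j _ => ?_
    rw [metricTensor_eq hz]
    simp only [RCLike.star_def]
    ring
  rw [key, Complex.ofReal_re]

theorem bergmanNorm_eq {z : Cn n} (hz : ‖z‖ < 1) (v : Cn n) :
    bergmanNorm n z v = Real.sqrt ((n + 1) * (‖v‖ ^ 2 / (1 - ‖z‖ ^ 2) +
      ‖(inner ℂ z v : ℂ)‖ ^ 2 / (1 - ‖z‖ ^ 2) ^ 2)) := by
  rw [bergmanNorm, bergmanNorm_sq hz]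

theorem bergmanNorm_nonneg (z v : Cn n) : 0 ≤ bergmanNorm n z v := Real.sqrt_nonneg _

/-- The metric is anisotropic: a general displacement is controlled with the factor √(1-|z|²),
whereas the complex radial component gains the full factor 1-|z|² in `norm_inner_le_bergmanNorm`.
These are the two terms weighed against each other in `normSq_mob_mul`. -/
theorem norm_sq_le_bergmanNorm {z : Cn n} (hz : ‖z‖ < 1) (v : Cn n) :
    ‖v‖ ^ 2 ≤ bergmanNorm n z v ^ 2 * (1 - ‖z‖ ^ 2) := by
  have hp := one_sub_normSq_pos hz
  rw [bergmanNorm_eq hz, Real.sq_sqrt (by positivity)]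
  have h1 : ‖v‖ ^ 2 = ‖v‖ ^ 2 / (1 - ‖z‖ ^ 2) * (1 - ‖z‖ ^ 2) := by field_simp
  have h2 : 0 ≤ ‖(inner ℂ z v : ℂ)‖ ^ 2 / (1 - ‖z‖ ^ 2) ^ 2 := by positivity
  have h3 : 0 ≤ ‖v‖ ^ 2 / (1 - ‖z‖ ^ 2) := by positivity
  rw [h1]
  refine mul_le_mul_of_nonneg_right ?_ hp.le
  rw [← h1]
  nlinarith [mul_nonneg (Nat.cast_nonneg n : (0 : ℝ) ≤ n) h2, mul_nonneg (Nat.cast_nonneg n : (0 : ℝ) ≤ n) h3]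

theorem norm_inner_le_bergmanNorm {z : Cn n} (hz : ‖z‖ < 1) (v : Cn n) :
    ‖(inner ℂ z v : ℂ)‖ ≤ bergmanNorm n z v * (1 - ‖z‖ ^ 2) := by
  have hp := one_sub_normSq_pos hz
  rw [← div_le_iff₀ hp, bergmanNorm_eq hz]
  refine Real.le_sqrt_of_sq_le ?_
  rw [div_pow]
  have h2 : 0 ≤ ‖(inner ℂ z v : ℂ)‖ ^ 2 / (1 - ‖z‖ ^ 2) ^ 2 := by positivity
  have h3 : 0 ≤ ‖v‖ ^ 2 / (1 - ‖z‖ ^ 2) := by positivity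
  nlinarith [mul_nonneg (Nat.cast_nonneg n : (0 : ℝ) ≤ n) h2, mul_nonneg (Nat.cast_nonneg n : (0 : ℝ) ≤ n) h3]

theorem continuousOn_bergmanNorm {γ γ' : ℝ → Cn n} {s : Set ℝ} (hγ : ContinuousOn γ s)
    (hγ' : ContinuousOn γ' s) (hb : ∀ t ∈ s, ‖γ t‖ < 1) :
    ContinuousOn (fun t => bergmanNorm n (γ t) (γ' t)) s := by
  have h : ContinuousOn (fun t => Real.sqrt ((n + 1) * (‖γ' t‖ ^ 2 / (1 - ‖γ t‖ ^ 2) +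
      ‖(inner ℂ (γ t) (γ' t) : ℂ)‖ ^ 2 / (1 - ‖γ t‖ ^ 2) ^ 2))) s := by
    have hd : ContinuousOn (fun t => 1 - ‖γ t‖ ^ 2) s := continuousOn_const.sub (hγ.norm.pow 2)
    refine ContinuousOn.sqrt (continuousOn_const.mul (ContinuousOn.add ?_ ?_))
    · exact (hγ'.norm.pow 2).div hd fun t ht => (one_sub_normSq_pos (hb t ht)).ne'
    · exact ((ContinuousOn.inner (𝕜 := ℂ) hγ hγ').norm.pow 2).div (hd.pow 2) fun t ht =>
        pow_ne_zero 2 (one_sub_normSq_pos (hb t ht)).ne'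
  exact h.congr fun t ht => bergmanNorm_eq (hb t ht) _

/-! ### Local comparison of the Bergman and pseudohyperbolic distances -/

theorem norm_sub_le_mul_integral {E : Type*} [NormedAddCommGroup E] [NormedSpace ℝ E]
    [CompleteSpace E] {h h' : ℝ → E} {b : ℝ → ℝ} {c : ℝ}
    (hd : ∀ t ∈ Set.Icc (0 : ℝ) 1, HasDerivWithinAt h (h' t) (Set.Icc 0 1) t)
    (hh' : ContinuousOn h' (Set.Icc 0 1)) (hb : ContinuousOn b (Set.Icc 0 1)) (hc : 0 ≤ c)
    (hb0 : ∀ t, 0 ≤ b t)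
    (hle : ∀ t ∈ Set.Icc (0 : ℝ) 1, ‖h' t‖ ≤ c * b t) {t : ℝ} (ht : t ∈ Set.Icc (0 : ℝ) 1) :
    ‖h t - h 0‖ ≤ c * ∫ s in (0 : ℝ)..1, b s := by
  have hsub : Set.Icc 0 t ⊆ Set.Icc (0 : ℝ) 1 := Set.Icc_subset_Icc_right ht.2
  have hu : Set.uIcc 0 t = Set.Icc 0 t := Set.uIcc_of_le ht.1
  have hu1 : Set.uIcc (0 : ℝ) 1 = Set.Icc 0 1 := Set.uIcc_of_le zero_le_one
  have hbi : IntervalIntegrable b volume 0 1 := (hu1 ▸ hb).intervalIntegrable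
  have hbi' : IntervalIntegrable b volume 0 t := (hu ▸ hb.mono hsub).intervalIntegrable
  have hi : IntervalIntegrable h' volume 0 t := (hu ▸ hh'.mono hsub).intervalIntegrable
  have h1 := intervalIntegral.integral_eq_sub_of_hasDeriv_right (f := h) (f' := h') (a := 0) (b := t)
    (by rw [hu]; exact fun s hs => ((hd s (hsub hs)).continuousWithinAt).mono hsub)
    (by
      rw [min_eq_left ht.1, max_eq_right ht.1]
      intro s hs
      have hs' : s ∈ Set.Ioo (0 : ℝ) 1 := ⟨hs.1, hs.2.trans_le ht.2⟩
      exact ((hd s (Set.Ioo_subset_Icc_self hs')).hasDerivAt (Icc_mem_nhds hs'.1 hs'.2)).hasDerivWithinAt)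
    hi
  rw [← h1]
  calc ‖∫ s in (0 : ℝ)..t, h' s‖ ≤ ∫ s in (0 : ℝ)..t, c * b s :=
        intervalIntegral.norm_integral_le_of_norm_le ht.1
          (Eventually.of_forall fun s hs => hle s (hsub (Set.Ioc_subset_Icc_self hs))) (hbi'.const_mul c)
    _ = c * ∫ s in (0 : ℝ)..t, b s := intervalIntegral.integral_const_mul _ _
    _ ≤ c * ∫ s in (0 : ℝ)..1, b s := by
        gcongr
        exact intervalIntegral.integral_mono_interval le_rfl ht.1 ht.2
          (Eventually.of_forall hb0) hbi

theorem le_norm_one_sub_inner {x y : Cn n} (hx : ‖x‖ < 1) :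
    1 - ‖x‖ ^ 2 - ‖(inner ℂ x (y - x) : ℂ)‖ ≤ ‖(1 - inner ℂ x y : ℂ)‖ ∧
      ‖(1 - inner ℂ x y : ℂ)‖ ≤ 1 - ‖x‖ ^ 2 + ‖(inner ℂ x (y - x) : ℂ)‖ := by
  have hp := one_sub_normSq_pos hx
  have e : (1 - inner ℂ x y : ℂ) = ((1 - ‖x‖ ^ 2 : ℝ) : ℂ) - inner ℂ x (y - x) := by
    rw [inner_sub_right, inner_self_eq_norm_sq_to_K]; push_cast
    change _ = 1 - (‖x‖ : ℂ) ^ 2 - (inner ℂ x y - (‖x‖ : ℂ) ^ 2)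
    ring
  have h : ‖((1 - ‖x‖ ^ 2 : ℝ) : ℂ)‖ = 1 - ‖x‖ ^ 2 := by
    rw [Complex.norm_real, Real.norm_of_nonneg hp.le]
  rw [e]
  constructor
  · have := norm_sub_norm_le ((1 - ‖x‖ ^ 2 : ℝ) : ℂ) (inner ℂ x (y - x))
    rwa [h] at this
  · have := norm_sub_le ((1 - ‖x‖ ^ 2 : ℝ) : ℂ) (inner ℂ x (y - x))
    rwa [h] at this

/-- Along a short curve 1-|γ|² at most doubles. The two metric bounds then integrate to a total
displacement of at most √(2q) l and a radial one of at most 2q(1+l) l, with q = 1-|x|² and l the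
length; `normSq_mob_mul` converts these into the claim. -/
theorem norm_mob_le_of_length {γ : ℝ → Cn n} (hγ : ContDiffOn ℝ 1 γ (Set.Icc 0 1))
    (hb : ∀ t ∈ Set.Icc (0 : ℝ) 1, γ t ∈ unitBall n) (hL : bergmanLength n γ ≤ 1 / 6) :
    ‖mob (γ 0) (γ 1)‖ ≤ 7 * bergmanLength n γ := by
  have h0 : (0 : ℝ) ∈ Set.Icc (0 : ℝ) 1 := by simp
  have h1 : (1 : ℝ) ∈ Set.Icc (0 : ℝ) 1 := by simp
  have hb' : ∀ t ∈ Set.Icc (0 : ℝ) 1, ‖γ t‖ < 1 := fun t ht => by simpa using hb t ht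
  set x := γ 0 with hx
  set γ' : ℝ → Cn n := derivWithin γ (Set.Icc 0 1) with hγ'
  set b : ℝ → ℝ := fun t => bergmanNorm n (γ t) (γ' t) with hbdef
  set l := bergmanLength n γ with hl
  have hlb : l = ∫ s in (0 : ℝ)..1, b s := rfl
  have hb0 : ∀ t, 0 ≤ b t := fun t => bergmanNorm_nonneg _ _
  have hl0 : 0 ≤ l := by
    rw [hlb]
    exact intervalIntegral.integral_nonneg zero_le_one fun t _ => hb0 t
  have hd : ∀ t ∈ Set.Icc (0 : ℝ) 1, HasDerivWithinAt γ (γ' t) (Set.Icc 0 1) t := fun t ht =>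
    ((hγ.differentiableOn one_ne_zero) t ht).hasDerivWithinAt
  have hc' : ContinuousOn γ' (Set.Icc 0 1) :=
    hγ.continuousOn_derivWithin (uniqueDiffOn_Icc zero_lt_one) le_rfl
  have hc : ContinuousOn γ (Set.Icc 0 1) := hγ.continuousOn
  have hbc : ContinuousOn b (Set.Icc 0 1) := continuousOn_bergmanNorm hc hc' hb'
  set q := 1 - ‖x‖ ^ 2 with hq
  have hq0 : 0 < q := one_sub_normSq_pos (hb' 0 h0)
  -- The logarithm of 1-|γ|² has derivative at most twice the speed in absolute value, so it changes
  -- by at most 2l ≤ 1/3 < log 2.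
  have hlog : ∀ t ∈ Set.Icc (0 : ℝ) 1, 1 - ‖γ t‖ ^ 2 ≤ 2 * q := by
    intro t ht
    have hder : ∀ t ∈ Set.Icc (0 : ℝ) 1, HasDerivWithinAt (fun t => Real.log (1 - ‖γ t‖ ^ 2))
        (-(2 * (inner ℂ (γ t) (γ' t) : ℂ).re) / (1 - ‖γ t‖ ^ 2)) (Set.Icc 0 1) t := by
      intro t ht
      have e : (fun t => 1 - ‖γ t‖ ^ 2) = fun t => 1 - (inner ℂ (γ t) (γ t) : ℂ).re := by
        ext t
        rw [inner_self_eq_norm_sq_to_K, ← RCLike.ofReal_pow]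
        rfl
      have h2 : HasDerivWithinAt (fun t => 1 - ‖γ t‖ ^ 2) (-(2 * (inner ℂ (γ t) (γ' t) : ℂ).re))
          (Set.Icc 0 1) t := by
        rw [e]
        have h3 := Complex.reCLM.hasFDerivAt.comp_hasDerivWithinAt t
          (HasDerivWithinAt.inner ℂ (hd t ht) (hd t ht))
        have h4 := h3.const_sub 1
        refine h4.congr_deriv ?_
        rw [← inner_conj_symm (γ' t) (γ t)]
        simp only [Complex.reCLM_apply, Complex.add_re, Complex.conj_re]
        ring
      exact h2.log (one_sub_normSq_pos (hb' t ht)).ne'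
    have hbound : ∀ t ∈ Set.Icc (0 : ℝ) 1,
        ‖-(2 * (inner ℂ (γ t) (γ' t) : ℂ).re) / (1 - ‖γ t‖ ^ 2)‖ ≤ 2 * b t := by
      intro t ht
      have hp := one_sub_normSq_pos (hb' t ht)
      have h5 := norm_inner_le_bergmanNorm (hb' t ht) (γ' t)
      rw [norm_div, norm_neg, Real.norm_of_nonneg hp.le, div_le_iff₀ hp, norm_mul, Real.norm_two,
        mul_assoc, Real.norm_eq_abs]
      exact mul_le_mul_of_nonneg_left ((Complex.abs_re_le_norm _).trans h5) zero_le_two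
    have hcont : ContinuousOn (fun t => -(2 * (inner ℂ (γ t) (γ' t) : ℂ).re) / (1 - ‖γ t‖ ^ 2))
        (Set.Icc 0 1) := by
      refine ContinuousOn.div ?_ (continuousOn_const.sub (hc.norm.pow 2))
        fun t ht => (one_sub_normSq_pos (hb' t ht)).ne'
      exact (continuousOn_const.mul (Complex.continuous_re.comp_continuousOn
        (ContinuousOn.inner (𝕜 := ℂ) hc hc'))).neg
    have h6 := norm_sub_le_mul_integral hder hcont hbc zero_le_two hb0 hbound ht
    rw [← hlb, Real.norm_eq_abs] at h6
    have h7 := (abs_le.1 h6).2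
    have h8 : Real.log (1 - ‖γ t‖ ^ 2) ≤ Real.log (2 * q) := by
      rw [Real.log_mul two_ne_zero hq0.ne']
      have : Real.log (1 - ‖γ 0‖ ^ 2) = Real.log q := rfl
      linarith [Real.log_two_gt_d9]
    exact (Real.log_le_log_iff (one_sub_normSq_pos (hb' t ht)) (by positivity)).1 h8
  set c := Real.sqrt (2 * q) with hcdef
  have hc0 : 0 ≤ c := Real.sqrt_nonneg _
  have hcsq : c ^ 2 = 2 * q := Real.sq_sqrt (by positivity)
  have hγ'le : ∀ t ∈ Set.Icc (0 : ℝ) 1, ‖γ' t‖ ≤ c * b t := by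
    intro t ht
    have h2 := norm_sq_le_bergmanNorm (hb' t ht) (γ' t)
    have h3 : ‖γ' t‖ ^ 2 ≤ (c * b t) ^ 2 := by
      rw [mul_pow, hcsq, mul_comm]
      exact h2.trans (mul_le_mul_of_nonneg_left (hlog t ht) (sq_nonneg _))
    exact (pow_le_pow_iff_left₀ (norm_nonneg _) (mul_nonneg hc0 (hb0 t)) two_ne_zero).1 h3
  have hdisp : ∀ t ∈ Set.Icc (0 : ℝ) 1, ‖γ t - x‖ ≤ c * l := fun t ht =>
    norm_sub_le_mul_integral hd hc' hbc hc0 hb0 hγ'le ht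
  -- The metric controls the component along γ(t), not along x. The error from replacing one by the
  -- other is a product of two quantities of size √q, hence again of order q.
  have hinle : ∀ t ∈ Set.Icc (0 : ℝ) 1, ‖(inner ℂ x (γ' t) : ℂ)‖ ≤ (2 * q * (1 + l)) * b t := by
    intro t ht
    have e : (inner ℂ x (γ' t) : ℂ) = inner ℂ (γ t) (γ' t) - inner ℂ (γ t - x) (γ' t) := by
      rw [inner_sub_left]; ring
    have h2 := norm_inner_le_bergmanNorm (hb' t ht) (γ' t)
    have h3 : ‖(inner ℂ (γ t - x) (γ' t) : ℂ)‖ ≤ (c * l) * (c * b t) :=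
      (norm_inner_le_norm _ _).trans (mul_le_mul (hdisp t ht) (hγ'le t ht) (norm_nonneg _)
        (mul_nonneg hc0 hl0))
    have h4 : (c * l) * (c * b t) = 2 * q * l * b t := by rw [← hcsq]; ring
    have h5 : bergmanNorm n (γ t) (γ' t) * (1 - ‖γ t‖ ^ 2) ≤ b t * (2 * q) :=
      mul_le_mul_of_nonneg_left (hlog t ht) (hb0 t)
    rw [e]
    refine (norm_sub_le _ _).trans ?_
    linarith
  have hin : ‖(inner ℂ x (γ 1 - x) : ℂ)‖ ≤ (2 * q * (1 + l)) * l := by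
    have h2 := norm_sub_le_mul_integral (h := fun t => (inner ℂ x (γ t) : ℂ))
      (h' := fun t => inner ℂ x (γ' t))
      (fun t ht => ((innerSL ℂ x).restrictScalars ℝ).hasFDerivAt.comp_hasDerivWithinAt t (hd t ht))
      (((innerSL ℂ x).continuous).comp_continuousOn hc') hbc (by positivity) hb0 hinle h1
    rw [inner_sub_right]
    exact h2
  have hl1 : (2 * q * (1 + l)) * l ≤ 7 / 18 * q := by
    have : (1 + l) * l ≤ 7 / 6 * (1 / 6) := by nlinarith
    nlinarith
  have hden := (le_norm_one_sub_inner (y := γ 1) (hb' 0 h0)).1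
  have hid := normSq_mob_mul (hb' 0 h0) (hb' 1 h1)
  have hden' : q / 2 ≤ ‖(1 - inner ℂ x (γ 1) : ℂ)‖ := by linarith
  have hd1 := hdisp 1 h1
  have h9 : ‖mob x (γ 1)‖ ^ 2 * (q / 2) ^ 2 ≤ (7 * l) ^ 2 * (q / 2) ^ 2 := by
    calc ‖mob x (γ 1)‖ ^ 2 * (q / 2) ^ 2 ≤ ‖mob x (γ 1)‖ ^ 2 * ‖(1 - inner ℂ x (γ 1) : ℂ)‖ ^ 2 := by
          gcongr
      _ = q * ‖γ 1 - x‖ ^ 2 + ‖(inner ℂ x (γ 1 - x) : ℂ)‖ ^ 2 := hid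
      _ ≤ q * (c * l) ^ 2 + ((2 * q * (7 / 6)) * l) ^ 2 := by
          have : (2 * q * (1 + l)) * l ≤ (2 * q * (7 / 6)) * l := by
            have : 1 + l ≤ 7 / 6 := by linarith
            gcongr
          gcongr
          exact hin.trans this
      _ = (2 + 49 / 9) * (q ^ 2 * l ^ 2) := by rw [mul_pow, hcsq]; ring
      _ ≤ _ := by nlinarith [mul_nonneg (sq_nonneg q) (sq_nonneg l)]
  have h10 := le_of_mul_le_mul_right h9 (by positivity)
  exact (pow_le_pow_iff_left₀ (norm_nonneg _) (by positivity) two_ne_zero).1 h10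

theorem hasDerivWithinAt_segment (x y : Cn n) (s : Set ℝ) (t : ℝ) :
    HasDerivWithinAt (fun t : ℝ => x + t • (y - x)) (y - x) s t := by
  simpa using (((hasDerivAt_id t).smul_const (y - x)).const_add x).hasDerivWithinAt

theorem segment_mem_unitBall {x y : Cn n} (hx : ‖x‖ < 1) (hy : ‖y‖ < 1) {t : ℝ}
    (ht : t ∈ Set.Icc (0 : ℝ) 1) : x + t • (y - x) ∈ unitBall n :=
  (convex_ball (0 : Cn n) 1).add_smul_sub_mem (by simpa using hx) (by simpa using hy) ht

theorem segment_mem_lengths {x y : Cn n} (hx : ‖x‖ < 1) (hy : ‖y‖ < 1) :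
    bergmanLength n (fun t : ℝ => x + t • (y - x)) ∈
      {L | ∃ γ : ℝ → Cn n, ContDiffOn ℝ 1 γ (Set.Icc 0 1) ∧
        (∀ t ∈ Set.Icc (0 : ℝ) 1, γ t ∈ unitBall n) ∧ γ 0 = x ∧ γ 1 = y ∧ L = bergmanLength n γ} :=
  ⟨_, (contDiff_const.add (contDiff_id.smul contDiff_const)).contDiffOn,
    fun _ ht => segment_mem_unitBall hx hy ht, by simp, by simp, rfl⟩

theorem bergmanLength_segment_le {x y : Cn n} {c : ℝ}
    (hbn : ∀ t ∈ Set.Icc (0 : ℝ) 1, bergmanNorm n (x + t • (y - x)) (y - x) ≤ c) :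
    bergmanLength n (fun t : ℝ => x + t • (y - x)) ≤ c := by
  have hder : ∀ t ∈ Set.Icc (0 : ℝ) 1,
      derivWithin (fun t : ℝ => x + t • (y - x)) (Set.Icc 0 1) t = y - x := fun t ht =>
    (hasDerivWithinAt_segment x y _ t).derivWithin (uniqueDiffOn_Icc zero_lt_one t ht)
  have h1 : ∀ t ∈ Set.uIoc (0 : ℝ) 1, ‖bergmanNorm n (x + t • (y - x))
      (derivWithin (fun t : ℝ => x + t • (y - x)) (Set.Icc 0 1) t)‖ ≤ c := by
    intro t ht
    rw [Set.uIoc_of_le zero_le_one] at ht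
    have ht' := Set.Ioc_subset_Icc_self ht
    rw [hder t ht', Real.norm_of_nonneg (bergmanNorm_nonneg _ _)]
    exact hbn t ht'
  have h2 := intervalIntegral.norm_integral_le_of_norm_le_const h1
  rw [sub_zero, abs_one, mul_one] at h2
  exact (le_abs_self _).trans h2

theorem norm_mob_lt_of_bergmanDist_lt {x y : Cn n} (hx : ‖x‖ < 1) (hy : ‖y‖ < 1) {ρ : ℝ}
    (hρ : ρ ≤ 1 / 6) (h : bergmanDist n x y < ρ) : ‖mob x y‖ < 7 * ρ := by
  obtain ⟨L, ⟨γ, hγ, hb, rfl, rfl, rfl⟩, hL⟩ :=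
    exists_lt_of_csInf_lt ⟨_, segment_mem_lengths hx hy⟩ h
  exact (norm_mob_le_of_length hγ hb (by linarith)).trans_lt (by linarith)

/-- The converse reading of `normSq_mob_mul`. The radial term occurs on both sides, since |1-⟨y,x⟩|
is at most 1-|x|² plus that term, and d ≤ 1/8 allows it to be absorbed. -/
theorem displacement_le {x y : Cn n} (hx : ‖x‖ < 1) (hy : ‖y‖ < 1) (hd : ‖mob x y‖ ≤ 1 / 8) :
    ‖(inner ℂ x (y - x) : ℂ)‖ ≤ 2 * ‖mob x y‖ * (1 - ‖x‖ ^ 2) ∧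
      ‖y - x‖ ^ 2 ≤ 4 * ‖mob x y‖ ^ 2 * (1 - ‖x‖ ^ 2) := by
  have hid := normSq_mob_mul hx hy
  have hq0 : 0 < 1 - ‖x‖ ^ 2 := one_sub_normSq_pos hx
  have hden := (le_norm_one_sub_inner (y := y) hx).2
  have hd0 : 0 ≤ ‖mob x y‖ := norm_nonneg _
  have hD0 : 0 ≤ ‖(1 - inner ℂ x y : ℂ)‖ := norm_nonneg _
  have hI0 : 0 ≤ ‖(inner ℂ x (y - x) : ℂ)‖ := norm_nonneg _
  generalize ‖mob x y‖ = d at *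
  generalize 1 - ‖x‖ ^ 2 = q at *
  generalize ‖(1 - inner ℂ x y : ℂ)‖ = D at *
  generalize ‖(inner ℂ x (y - x) : ℂ)‖ = I at *
  have hin1 : I ≤ d * D := by
    refine (pow_le_pow_iff_left₀ hI0 (by positivity) two_ne_zero).1 ?_
    rw [mul_pow, hid]
    linarith [mul_nonneg hq0.le (sq_nonneg ‖y - x‖)]
  have hDq : D ≤ 2 * q := by nlinarith
  refine ⟨by nlinarith, ?_⟩
  have h1 : q * ‖y - x‖ ^ 2 ≤ d ^ 2 * D ^ 2 := by
    rw [hid]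
    linarith [sq_nonneg I]
  have h2 : d ^ 2 * D ^ 2 ≤ d ^ 2 * (2 * q) ^ 2 := by gcongr
  have h3 : q * ‖y - x‖ ^ 2 ≤ q * (4 * d ^ 2 * q) := by linarith
  exact le_of_mul_le_mul_left h3 hq0

/-- The Euclidean segment serves as test curve for the distance. Along it 1-|·|² stays above
(1-|x|²)/4, so `displacement_le` bounds the speed; 16 + 12² = 160 ≤ 13² gives the constant. -/
theorem bergmanNorm_segment_le {x y : Cn n} (hx : ‖x‖ < 1) (hy : ‖y‖ < 1)
    (hd : ‖mob x y‖ ≤ 1 / 8) {t : ℝ} (ht : t ∈ Set.Icc (0 : ℝ) 1) :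
    bergmanNorm n (x + t • (y - x)) (y - x) ≤ 13 * (n + 1) * ‖mob x y‖ := by
  obtain ⟨hin, hyx⟩ := displacement_le hx hy hd
  have hq0 : 0 < 1 - ‖x‖ ^ 2 := one_sub_normSq_pos hx
  have hd0 : 0 ≤ ‖mob x y‖ := norm_nonneg _
  have hz1 : ‖x + t • (y - x)‖ < 1 := by simpa using segment_mem_unitBall hx hy ht
  have htx : (t • (y - x) : Cn n) = (t : ℂ) • (y - x) := (Complex.coe_smul t _).symm
  have hzexp : 1 - ‖x + t • (y - x)‖ ^ 2 =
      1 - ‖x‖ ^ 2 - 2 * (t * (inner ℂ x (y - x) : ℂ).re) - t ^ 2 * ‖y - x‖ ^ 2 := by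
    rw [norm_add_sq (𝕜 := ℂ), htx, inner_smul_right, norm_smul, Complex.norm_real,
      Real.norm_of_nonneg ht.1, mul_pow]
    simp only [RCLike.re_to_complex, Complex.re_ofReal_mul]
    ring
  have hre := (Complex.re_le_norm (inner ℂ x (y - x))).trans hin
  have hzin : ‖(inner ℂ (x + t • (y - x)) (y - x) : ℂ)‖ ≤
      ‖(inner ℂ x (y - x) : ℂ)‖ + ‖y - x‖ ^ 2 := by
    rw [inner_add_left, htx]
    refine (norm_add_le _ _).trans (add_le_add le_rfl ((norm_inner_le_norm _ _).trans ?_))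
    rw [norm_smul, Complex.norm_real, Real.norm_of_nonneg ht.1, sq, mul_assoc]
    exact mul_le_of_le_one_left (by positivity) ht.2
  have hzp := one_sub_normSq_pos hz1
  have hJ0 : 0 ≤ ‖(inner ℂ (x + t • (y - x)) (y - x) : ℂ)‖ := norm_nonneg _
  rw [bergmanNorm_eq hz1]
  have hn0 : (0 : ℝ) ≤ n := Nat.cast_nonneg n
  refine Real.sqrt_le_iff.2 ⟨by positivity, ?_⟩
  obtain ⟨ht0, ht1⟩ := ht
  generalize ‖mob x y‖ = d at *
  generalize 1 - ‖x‖ ^ 2 = q at *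
  generalize (inner ℂ x (y - x) : ℂ).re = R at *
  generalize ‖(inner ℂ x (y - x) : ℂ)‖ = I at *
  generalize ‖(inner ℂ (x + t • (y - x)) (y - x) : ℂ)‖ = J at *
  generalize 1 - ‖x + t • (y - x)‖ ^ 2 = p at *
  have hdq : d * q ≤ 1 / 8 * q := by gcongr
  have hdq2 : d ^ 2 * q ≤ 1 / 8 * (d * q) := by
    rw [sq, mul_assoc]
    exact mul_le_mul_of_nonneg_right hd (by positivity)
  have hzn : q / 4 ≤ p := by
    have h2 : t * R ≤ 2 * d * q := (mul_le_mul_of_nonneg_left hre ht0).trans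
      (mul_le_of_le_one_left (by positivity) ht1)
    have h3 : t ^ 2 * ‖y - x‖ ^ 2 ≤ 4 * d ^ 2 * q :=
      (mul_le_of_le_one_left (by positivity) (pow_le_one₀ ht0 ht1)).trans hyx
    rw [hzexp]
    linarith
  have hJ : J ≤ 3 * d * q := by linarith
  have h1 : ‖y - x‖ ^ 2 / p ≤ 16 * d ^ 2 := by
    rw [div_le_iff₀ hzp]
    calc ‖y - x‖ ^ 2 ≤ 16 * d ^ 2 * (q / 4) := by linarith
      _ ≤ _ := by gcongr
  have h2 : J / p ≤ 12 * d := by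
    rw [div_le_iff₀ hzp]
    calc J ≤ 12 * d * (q / 4) := by linarith
      _ ≤ _ := by gcongr
  have h3 : J ^ 2 / p ^ 2 ≤ (12 * d) ^ 2 := by
    rw [← div_pow]
    gcongr
  calc ((n : ℝ) + 1) * (‖y - x‖ ^ 2 / p + J ^ 2 / p ^ 2)
      ≤ ((n : ℝ) + 1) * (16 * d ^ 2 + (12 * d) ^ 2) := by gcongr
    _ = 160 * (n + 1) * d ^ 2 := by ring
    _ ≤ 169 * ((n + 1) * (n + 1)) * d ^ 2 := by
        have hk : 160 * ((n : ℝ) + 1) ≤ 169 * ((n + 1) * (n + 1)) := by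
          nlinarith [mul_nonneg hn0 hn0]
        exact mul_le_mul_of_nonneg_right hk (sq_nonneg d)
    _ = _ := by ring

theorem bergmanDist_le_mul_norm_mob {x y : Cn n} (hx : ‖x‖ < 1) (hy : ‖y‖ < 1)
    (hd : ‖mob x y‖ ≤ 1 / 8) : bergmanDist n x y ≤ 13 * (n + 1) * ‖mob x y‖ := by
  refine (csInf_le ⟨0, ?_⟩ (segment_mem_lengths hx hy)).trans
    (bergmanLength_segment_le fun t ht => bergmanNorm_segment_le hx hy hd ht)
  rintro L ⟨γ, -, -, -, -, rfl⟩
  exact intervalIntegral.integral_nonneg zero_le_one fun t _ => bergmanNorm_nonneg _ _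

theorem IsUC.exists_norm_mob_le {g : Cn n → ℂ} (hg : IsUC n g) {ε : ℝ} (hε : 0 < ε) :
    ∃ r, 0 < r ∧ r < 1 ∧
      ∀ z w, ‖z‖ < 1 → ‖w‖ < 1 → ‖mob z w‖ ≤ r → ‖g z - g w‖ ≤ ε := by
  obtain ⟨δ, hδ, h⟩ := hg ε hε
  have hM : (0 : ℝ) < 26 * (n + 1) := by positivity
  -- 26 is twice the comparison constant 13, so the Bergman distance is at most δ/2 and the strict
  -- inequality holds.
  refine ⟨min (1 / 8) (δ / (26 * (n + 1))), by positivity,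
    (min_le_left _ _).trans_lt (by norm_num), fun z w hz hw hzw => ?_⟩
  have h1 := bergmanDist_le_mul_norm_mob hz hw (hzw.trans (min_le_left _ _))
  have h2 := hzw.trans (min_le_right _ _)
  rw [le_div_iff₀ hM] at h2
  exact (h z (by simpa using hz) w (by simpa using hw) (by linarith)).le

theorem mob_self {x : Cn n} (hx : ‖x‖ < 1) : mob x x = 0 := by
  have := mob_mob hx (w := 0) (by simp)
  rwa [mob_zero] at this

theorem IsUC.continuousOn {g : Cn n → ℂ} (hg : IsUC n g) : ContinuousOn g (unitBall n) := by
  intro z hz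
  have hz' : ‖z‖ < 1 := by simpa using hz
  rw [ContinuousWithinAt, Metric.tendsto_nhds]
  intro ε hε
  obtain ⟨r, hr0, -, hr⟩ := hg.exists_norm_mob_le (half_pos hε)
  have hc : Tendsto (fun w => ‖mob z w‖) (𝓝 z) (𝓝 0) := by
    have := (hasFDerivAt_mob hz' hz').continuousAt.norm
    rwa [ContinuousAt, mob_self hz', norm_zero] at this
  filter_upwards [self_mem_nhdsWithin, nhdsWithin_le_nhds (hc.eventually (gt_mem_nhds hr0))]
    with w hw hw1
  rw [dist_eq_norm, norm_sub_rev]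
  have := hr z w hz' (by simpa using hw) (le_of_lt hw1)
  linarith

/-! ### VMO in terms of pseudohyperbolic balls and the invariant measure -/

instance (n : ℕ) : IsFiniteMeasure (ballMeasure n) := by
  have hVpos : volume (unitBall n) ≠ 0 := (measure_ball_pos _ _ one_pos).ne'
  refine ⟨?_⟩
  rw [ballMeasure, Measure.smul_apply, Measure.restrict_apply_univ, smul_eq_mul]
  exact ENNReal.mul_lt_top (ENNReal.inv_lt_top.2 (pos_iff_ne_zero.2 hVpos)) measure_ball_lt_top

theorem ae_ballMeasure_norm_lt (n : ℕ) : ∀ᵐ z ∂(ballMeasure n), ‖z‖ < 1 := by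
  refine Measure.ae_smul_measure ?_ _
  filter_upwards [ae_restrict_mem measurableSet_ball] with z hz
  simpa using hz

theorem setLIntegral_invMeasure (n : ℕ) {s : Set (Cn n)} (hs : MeasurableSet s)
    (F : Cn n → ℝ≥0∞) :
    ∫⁻ z in s, F z ∂(invMeasure n) =
      volume (unitBall n) * ∫⁻ z in s, defPow (-(n + 1)) z * F z ∂(ballMeasure n) := by
  have hVpos : volume (unitBall n) ≠ 0 := (measure_ball_pos _ _ one_pos).ne'
  have hVfin : volume (unitBall n) ≠ ∞ := measure_ball_lt_top.ne
  rw [invMeasure_eq, restrict_withDensity hs, ballMeasure, Measure.restrict_smul,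
    lintegral_smul_measure, smul_eq_mul, ← mul_assoc, ENNReal.mul_inv_cancel hVpos hVfin, one_mul,
    lintegral_withDensity_eq_lintegral_mul_non_measurable _ (measurable_defPow _)
      (Eventually.of_forall fun z => defPow_ne_top.lt_top)]
  rfl

/-- With y = `mob x a` and |a| ≤ 1/2, the quotient (1-|y|²)/(1-|x|²) equals (1-|a|²)/|1-⟨a,x⟩|²,
where the numerator lies in [3/4, 1] and the modulus in [1/2, 3/2]. -/
theorem one_sub_normSq_bounds {x y : Cn n} (hx : ‖x‖ < 1) (hy : ‖y‖ < 1)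
    (hd : ‖mob x y‖ ≤ 1 / 2) :
    (1 - ‖x‖ ^ 2) / 3 ≤ 1 - ‖y‖ ^ 2 ∧ 1 - ‖y‖ ^ 2 ≤ 4 * (1 - ‖x‖ ^ 2) := by
  have ha := norm_mob_lt_one hx hy
  have h := one_sub_normSq_mob hx ha
  rw [mob_mob hx hy] at h
  have hq := one_sub_normSq_pos hx
  have hin : ‖(inner ℂ x (mob x y) : ℂ)‖ ≤ 1 / 2 := by
    refine (norm_inner_le_norm _ _).trans ?_
    nlinarith [norm_nonneg x, norm_nonneg (mob x y)]
  have h1 : 1 / 2 ≤ ‖(1 - inner ℂ x (mob x y) : ℂ)‖ := by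
    have := norm_sub_norm_le (1 : ℂ) (inner ℂ x (mob x y))
    rw [norm_one] at this
    linarith
  have h2 : ‖(1 - inner ℂ x (mob x y) : ℂ)‖ ≤ 3 / 2 := by
    have := norm_sub_le (1 : ℂ) (inner ℂ x (mob x y))
    rw [norm_one] at this
    linarith
  have h3 : ‖mob x y‖ ^ 2 ≤ 1 / 4 := by nlinarith [norm_nonneg (mob x y)]
  generalize ‖(1 - inner ℂ x (mob x y) : ℂ)‖ = D at *
  have hD : 0 < D ^ 2 := by positivity
  have h4 : 1 / 4 ≤ D ^ 2 := by nlinarith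
  have h5 : D ^ 2 ≤ 9 / 4 := by nlinarith
  rw [h]
  constructor
  · rw [le_div_iff₀ hD]
    nlinarith
  · rw [div_le_iff₀ hD]
    nlinarith [mul_nonneg hq.le (sq_nonneg ‖mob x y‖)]

theorem defPow_neg_bounds {x y : Cn n} (hx : ‖x‖ < 1) (hy : ‖y‖ < 1) (hd : ‖mob x y‖ ≤ 1 / 2) :
    ENNReal.ofReal (((4 * (1 - ‖x‖ ^ 2)) ^ (n + 1))⁻¹) ≤ defPow (-(n + 1)) y ∧
      defPow (-(n + 1)) y ≤
        12 ^ (n + 1) * ENNReal.ofReal (((4 * (1 - ‖x‖ ^ 2)) ^ (n + 1))⁻¹) := by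
  obtain ⟨h1, h2⟩ := one_sub_normSq_bounds hx hy hd
  have hq := one_sub_normSq_pos hx
  have hp := one_sub_normSq_pos hy
  have e : defPow (-(n + 1)) y = ENNReal.ofReal (((1 - ‖y‖ ^ 2) ^ (n + 1))⁻¹) := by
    rw [defPow, Real.rpow_neg hp.le]
    norm_cast
  have e2 : (12 : ℝ≥0∞) ^ (n + 1) = ENNReal.ofReal (12 ^ (n + 1)) := by
    rw [ENNReal.ofReal_pow (by norm_num)]
    simp
  rw [e, e2, ← ENNReal.ofReal_mul (by positivity)]
  constructor
  · exact ENNReal.ofReal_le_ofReal (by gcongr)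
  · refine ENNReal.ofReal_le_ofReal ?_
    rw [← div_eq_mul_inv, ← div_pow, ← inv_pow]
    gcongr
    rw [inv_le_comm₀ hp (by positivity), inv_div]
    linarith

theorem lintegral_bergmanBall_eq {f : Cn n → ℂ} (hf : MemLp f ∞ (ballMeasure n)) (x : Cn n)
    (ρ : ℝ) :
    ∫⁻ y in bergmanBall n x ρ, ‖f y - ballAverage n f x ρ‖ₑ ^ 2 ∂(ballMeasure n) =
      ballMeasure n (bergmanBall n x ρ) * ENNReal.ofReal (meanOsc n f ρ x) := by
  set c := ballAverage n f x ρ with hc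
  set ν := (ballMeasure n).restrict (bergmanBall n x ρ) with hν
  have hfc : MemLp (fun y => f y - c) 2 ν :=
    ((hf.restrict _).sub (memLp_const c)).mono_exponent le_top
  have hi : Integrable (fun y => ‖f y - c‖ ^ 2) ν := hfc.integrable_norm_pow two_ne_zero
  have h1 : ∫⁻ y, ‖f y - c‖ₑ ^ 2 ∂ν = ENNReal.ofReal (∫ y, ‖f y - c‖ ^ 2 ∂ν) := by
    rw [ofReal_integral_eq_lintegral_ofReal hi (Eventually.of_forall fun y => by positivity)]
    refine lintegral_congr fun y => ?_
    rw [ENNReal.ofReal_pow (norm_nonneg _), ofReal_norm]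
  have h2 := measure_smul_average ν fun y => ‖f y - c‖ ^ 2
  have h3 : meanOsc n f ρ x = ⨍ y, ‖f y - c‖ ^ 2 ∂ν := rfl
  rw [h1, ← h2, ← h3, smul_eq_mul, ENNReal.ofReal_mul measureReal_nonneg, ofReal_measureReal, hν,
    Measure.restrict_apply_univ]

/-- The inclusions pball(x,r) ⊆ E(x,Mr) ⊆ pball(x,7Mr), the first one inside the unit ball, sandwich
the Bergman ball. On these sets the invariant density is constant up to 12^(n+1), and doubling
returns from radius 7Mr to r. -/
theorem IsVMO.exists_lintegral_pball_le {f : Cn n → ℂ} (hf : IsVMO n f) {ε : ℝ} (hε : 0 < ε) :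
    ∃ r₀ > 0, ∀ r, 0 < r → r < r₀ → ∀ x : Cn n, ‖x‖ < 1 → ∃ c : ℂ,
      ∫⁻ y in pball x r, ‖f y - c‖ₑ ^ 2 ∂(invMeasure n) ≤
        ENNReal.ofReal ε * invMeasure n (ball 0 r) := by
  set M : ℝ := 13 * (n + 1) with hM
  have hM1 : 13 ≤ M := by
    have : (0 : ℝ) ≤ n := Nat.cast_nonneg n
    rw [hM]; linarith
  set K : ℝ := 24 ^ (n + 1) * (14 * M) ^ (2 * n) with hK
  have hK0 : 0 < K := by positivity
  have hev := Metric.tendstoUniformlyOn_iff.1 hf.tendsto (ε / K) (by positivity)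
  obtain ⟨ρ₀, hρ₀, hρ⟩ := mem_nhdsGT_iff_exists_Ioo_subset.1 hev
  have hρ₀' : 0 < ρ₀ := hρ₀
  -- The second bound makes Mr < 1/28, which meets the requirements Mr ≤ 1/6 and 7Mr ≤ 1/2 of the
  -- comparisons.
  refine ⟨min (ρ₀ / M) (1 / (28 * M)), by positivity, fun r hr0 hr x hx =>
    ⟨ballAverage n f x (M * r), ?_⟩⟩
  have hr1 : M * r < ρ₀ := by
    have := hr.trans_le (min_le_left _ _)
    rw [lt_div_iff₀ (by positivity)] at this
    linarith
  have hr2 : 28 * M * r < 1 := by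
    have := hr.trans_le (min_le_right _ _)
    rw [lt_div_iff₀ (by positivity)] at this
    linarith
  have hosc : meanOsc n f (M * r) x ≤ ε / K := by
    have h1 := hρ ⟨(by positivity : 0 < M * r), hr1⟩ x (by simpa using hx)
    rw [dist_eq_norm, zero_sub, norm_neg] at h1
    exact (le_abs_self _).trans h1.le
  have hr8 : r ≤ 1 / 8 := by nlinarith
  set ν := ballMeasure n with hν
  set V := volume (unitBall n)
  set W := ENNReal.ofReal (((4 * (1 - ‖x‖ ^ 2)) ^ (n + 1))⁻¹) with hW
  set E := bergmanBall n x (M * r) with hE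
  set F : Cn n → ℝ≥0∞ := fun y => ‖f y - ballAverage n f x (M * r)‖ₑ ^ 2 with hF
  have hsub1 : pball x r ∩ {y | ‖y‖ < 1} ⊆ E := by
    rintro y ⟨hy, hy1⟩
    have hy' : ‖mob x y‖ < r := hy
    have hy1' : ‖y‖ < 1 := hy1
    refine ⟨by simpa using hy1', ?_⟩
    have := bergmanDist_le_mul_norm_mob hx hy1' (hy'.le.trans hr8)
    rw [← hM] at this
    exact this.trans_lt (by gcongr)
  have hsub2 : E ⊆ pball x (7 * (M * r)) := fun y hy =>
    norm_mob_lt_of_bergmanDist_lt hx (by simpa using hy.1) (by linarith) hy.2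
  have hball : ∀ᵐ y ∂ν, ‖y‖ < 1 := ae_ballMeasure_norm_lt n
  have hstep1 : ∫⁻ y in pball x r, F y ∂(invMeasure n) ≤
      V * (12 ^ (n + 1) * W * ∫⁻ y in E, F y ∂ν) := by
    rw [setLIntegral_invMeasure n (measurableSet_pball x r)]
    refine mul_le_mul_right ?_ _
    rw [← lintegral_const_mul' _ _ (ENNReal.mul_ne_top (by simp) ENNReal.ofReal_ne_top)]
    have hset : pball x r =ᵐ[ν] (pball x r ∩ {y | ‖y‖ < 1} : Set (Cn n)) := by
      filter_upwards [hball] with y hy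
      exact propext ⟨fun h => ⟨h, hy⟩, fun h => h.1⟩
    rw [Measure.restrict_congr_set hset]
    refine le_trans (setLIntegral_mono_ae' ((measurableSet_pball x r).inter
      (measurableSet_lt measurable_norm measurable_const)) (Eventually.of_forall fun y hy => ?_))
      (lintegral_mono_set hsub1)
    have hy' : ‖mob x y‖ < r := hy.1
    exact mul_le_mul_left (defPow_neg_bounds hx hy.2 (by linarith)).2 _
  have hstep2 : V * (W * ν E) ≤ invMeasure n (pball x (7 * (M * r))) := by
    have h := setLIntegral_invMeasure n (measurableSet_pball x (7 * (M * r))) fun _ => 1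
    rw [setLIntegral_one] at h
    rw [h]
    refine mul_le_mul_right ?_ _
    calc W * ν E ≤ W * ν (pball x (7 * (M * r))) := mul_le_mul_right (measure_mono hsub2) _
      _ = ∫⁻ y in pball x (7 * (M * r)), W ∂ν := by rw [setLIntegral_const]
      _ ≤ _ := by
        refine setLIntegral_mono_ae' (measurableSet_pball x _) ?_
        filter_upwards [hball] with y hy1 hy
        have hy' : ‖mob x y‖ < 7 * (M * r) := hy
        rw [mul_one]
        exact (defPow_neg_bounds hx hy1 (by linarith)).1
  have hstep3 : invMeasure n (pball x (7 * (M * r))) ≤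
      2 ^ (n + 1) * ENNReal.ofReal ((7 * M) ^ (2 * n)) * invMeasure n (ball 0 r) := by
    rw [invMeasure_pball hx, ← mul_assoc]
    exact invMeasure_ball_mul_le (by positivity) (by linarith) (by linarith)
  have e12 : ENNReal.ofReal ((12 : ℝ) ^ (n + 1)) = 12 ^ (n + 1) := by
    rw [ENNReal.ofReal_pow (by norm_num), ENNReal.ofReal_ofNat]
  have e2 : ENNReal.ofReal ((2 : ℝ) ^ (n + 1)) = 2 ^ (n + 1) := by
    rw [ENNReal.ofReal_pow (by norm_num), ENNReal.ofReal_ofNat]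
  have h24 : (24 : ℝ) ^ (n + 1) = 12 ^ (n + 1) * 2 ^ (n + 1) := by
    rw [← mul_pow]
    norm_num
  calc ∫⁻ y in pball x r, F y ∂(invMeasure n)
      ≤ V * (12 ^ (n + 1) * W * (ν E * ENNReal.ofReal (meanOsc n f (M * r) x))) := by
        rw [← lintegral_bergmanBall_eq hf.memLp]
        exact hstep1
    _ = 12 ^ (n + 1) * ENNReal.ofReal (meanOsc n f (M * r) x) * (V * (W * ν E)) := by ring
    _ ≤ 12 ^ (n + 1) * ENNReal.ofReal (ε / K) *
        (2 ^ (n + 1) * ENNReal.ofReal ((7 * M) ^ (2 * n)) * invMeasure n (ball 0 r)) :=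
        mul_le_mul' (mul_le_mul_right (ENNReal.ofReal_le_ofReal hosc) _) (hstep2.trans hstep3)
    _ = ENNReal.ofReal (12 ^ (n + 1) * (ε / K) * (2 ^ (n + 1) * (7 * M) ^ (2 * n))) *
        invMeasure n (ball 0 r) := by
        rw [ENNReal.ofReal_mul (by positivity), ENNReal.ofReal_mul (by positivity),
          ENNReal.ofReal_mul (by positivity), e12, e2]
        ring
    _ ≤ ENNReal.ofReal ε * invMeasure n (ball 0 r) := by
        refine mul_le_mul_left (ENNReal.ofReal_le_ofReal ?_) _
        have e : (12 : ℝ) ^ (n + 1) * (ε / K) * (2 ^ (n + 1) * (7 * M) ^ (2 * n)) =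
            ε * ((24 ^ (n + 1) * (7 * M) ^ (2 * n)) / K) := by
          rw [h24]
          ring
        rw [e]
        refine mul_le_of_le_one_right hε.le (div_le_one_of_le₀ ?_ hK0.le)
        rw [hK]
        gcongr
        linarith

/-! ### Local means and the splitting of the symbol -/

/-- Jensen's inequality for the distance of a mean value to a constant. -/
theorem measure_mul_enorm_average_sub_sq_le {α : Type*} [MeasurableSpace α] (ν : Measure α)
    [IsFiniteMeasure ν] {φ : α → ℂ} (hφ : Integrable φ ν) (c : ℂ) :
    ν Set.univ * ‖⨍ y, φ y ∂ν - c‖ₑ ^ 2 ≤ ∫⁻ y, ‖φ y - c‖ₑ ^ 2 ∂ν := by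
  rcases eq_or_ne (ν Set.univ) 0 with h0 | h0
  · simp [h0]
  have h1 : ν Set.univ * ‖⨍ y, φ y ∂ν - c‖ₑ ≤ ∫⁻ y, ‖φ y - c‖ₑ ∂ν := by
    have e : ν.real Set.univ • (⨍ y, φ y ∂ν - c) = ∫ y, (φ y - c) ∂ν := by
      rw [integral_sub hφ (integrable_const c), integral_const, smul_sub, measure_smul_average]
    have e2 : ‖ν.real Set.univ‖ₑ = ν Set.univ := by
      rw [Real.enorm_eq_ofReal measureReal_nonneg, ofReal_measureReal]
    rw [← e2, ← enorm_smul, e]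
    exact enorm_integral_le_lintegral_enorm _
  have h2 := sq_lintegral_le ν (hφ.1.sub aestronglyMeasurable_const).enorm (U := fun y => ‖φ y - c‖ₑ)
  have h3 := (pow_le_pow_left' h1 2).trans h2
  rw [mul_pow, sq (ν Set.univ), mul_assoc] at h3
  exact (ENNReal.mul_le_mul_iff_right h0 (measure_ne_top _ _)).1 h3

/-- The mean value of `φ` over a pseudohyperbolic ball, with respect to the invariant measure. -/
noncomputable def pmean (φ : Cn n → ℂ) (r : ℝ) (z : Cn n) : ℂ :=
  ⨍ y in pball z r, φ y ∂(invMeasure n)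

theorem measurable_pmean {φ : Cn n → ℂ} (hφ : Measurable φ) (r : ℝ) : Measurable (pmean φ r) := by
  have hset : MeasurableSet {p : Cn n × Cn n | ‖mob p.1 p.2‖ < r} :=
    measurableSet_lt measurable_mob_uncurry.norm measurable_const
  have h1 : Measurable fun z : Cn n => ∫ y, (pball z r).indicator φ y ∂(invMeasure n) := by
    have : StronglyMeasurable (Function.uncurry fun z : Cn n => (pball z r).indicator φ) :=
      ((hφ.comp measurable_snd).indicator hset).stronglyMeasurable
    exact this.integral_prod_right.measurable
  have h2 : Measurable fun z : Cn n => (invMeasure n).real (pball z r) :=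
    (measurable_measure_prodMk_left hset).ennreal_toReal
  have h3 : pmean φ r = fun z => ((invMeasure n).real (pball z r))⁻¹ •
      ∫ y, (pball z r).indicator φ y ∂(invMeasure n) := by
    ext z
    rw [pmean, setAverage_eq, integral_indicator (measurableSet_pball z r)]
  rw [h3]
  exact h2.inv.smul h1

theorem isFiniteMeasure_restrict_pball {z : Cn n} (hz : ‖z‖ < 1) {r : ℝ} (hr : r ≤ 1 / 2) :
    IsFiniteMeasure ((invMeasure n).restrict (pball z r)) := by
  refine ⟨?_⟩
  rw [Measure.restrict_apply_univ, invMeasure_pball hz]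
  exact (invMeasure_ball_ne_top hr).lt_top

theorem invMeasure_ball_mul_enorm_pmean_sub_sq_le {φ : Cn n → ℂ} (hφ : Measurable φ) {B : ℝ}
    (hB : ∀ z, ‖φ z‖ ≤ B) {r : ℝ} (hr : r ≤ 1 / 2) {z : Cn n} (hz : ‖z‖ < 1) (c : ℂ) :
    invMeasure n (ball 0 r) * ‖pmean φ r z - c‖ₑ ^ 2 ≤
      ∫⁻ y in pball z r, ‖φ y - c‖ₑ ^ 2 ∂(invMeasure n) := by
  have := isFiniteMeasure_restrict_pball hz hr
  have h := measure_mul_enorm_average_sub_sq_le ((invMeasure n).restrict (pball z r))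
    (Integrable.of_bound hφ.aestronglyMeasurable B (Eventually.of_forall hB)) c
  rwa [Measure.restrict_apply_univ, invMeasure_pball hz] at h

theorem norm_pmean_le {φ : Cn n → ℂ} (hφ : Measurable φ) {B : ℝ} (hB : ∀ z, ‖φ z‖ ≤ B) {r : ℝ}
    (hr0 : 0 < r) (hr : r ≤ 1 / 2) {z : Cn n} (hz : ‖z‖ < 1) : ‖pmean φ r z‖ ≤ B := by
  have hB0 : 0 ≤ B := (norm_nonneg _).trans (hB 0)
  have h := invMeasure_ball_mul_enorm_pmean_sub_sq_le hφ hB hr hz 0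
  have h1 : ∫⁻ y in pball z r, ‖φ y - 0‖ₑ ^ 2 ∂(invMeasure n) ≤
      invMeasure n (ball 0 r) * ENNReal.ofReal B ^ 2 := by
    rw [← invMeasure_pball hz, mul_comm, ← setLIntegral_const]
    refine lintegral_mono fun y => pow_le_pow_left' ?_ 2
    rw [sub_zero, ← ofReal_norm]
    exact ENNReal.ofReal_le_ofReal (hB y)
  have h2 := (ENNReal.mul_le_mul_iff_right (invMeasure_ball_ne_zero hr0 (by linarith))
    (invMeasure_ball_ne_top hr)).1 (h.trans h1)
  rw [sub_zero, ← ofReal_norm] at h2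
  have h3 := (ENNReal.pow_right_strictMono two_ne_zero).le_iff_le.1 h2
  exact (ENNReal.ofReal_le_ofReal_iff hB0).1 h3

/-- The doubling constant comparing invariant volumes of balls of radii `r` and `4 r`. -/
noncomputable def doublingConst (n : ℕ) : ℝ≥0∞ := 2 ^ (n + 1) * ENNReal.ofReal (4 ^ (2 * n))

theorem doublingConst_ne_top (n : ℕ) : doublingConst n ≠ ∞ :=
  ENNReal.mul_ne_top (by simp) ENNReal.ofReal_ne_top

/-- The crude triangle inequality gives 3r, and 4r makes the inclusion strict. This is why
oscillation is assumed on balls of radius 4r: one constant c then serves all balls of radius r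
centred within r of x. -/
theorem pball_subset {x z : Cn n} (hx : ‖x‖ < 1) (hz : ‖z‖ < 1) {r : ℝ} (hr0 : 0 < r)
    (hr : r ≤ 1 / 2) (hxz : ‖mob x z‖ ≤ r) : pball z r ∩ {y | ‖y‖ < 1} ⊆ pball x (4 * r) := by
  rintro y ⟨hy, hy1⟩
  have hy' : ‖mob z y‖ < r := hy
  rw [norm_mob_comm hx hz] at hxz
  have := norm_mob_le_of_norm_mob_le hr hz hx hy1 hxz hy'.le
  exact this.trans_lt (by linarith)

theorem setLIntegral_pball_le {x z : Cn n} (hx : ‖x‖ < 1) (hz : ‖z‖ < 1) {r : ℝ} (hr0 : 0 < r)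
    (hr : r ≤ 1 / 2) (hxz : ‖mob x z‖ ≤ r) (F : Cn n → ℝ≥0∞) :
    ∫⁻ y in pball z r, F y ∂(invMeasure n) ≤ ∫⁻ y in pball x (4 * r), F y ∂(invMeasure n) := by
  have hset : pball z r =ᵐ[invMeasure n] (pball z r ∩ {y | ‖y‖ < 1} : Set (Cn n)) := by
    filter_upwards [ae_invMeasure_norm_lt n] with y hy
    exact propext ⟨fun h => ⟨h, hy⟩, fun h => h.1⟩
  rw [Measure.restrict_congr_set hset]
  exact lintegral_mono_set (pball_subset hx hz hr0 hr hxz)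

theorem setLIntegral_pball_le_of_osc {φ : Cn n → ℂ} {r : ℝ} (hr0 : 0 < r) (hr : 4 * r ≤ 1 / 2)
    {x : Cn n} (hx : ‖x‖ < 1) {c : ℂ} {E : ℝ≥0∞}
    (hc : ∫⁻ y in pball x (4 * r), ‖φ y - c‖ₑ ^ 2 ∂(invMeasure n) ≤
      E * invMeasure n (ball 0 (4 * r))) {z : Cn n} (hz : ‖z‖ < 1) (hxz : ‖mob x z‖ ≤ r) :
    ∫⁻ y in pball z r, ‖φ y - c‖ₑ ^ 2 ∂(invMeasure n) ≤
      E * doublingConst n * invMeasure n (ball 0 r) := by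
  refine (setLIntegral_pball_le hx hz hr0 (by linarith) hxz _).trans (hc.trans ?_)
  rw [mul_assoc]
  exact mul_le_mul_right (invMeasure_ball_mul_le (by norm_num) hr (by linarith)) _

theorem enorm_pmean_sub_sq_le {φ : Cn n → ℂ} (hφ : Measurable φ) {B : ℝ} (hB : ∀ z, ‖φ z‖ ≤ B)
    {r : ℝ} (hr0 : 0 < r) (hr : 4 * r ≤ 1 / 2)
    {x : Cn n} (hx : ‖x‖ < 1) {c : ℂ} {E : ℝ≥0∞}
    (hc : ∫⁻ y in pball x (4 * r), ‖φ y - c‖ₑ ^ 2 ∂(invMeasure n) ≤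
      E * invMeasure n (ball 0 (4 * r))) {z : Cn n} (hz : ‖z‖ < 1) (hxz : ‖mob x z‖ ≤ r) :
    ‖pmean φ r z - c‖ₑ ^ 2 ≤ E * doublingConst n := by
  have h := (invMeasure_ball_mul_enorm_pmean_sub_sq_le hφ hB (by linarith) hz c).trans
    (setLIntegral_pball_le_of_osc hr0 hr hx hc hz hxz)
  rw [mul_comm _ (invMeasure n _)] at h
  exact (ENNReal.mul_le_mul_iff_right (invMeasure_ball_ne_zero hr0 (by linarith))
    (invMeasure_ball_ne_top (by linarith))).1 h

theorem enorm_sub_sq_le (a b : ℂ) : ‖a - b‖ₑ ^ 2 ≤ 2 * ‖a‖ₑ ^ 2 + 2 * ‖b‖ₑ ^ 2 := by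
  simp only [← ofReal_norm]
  rw [← ENNReal.ofReal_pow (norm_nonneg _), ← ENNReal.ofReal_pow (norm_nonneg _),
    ← ENNReal.ofReal_pow (norm_nonneg _), ← ENNReal.ofReal_ofNat 2,
    ← ENNReal.ofReal_mul (by norm_num), ← ENNReal.ofReal_mul (by norm_num),
    ← ENNReal.ofReal_add (by positivity) (by positivity)]
  refine ENNReal.ofReal_le_ofReal ?_
  have := norm_sub_le a b
  nlinarith [sq_nonneg (‖a‖ - ‖b‖), norm_nonneg (a - b), norm_nonneg a, norm_nonneg b]

/-- Both means lie close to the same constant c attached to the ball of radius 4r about z, hence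
close to each other. -/
theorem norm_pmean_sub_pmean_le {φ : Cn n → ℂ} (hφ : Measurable φ) {B : ℝ} (hB : ∀ z, ‖φ z‖ ≤ B)
    {r : ℝ} (hr0 : 0 < r) (hr : 4 * r ≤ 1 / 2) {ε : ℝ} (hε : 0 ≤ ε)
    (hosc : ∀ x : Cn n, ‖x‖ < 1 → ∃ c : ℂ,
      ∫⁻ y in pball x (4 * r), ‖φ y - c‖ₑ ^ 2 ∂(invMeasure n) ≤
        ENNReal.ofReal (ε ^ 2) * invMeasure n (ball 0 (4 * r)))
    {z w : Cn n} (hz : ‖z‖ < 1) (hw : ‖w‖ < 1) (hzw : ‖mob z w‖ ≤ r) :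
    ‖pmean φ r z - pmean φ r w‖ ≤ 2 * Real.sqrt (doublingConst n).toReal * ε := by
  obtain ⟨c, hc⟩ := hosc z hz
  have h1 : ∀ y : Cn n, ‖y‖ < 1 → ‖mob z y‖ ≤ r →
      ‖pmean φ r y - c‖ ≤ Real.sqrt (doublingConst n).toReal * ε := fun y hy hzy => by
    have h := enorm_pmean_sub_sq_le hφ hB hr0 hr hz hc hy hzy
    have h2 := ENNReal.toReal_mono
      (ENNReal.mul_ne_top ENNReal.ofReal_ne_top (doublingConst_ne_top n)) h
    rw [ENNReal.toReal_mul, ENNReal.toReal_ofReal (sq_nonneg ε), ENNReal.toReal_pow,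
      toReal_enorm] at h2
    refine abs_le_of_sq_le_sq' ?_ (by positivity) |>.2
    rw [mul_pow, Real.sq_sqrt ENNReal.toReal_nonneg]
    linarith
  have h2 := h1 z hz (by rw [mob_self hz, norm_zero]; exact hr0.le)
  have h3 := h1 w hw hzw
  have h4 := norm_sub_le (pmean φ r z - c) (pmean φ r w - c)
  rw [sub_sub_sub_cancel_right] at h4
  linarith

theorem setLIntegral_enorm_sub_pmean_sq_le {φ : Cn n → ℂ} (hφ : Measurable φ) {B : ℝ}
    (hB : ∀ z, ‖φ z‖ ≤ B) {r : ℝ} (hr0 : 0 < r) (hr : 4 * r ≤ 1 / 2) {E : ℝ≥0∞}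
    (hosc : ∀ x : Cn n, ‖x‖ < 1 → ∃ c : ℂ,
      ∫⁻ y in pball x (4 * r), ‖φ y - c‖ₑ ^ 2 ∂(invMeasure n) ≤
        E * invMeasure n (ball 0 (4 * r))) {x : Cn n} (hx : ‖x‖ < 1) :
    ∫⁻ y in pball x r, ‖φ y - pmean φ r y‖ₑ ^ 2 ∂(invMeasure n) ≤
      4 * (E * doublingConst n) * invMeasure n (ball 0 r) := by
  obtain ⟨c, hc⟩ := hosc x hx
  set D := E * doublingConst n
  have h1 : ∫⁻ y in pball x r, ‖φ y - c‖ₑ ^ 2 ∂(invMeasure n) ≤ D * invMeasure n (ball 0 r) :=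
    setLIntegral_pball_le_of_osc hr0 hr hx hc hx (by rw [mob_self hx, norm_zero]; exact hr0.le)
  have hm : Measurable fun y => 2 * ‖φ y - c‖ₑ ^ 2 :=
    (((hφ.sub_const c).enorm).pow_const 2).const_mul 2
  calc ∫⁻ y in pball x r, ‖φ y - pmean φ r y‖ₑ ^ 2 ∂(invMeasure n)
      ≤ ∫⁻ y in pball x r, (2 * ‖φ y - c‖ₑ ^ 2 + 2 * D) ∂(invMeasure n) := by
        refine setLIntegral_mono_ae' (measurableSet_pball x r) ?_
        filter_upwards [ae_invMeasure_norm_lt n] with y hy hxy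
        have hxy' : ‖mob x y‖ < r := hxy
        have h2 := enorm_pmean_sub_sq_le hφ hB hr0 hr hx hc hy hxy'.le
        -- Symbol and mean are both compared with c; the two contributions 2D make up the constant
        -- 4.
        have h3 := enorm_sub_sq_le (φ y - c) (pmean φ r y - c)
        rw [sub_sub_sub_cancel_right] at h3
        exact h3.trans (add_le_add le_rfl (mul_le_mul_right h2 _))
    _ = 2 * ∫⁻ y in pball x r, ‖φ y - c‖ₑ ^ 2 ∂(invMeasure n) +
        2 * D * invMeasure n (ball 0 r) := by
        rw [lintegral_add_left hm, lintegral_const_mul _ (((hφ.sub_const c).enorm).pow_const 2),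
          setLIntegral_const, invMeasure_pball hx]
    _ ≤ 2 * (D * invMeasure n (ball 0 r)) + 2 * D * invMeasure n (ball 0 r) :=
        add_le_add (mul_le_mul_right h1 _) le_rfl
    _ = _ := by ring

theorem norm_sub_bergmanProj_le {lam : ℝ} (h : Lp ℂ 2 (bergmanMeasure n lam)) :
    ‖h - bergmanProj n lam h‖ ≤ ‖h‖ := by
  have h1 : h - bergmanProj n lam h = (bergmanSpace n lam)ᗮ.orthogonalProjectionOnto h := by
    rw [sub_eq_iff_eq_add']
    exact ((bergmanSpace n lam).starProjection_add_starProjection_orthogonal h).symm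
  rw [h1]
  exact Submodule.norm_orthogonalProjectionOnto_apply_le _ h

/-- A symbol with small local `L²` oscillation is a small form perturbation on the Bergman space. -/
theorem lintegral_enorm_sq_mul_le {lam r : ℝ} (hlam : 2 ≤ lam) (hr0 : 0 < r) (hr : r ≤ 1 / 2)
    (hlr : lam * r ^ 2 ≤ 1) {ψ : Cn n → ℂ} (hψ : Measurable ψ) {D : ℝ≥0∞}
    (hD : ∀ x : Cn n, ‖x‖ < 1 → ∫⁻ y in pball x r, ‖ψ y‖ₑ ^ 2 ∂(invMeasure n) ≤
      D * invMeasure n (ball 0 r)) (u : bergmanSpace n lam) :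
    ∫⁻ z, ‖ψ z * (u : Lp ℂ 2 (bergmanMeasure n lam)) z‖ₑ ^ 2 ∂(bergmanMeasure n lam) ≤
      4 * 2 ^ (n + 1) * D * ‖u‖ₑ ^ 2 := by
  obtain ⟨v, hv, huv⟩ := u.2
  set V : Cn n → ℂ := (unitBall n).indicator v
  have hVm : Measurable V := measurable_indicator_of_differentiableOn hv
  have hVv : ∀ z : Cn n, ‖z‖ < 1 → V z = v z := fun z hz =>
    Set.indicator_of_mem (by simpa using hz) _
  set G : Cn n → ℝ≥0∞ := fun z => ‖V z‖ₑ ^ 2 * defPow lam z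
  have hG : Measurable G := (hVm.enorm.pow_const 2).mul (measurable_defPow _)
  have huV : (u : Lp ℂ 2 (bergmanMeasure n lam)) =ᵐ[bergmanMeasure n lam] V := by
    filter_upwards [huv, ae_bergmanMeasure_norm_lt n lam] with z h1 h2
    rw [h1, hVv z h2]
  have hmain := lintegral_mul_le_of_submean hr0 hr (K := 4 * 2 ^ (n + 1))
    (ENNReal.mul_ne_top (by simp) (by simp)) hG (hψ.enorm.pow_const 2)
    (fun x hx => enorm_sq_mul_le hlam hr0 hr hlr hv hG (fun z hz => by rw [← hVv z hz]) hx) hD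
  have e1 : ∫⁻ z, ‖ψ z * (u : Lp ℂ 2 (bergmanMeasure n lam)) z‖ₑ ^ 2 ∂(bergmanMeasure n lam) =
      (defInt n lam)⁻¹ * ∫⁻ z, ‖ψ z‖ₑ ^ 2 * G z ∂(invMeasure n) := by
    rw [lintegral_congr_ae (g := fun z => ‖ψ z * V z‖ₑ ^ 2)
      (huV.mono fun z hz => by simp only [hz]), lintegral_bergmanMeasure]
    congr 1
    refine lintegral_congr fun z => ?_
    simp only [G]
    rw [enorm_mul]
    ring
  have e2 : ‖u‖ₑ ^ 2 = (defInt n lam)⁻¹ * ∫⁻ z, G z ∂(invMeasure n) := by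
    change ‖(u : Lp ℂ 2 (bergmanMeasure n lam))‖ₑ ^ 2 = _
    rw [enorm_sq_eq_lintegral, lintegral_congr_ae (g := fun z => ‖V z‖ₑ ^ 2)
      (huV.mono fun z hz => by simp only [hz]), lintegral_bergmanMeasure]
    congr 1
    refine lintegral_congr fun z => ?_
    simp only [G]
    ring
  rw [e1, e2]
  calc (defInt n lam)⁻¹ * ∫⁻ z, ‖ψ z‖ₑ ^ 2 * G z ∂(invMeasure n)
      ≤ (defInt n lam)⁻¹ * (4 * 2 ^ (n + 1) * D * ∫⁻ z, G z ∂(invMeasure n)) :=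
        mul_le_mul_right hmain _
    _ = _ := by ring

/-- The Hankel operator of a symbol with small local oscillation is small. -/
theorem exists_enorm_sub_bergmanProj_le_of_osc (hn : 1 ≤ n) : ∃ K : ℝ≥0∞, K ≠ ∞ ∧
    ∀ (lam r ε B : ℝ) (φ : Cn n → ℂ), 8 * (n + 1) ≤ lam → 0 < r → 4 * r ≤ 1 / 2 →
      lam * r ^ 2 = 1 → 0 ≤ ε → Measurable φ → (∀ z, ‖φ z‖ ≤ B) →
      (∀ x : Cn n, ‖x‖ < 1 → ∃ c : ℂ,
        ∫⁻ y in pball x (4 * r), ‖φ y - c‖ₑ ^ 2 ∂(invMeasure n) ≤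
          ENNReal.ofReal (ε ^ 2) * invMeasure n (ball 0 (4 * r))) →
      ∀ (u : bergmanSpace n lam) (h : Lp ℂ 2 (bergmanMeasure n lam)),
        h =ᵐ[bergmanMeasure n lam] (fun z => φ z * (u : Lp ℂ 2 (bergmanMeasure n lam)) z) →
        ‖h - bergmanProj n lam h‖ₑ ≤ K * ENNReal.ofReal ε * ‖u‖ₑ := by
  obtain ⟨K, hK, hKb⟩ := exists_enorm_sub_bergmanProj_le hn
  set Q : ℝ≥0∞ := 4 * 2 ^ (n + 1) * (4 * doublingConst n) with hQ
  have hQt : Q ≠ ∞ := ENNReal.mul_ne_top (ENNReal.mul_ne_top (by simp) (by simp))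
    (ENNReal.mul_ne_top (by simp) (doublingConst_ne_top n))
  set S := 2 * Real.sqrt (doublingConst n).toReal with hS
  refine ⟨K * ENNReal.ofReal S + Q ^ (1 / 2 : ℝ), ENNReal.add_ne_top.2
    ⟨ENNReal.mul_ne_top hK ENNReal.ofReal_ne_top, ENNReal.rpow_ne_top_of_nonneg (by norm_num) hQt⟩,
    fun lam r ε B φ hlam hr0 hr hlr hε hφ hB hosc u h hh => ?_⟩
  have hn0 : (0 : ℝ) ≤ n := Nat.cast_nonneg n
  have hmem : MemLp (fun z => pmean φ r z * (u : Lp ℂ 2 (bergmanMeasure n lam)) z) 2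
      (bergmanMeasure n lam) := by
    refine (Lp.memLp (u : Lp ℂ 2 (bergmanMeasure n lam))).of_le_mul (c := B)
      ((measurable_pmean hφ r).aestronglyMeasurable.mul (Lp.aestronglyMeasurable _)) ?_
    filter_upwards [ae_bergmanMeasure_norm_lt n lam] with z hz
    rw [norm_mul]
    exact mul_le_mul_of_nonneg_right (norm_pmean_le hφ hB hr0 (by linarith) hz) (norm_nonneg _)
  set h1 := hmem.toLp with hh1
  have hk1 := hKb lam r (S * ε) (pmean φ r) hlam hr0 (by linarith) hlr.ge
    (fun z w hz hw hzw => norm_pmean_sub_pmean_le hφ hB hr0 hr hε hosc hz hw hzw) u h1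
    hmem.coeFn_toLp
  -- For the rough part multiplication itself is small on holomorphic functions, so contractivity of
  -- I - P is enough and no cancellation in the kernel is needed.
  have hk2 : ‖h - h1‖ₑ ≤ Q ^ (1 / 2 : ℝ) * ENNReal.ofReal ε * ‖u‖ₑ := by
    rw [← (ENNReal.pow_right_strictMono two_ne_zero).le_iff_le]
    have h2 := lintegral_enorm_sq_mul_le (by linarith) hr0 (by linarith) hlr.le
      (hφ.sub (measurable_pmean hφ r))
      (fun x hx => setLIntegral_enorm_sub_pmean_sq_le hφ hB hr0 hr hosc hx) u
    rw [enorm_sq_eq_lintegral, lintegral_congr_ae (g := fun z => ‖(φ - pmean φ r) z *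
      (u : Lp ℂ 2 (bergmanMeasure n lam)) z‖ₑ ^ 2)]
    · refine h2.trans (le_of_eq ?_)
      have h3 : (Q ^ (1 / 2 : ℝ)) ^ 2 = Q := by
        rw [← ENNReal.rpow_natCast, ← ENNReal.rpow_mul]
        simp
      rw [mul_pow, mul_pow, h3, ENNReal.ofReal_pow hε, hQ]
      ring
    · filter_upwards [Lp.coeFn_sub h h1, hh, hmem.coeFn_toLp] with z e1 e2 e3
      rw [e1, Pi.sub_apply, e2, e3, Pi.sub_apply, sub_mul]
  have hsplit : h - bergmanProj n lam h =
      (h1 - bergmanProj n lam h1) + ((h - h1) - bergmanProj n lam (h - h1)) := by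
    rw [map_sub, Submodule.coe_sub]
    abel
  rw [hsplit]
  refine (enorm_add_le _ _).trans ?_
  have hk3 : ‖(h - h1) - bergmanProj n lam (h - h1)‖ₑ ≤ ‖h - h1‖ₑ := by
    rw [← ofReal_norm, ← ofReal_norm]
    exact ENNReal.ofReal_le_ofReal (norm_sub_bergmanProj_le _)
  refine (add_le_add hk1 (hk3.trans hk2)).trans (le_of_eq ?_)
  rw [ENNReal.ofReal_mul (by positivity)]
  ring

/-! ### Vanishing oscillation and the limit of the Hankel norms -/

/-- The mean oscillation over pseudohyperbolic balls, with respect to the invariant measure, tends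
to zero with the radius, uniformly in the centre. -/
def HasVanishingOsc (n : ℕ) (f : Cn n → ℂ) : Prop :=
  ∀ ε : ℝ, 0 < ε → ∃ r₀ > 0, ∀ r, 0 < r → r < r₀ → ∀ x : Cn n, ‖x‖ < 1 → ∃ c : ℂ,
    ∫⁻ y in pball x r, ‖f y - c‖ₑ ^ 2 ∂(invMeasure n) ≤ ENNReal.ofReal ε * invMeasure n (ball 0 r)

theorem IsVMO.hasVanishingOsc {f : Cn n → ℂ} (hf : IsVMO n f) : HasVanishingOsc n f :=
  fun _ => hf.exists_lintegral_pball_le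

theorem HasVanishingOsc.conj {f : Cn n → ℂ} (hf : HasVanishingOsc n f) :
    HasVanishingOsc n (star f) := fun ε hε => by
  obtain ⟨r₀, hr₀, h⟩ := hf ε hε
  refine ⟨r₀, hr₀, fun r hr hr' x hx => ?_⟩
  obtain ⟨c, hc⟩ := h r hr hr' x hx
  refine ⟨starRingEnd ℂ c, le_of_eq_of_le (lintegral_congr fun y => ?_) hc⟩
  rw [Pi.star_apply, RCLike.star_def, ← map_sub, RCLike.enorm_conj]

theorem HasVanishingOsc.congr {f φ : Cn n → ℂ} (hf : HasVanishingOsc n f)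
    (h : f =ᵐ[invMeasure n] φ) : HasVanishingOsc n φ := fun ε hε => by
  obtain ⟨r₀, hr₀, H⟩ := hf ε hε
  refine ⟨r₀, hr₀, fun r hr hr' x hx => ?_⟩
  obtain ⟨c, hc⟩ := H r hr hr' x hx
  refine ⟨c, le_of_eq_of_le (lintegral_congr_ae (ae_restrict_of_ae ?_)) hc⟩
  filter_upwards [h] with y hy
  rw [hy]

theorem exists_ae_norm_le {f : Cn n → ℂ} (hf : MemLp f ∞ (ballMeasure n)) :
    ∃ B : ℝ, 0 ≤ B ∧ ∀ᵐ z ∂(ballMeasure n), ‖f z‖ ≤ B := by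
  have hfin : eLpNormEssSup f (ballMeasure n) ≠ ∞ := by
    rw [← eLpNorm_exponent_top]
    exact hf.2.ne
  refine ⟨(eLpNormEssSup f (ballMeasure n)).toReal, ENNReal.toReal_nonneg, ?_⟩
  filter_upwards [ae_le_eLpNormEssSup (f := f) (μ := ballMeasure n)] with z hz
  rw [← toReal_enorm]
  exact ENNReal.toReal_mono hfin hz

/-- The averaging estimates require a Borel function bounded at every point. The operators and the
oscillation see only the class of f, so this representative may replace it. -/
theorem exists_measurable_bounded_ae_eq {f : Cn n → ℂ} (hf : MemLp f ∞ (ballMeasure n)) :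
    ∃ (φ : Cn n → ℂ) (B : ℝ), Measurable φ ∧ (∀ z, ‖φ z‖ ≤ B) ∧ f =ᵐ[ballMeasure n] φ := by
  obtain ⟨B, hB0, hB⟩ := exists_ae_norm_le hf
  obtain ⟨g, hg, hfg⟩ := hf.1
  have hs : MeasurableSet {z | ‖g z‖ ≤ B} := measurableSet_le hg.measurable.norm measurable_const
  refine ⟨{z | ‖g z‖ ≤ B}.indicator g, B, hg.measurable.indicator hs, fun z => ?_, ?_⟩
  · by_cases h : z ∈ {z | ‖g z‖ ≤ B}
    · rw [Set.indicator_of_mem h]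
      exact h
    · rw [Set.indicator_of_notMem h, norm_zero]
      exact hB0
  · filter_upwards [hB, hfg] with z h1 h2
    rw [Set.indicator_of_mem, h2]
    rw [h2] at h1
    exact h1

theorem hankel_apply {lam : ℝ} {f : Cn n → ℂ} (hf : MemLp f ∞ (ballMeasure n))
    (u : bergmanSpace n lam) :
    hankel n lam f hf u = mulOp n lam f hf u - bergmanProj n lam (mulOp n lam f hf u) := rfl

theorem HasVanishingOsc.tendsto_norm_hankel (hn : 1 ≤ n) {f : Cn n → ℂ}
    (hf : MemLp f ∞ (ballMeasure n)) (ho : HasVanishingOsc n f) :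
    Tendsto (fun lam : ℝ => ‖hankel n lam f hf‖) atTop (𝓝 0) := by
  obtain ⟨K, hK, hKb⟩ := exists_enorm_sub_bergmanProj_le_of_osc hn
  obtain ⟨φ, B, hφ, hB, hfφ⟩ := exists_measurable_bounded_ae_eq hf
  have ho' := ho.congr ((invMeasure_ac_ballMeasure n).ae_le hfφ)
  have hbound : ∀ ε : ℝ, 0 < ε → ∀ᶠ lam : ℝ in atTop, ‖hankel n lam f hf‖ ≤ K.toReal * ε := by
    intro ε hε
    obtain ⟨r₀, hr₀, H⟩ := ho' (ε ^ 2) (by positivity)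
    -- For r = λ^(-1/2) the first condition gives 4r < r₀ and the second gives 4r ≤ 1/2.
    filter_upwards [Real.tendsto_sqrt_atTop.eventually_gt_atTop (4 / r₀),
      Real.tendsto_sqrt_atTop.eventually_ge_atTop 8, eventually_ge_atTop (8 * ((n : ℝ) + 1))]
      with lam h1 h2 h3
    have hs : 0 < Real.sqrt lam := by linarith
    have hlam0 : 0 < lam := Real.sqrt_pos.1 hs
    refine ContinuousLinearMap.opNorm_le_bound _ (by positivity) fun u => ?_
    have h4 : 4 * (Real.sqrt lam)⁻¹ < r₀ := by
      rw [div_lt_iff₀ hr₀] at h1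
      rw [← div_eq_mul_inv, div_lt_iff₀ hs]
      linarith
    have h5 : 4 * (Real.sqrt lam)⁻¹ ≤ 1 / 2 := by
      rw [← div_eq_mul_inv, div_le_iff₀ hs]
      linarith
    have h6 : lam * (Real.sqrt lam)⁻¹ ^ 2 = 1 := by
      rw [inv_pow, Real.sq_sqrt hlam0.le, mul_inv_cancel₀ hlam0.ne']
    have h7 := hKb lam (Real.sqrt lam)⁻¹ ε B φ h3 (by positivity) h5 h6 hε.le hφ hB
      (fun x hx => H _ (by positivity) h4 x hx) u (mulOp n lam f hf u) (by
        filter_upwards [coeFn_mulOp n lam f hf u,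
          (bergmanMeasure_absolutelyContinuous n lam).ae_le hfφ] with z e1 e2
        rw [e1, e2])
    rw [← hankel_apply] at h7
    have h8 := ENNReal.toReal_mono
      (ENNReal.mul_ne_top (ENNReal.mul_ne_top hK ENNReal.ofReal_ne_top) enorm_ne_top) h7
    rwa [ENNReal.toReal_mul, ENNReal.toReal_mul, ENNReal.toReal_ofReal hε.le, toReal_enorm,
      toReal_enorm] at h8
  rw [Metric.tendsto_nhds]
  intro δ hδ
  have hK0 : 0 ≤ K.toReal := ENNReal.toReal_nonneg
  filter_upwards [hbound (δ / (K.toReal + 1)) (by positivity)] with lam h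
  rw [dist_zero_right, Real.norm_of_nonneg (ContinuousLinearMap.opNorm_nonneg _)]
  refine h.trans_lt ?_
  rw [← mul_div_assoc, div_lt_iff₀ (by positivity)]
  nlinarith

/-! ### Semi-commutators through Hankel operators -/

theorem inner_mulOp {lam : ℝ} {f : Cn n → ℂ} (hf : MemLp f ∞ (ballMeasure n))
    (x y : Lp ℂ 2 (bergmanMeasure n lam)) :
    inner ℂ x (mulOp n lam f hf y) = inner ℂ (mulOp n lam (star f) hf.star x) y := by
  rw [L2.inner_def, L2.inner_def]
  refine integral_congr_ae ?_
  filter_upwards [coeFn_mulOp n lam f hf y, coeFn_mulOp n lam (star f) hf.star x] with z h1 h2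
  rw [h1, h2, RCLike.inner_apply, RCLike.inner_apply, Pi.star_apply, map_mul]
  simp only [RCLike.star_def, RCLike.conj_conj]
  ring

/-- On the orthogonal complement P M_f is the adjoint of the Hankel operator of the conjugate
symbol. Pairing p = P M_f y with itself gives ‖p‖² = ⟨H p, y⟩ for that operator H, because y
annihilates the part of the product in A²_λ. -/
theorem norm_bergmanProj_mulOp_le {lam : ℝ} {f : Cn n → ℂ} (hf : MemLp f ∞ (ballMeasure n))
    {y : Lp ℂ 2 (bergmanMeasure n lam)} (hy : bergmanProj n lam y = 0) :
    ‖bergmanProj n lam (mulOp n lam f hf y)‖ ≤ ‖hankel n lam (star f) hf.star‖ * ‖y‖ := by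
  set p := bergmanProj n lam (mulOp n lam f hf y) with hp
  have horth : ∀ q : bergmanSpace n lam, inner ℂ (q : Lp ℂ 2 (bergmanMeasure n lam)) y = 0 :=
    fun q => by
      have := Submodule.inner_orthogonalProjectionOnto_eq_of_mem_left q y
      rw [← this]
      change inner ℂ q (bergmanProj n lam y) = 0
      rw [hy, inner_zero_right]
  have h1 : inner ℂ (p : Lp ℂ 2 (bergmanMeasure n lam)) (p : Lp ℂ 2 (bergmanMeasure n lam)) =
      inner ℂ (hankel n lam (star f) hf.star p) y := by
    have h2 := Submodule.inner_orthogonalProjectionOnto_eq_of_mem_left p (mulOp n lam f hf y)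
    rw [hankel_apply, inner_sub_left, horth, sub_zero, ← inner_mulOp hf, ← h2]
    rfl
  have h3 : ‖p‖ ^ 2 ≤ ‖hankel n lam (star f) hf.star‖ * ‖p‖ * ‖y‖ := by
    have h4 := norm_inner_le_norm (𝕜 := ℂ) (hankel n lam (star f) hf.star p) y
    rw [← h1, inner_self_eq_norm_sq_to_K] at h4
    have h5 : ‖((‖(p : Lp ℂ 2 (bergmanMeasure n lam))‖ : ℂ)) ^ 2‖ = ‖p‖ ^ 2 := by
      rw [norm_pow, Complex.norm_real, norm_norm]
      rfl
    refine (le_of_eq_of_le h5.symm h4).trans ?_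
    exact mul_le_mul_of_nonneg_right ((hankel n lam (star f) hf.star).le_opNorm p) (norm_nonneg _)
  rcases (norm_nonneg p).eq_or_lt with h0 | h0
  · rw [← h0]
    positivity
  · refine le_of_mul_le_mul_right ?_ h0
    rw [← sq]
    linarith

theorem bergmanProj_coe {lam : ℝ} (p : bergmanSpace n lam) :
    bergmanProj n lam (p : Lp ℂ 2 (bergmanMeasure n lam)) = p :=
  Submodule.orthogonalProjectionOnto_mem_subspace_eq_self p

theorem norm_bergmanProj_mulOp_sub_le {lam : ℝ} {f : Cn n → ℂ} (hf : MemLp f ∞ (ballMeasure n))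
    (h : Lp ℂ 2 (bergmanMeasure n lam)) :
    ‖bergmanProj n lam (mulOp n lam f hf (bergmanProj n lam h)) -
      bergmanProj n lam (mulOp n lam f hf h)‖ ≤
      ‖hankel n lam (star f) hf.star‖ * ‖h - bergmanProj n lam h‖ := by
  rw [← map_sub, ← map_sub, norm_sub_rev h]
  exact norm_bergmanProj_mulOp_le hf (by rw [map_sub, bergmanProj_coe, sub_self])

theorem norm_mulOp_le {lam : ℝ} {g : Cn n → ℂ} (hg : MemLp g ∞ (ballMeasure n)) {B : ℝ}
    (hB : ∀ᵐ z ∂(ballMeasure n), ‖g z‖ ≤ B) (y : Lp ℂ 2 (bergmanMeasure n lam)) :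
    ‖mulOp n lam g hg y‖ ≤ B * ‖y‖ := by
  refine Lp.norm_le_mul_norm_of_ae_le_mul ?_
  filter_upwards [coeFn_mulOp n lam g hg y,
    (bergmanMeasure_absolutelyContinuous n lam).ae_le hB] with z h1 h2
  rw [h1, norm_mul]
  exact mul_le_mul_of_nonneg_right h2 (norm_nonneg _)

theorem mulOp_mul {lam : ℝ} {f g : Cn n → ℂ} (hf : MemLp f ∞ (ballMeasure n))
    (hg : MemLp g ∞ (ballMeasure n)) (y : Lp ℂ 2 (bergmanMeasure n lam)) :
    mulOp n lam (fun z => f z * g z) (memLp_top_mul hf hg) y =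
      mulOp n lam f hf (mulOp n lam g hg y) := by
  refine Lp.ext ?_
  filter_upwards [coeFn_mulOp n lam _ (memLp_top_mul hf hg) y, coeFn_mulOp n lam g hg y,
    coeFn_mulOp n lam f hf (mulOp n lam g hg y)] with z h1 h2 h3
  rw [h1, h3, h2, mul_assoc]

/-- The semi-commutator is -P M_f (I-P) M_g: the left factor is controlled by the Hankel norm, the
right one by the bound on g. -/
theorem norm_semiCommutator_le {lam : ℝ} {f g : Cn n → ℂ} (hf : MemLp f ∞ (ballMeasure n))
    (hg : MemLp g ∞ (ballMeasure n)) {B : ℝ} (hB0 : 0 ≤ B)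
    (hB : ∀ᵐ z ∂(ballMeasure n), ‖g z‖ ≤ B) :
    ‖toeplitz n lam f hf ∘L toeplitz n lam g hg -
      toeplitz n lam (fun z => f z * g z) (memLp_top_mul hf hg)‖ ≤
      ‖hankel n lam (star f) hf.star‖ * B := by
  refine ContinuousLinearMap.opNorm_le_bound _
    (mul_nonneg (ContinuousLinearMap.opNorm_nonneg _) hB0) fun u => ?_
  have e : (toeplitz n lam f hf ∘L toeplitz n lam g hg -
      toeplitz n lam (fun z => f z * g z) (memLp_top_mul hf hg)) u =
      bergmanProj n lam (mulOp n lam f hf (bergmanProj n lam (mulOp n lam g hg u))) -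
      bergmanProj n lam (mulOp n lam f hf (mulOp n lam g hg u)) := by
    rw [← mulOp_mul hf hg]
    rfl
  rw [e, mul_assoc]
  refine (norm_bergmanProj_mulOp_sub_le hf _).trans
    (mul_le_mul_of_nonneg_left ?_ (ContinuousLinearMap.opNorm_nonneg _))
  exact (norm_sub_bergmanProj_le _).trans (norm_mulOp_le hg hB _)

/-! ### Unbounded symbols and the operators on the common domain -/

theorem mem_toeplitzMaxDomain {lam : ℝ} {g : Cn n → ℂ} {u : bergmanSpace n lam} :
    u ∈ toeplitzMaxDomain n lam g ↔
      MemLp (fun z => g z * (u : Lp ℂ 2 (bergmanMeasure n lam)) z) 2 (bergmanMeasure n lam) :=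
  Iff.rfl

theorem toeplitzMaxDomain_le_mul {lam : ℝ} {f g : Cn n → ℂ} (hf : MemLp f ∞ (ballMeasure n)) :
    toeplitzMaxDomain n lam g ≤ toeplitzMaxDomain n lam fun z => f z * g z := fun u hu => by
  rw [mem_toeplitzMaxDomain] at hu ⊢
  have := hu.mul (r := 2) (memLp_top_bergmanMeasure hf lam)
  refine this.ae_eq (Eventually.of_forall fun z => ?_)
  simp only [Pi.mul_apply, mul_assoc]

theorem memLp_of_norm_le_rpow (hn : 1 ≤ n) {lam ρ C : ℝ} (hρ : 2 * ρ < lam - n) {G : Cn n → ℂ}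
    (hG : AEStronglyMeasurable G (bergmanMeasure n lam))
    (hGb : ∀ᵐ z ∂(bergmanMeasure n lam), ‖G z‖ ≤ C * (1 - ‖z‖ ^ 2) ^ (-ρ)) :
    MemLp G 2 (bergmanMeasure n lam) := by
  have hw : MemLp (fun z : Cn n => (1 - ‖z‖ ^ 2) ^ (-ρ)) 2 (bergmanMeasure n lam) := by
    have hm : Measurable fun z : Cn n => (1 - ‖z‖ ^ 2) ^ (-ρ) := by fun_prop
    refine ⟨hm.aestronglyMeasurable, ?_⟩
    rw [eLpNorm_lt_top_iff_lintegral_rpow_enorm_lt_top (by simp) (by simp)]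
    simp only [ENNReal.toReal_ofNat, ENNReal.rpow_ofNat]
    rw [lintegral_bergmanMeasure]
    refine ENNReal.mul_lt_top (ENNReal.inv_lt_top.2 (pos_iff_ne_zero.2 (defInt_ne_zero n lam))) ?_
    rw [lintegral_congr_ae (g := defPow (lam - 2 * ρ))]
    · exact (defInt_ne_top hn (by linarith)).lt_top
    · filter_upwards [ae_invMeasure_norm_lt n] with z hz
      have e : ‖(1 - ‖z‖ ^ 2) ^ (-ρ)‖ₑ = defPow (-ρ) z :=
        Real.enorm_eq_ofReal (Real.rpow_nonneg (one_sub_normSq_pos hz).le _)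
      rw [e, sq, ← defPow_add hz, ← defPow_add hz]
      congr 1
      ring
  refine hw.of_le_mul (c := C) hG ?_
  filter_upwards [hGb, ae_bergmanMeasure_norm_lt n lam] with z h1 h2
  rwa [Real.norm_of_nonneg (Real.rpow_nonneg (one_sub_normSq_pos h2).le _)]

theorem aestronglyMeasurable_of_continuousOn {g : Cn n → ℂ} (lam : ℝ)
    (hg : ContinuousOn g (unitBall n)) : AEStronglyMeasurable g (bergmanMeasure n lam) :=
  (hg.aestronglyMeasurable measurableSet_ball).mono_ac
    ((bergmanMeasure_absolutelyContinuous n lam).trans Measure.smul_absolutelyContinuous)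

theorem IsUC.commonDomain_le (hn : 1 ≤ n) {lam : ℝ} (hlam : n < lam) {g : Cn n → ℂ}
    (hg : IsUC n g) : commonDomain n lam ≤ toeplitzMaxDomain n lam g := by
  rintro u ⟨F, -, hFb, huF⟩
  -- g and u each contribute growth of exponent ρ, so the product has exponent 2ρ; its square
  -- integrability needs 4ρ < λ - n.
  set ρ := (lam - n) / 8 with hρ
  have hρ0 : 0 < ρ := by rw [hρ]; linarith
  obtain ⟨r, hr0, hr1, hr⟩ := hg.exists_norm_mob_le one_pos
  obtain ⟨C, hC0, hC⟩ := exists_norm_le_of_chain hr0 hr1 hr hρ0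
  obtain ⟨D, hD⟩ := hFb ρ hρ0
  rw [mem_toeplitzMaxDomain]
  refine memLp_of_norm_le_rpow hn (ρ := 2 * ρ) (C := C * D) (by rw [hρ]; linarith)
    ((aestronglyMeasurable_of_continuousOn lam hg.continuousOn).mul (Lp.aestronglyMeasurable _)) ?_
  filter_upwards [huF, ae_bergmanMeasure_norm_lt n lam] with z h1 hz
  have hz' := one_sub_normSq_pos hz
  have e : (1 - ‖z‖ ^ 2) ^ (-(2 * ρ)) = (1 - ‖z‖ ^ 2) ^ (-ρ) * (1 - ‖z‖ ^ 2) ^ (-ρ) := by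
    rw [← Real.rpow_add hz']
    congr 1
    ring
  have h2 : 0 ≤ (1 - ‖z‖ ^ 2) ^ (-ρ) := Real.rpow_nonneg hz'.le _
  rw [h1, norm_mul, e, mul_mul_mul_comm]
  exact mul_le_mul (hC z hz) (hD z (by simpa using hz)) (norm_nonneg _) (by positivity)

theorem domain_semiCommutatorOn (lam : ℝ) {f : Cn n → ℂ} (hf : MemLp f ∞ (ballMeasure n))
    {g : Cn n → ℂ} (h : commonDomain n lam ≤ toeplitzMaxDomain n lam g) :
    (semiCommutatorOn n lam f hf g).domain = commonDomain n lam := by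
  refine le_antisymm inf_le_left (le_inf le_rfl (le_inf h (h.trans ?_)))
  exact toeplitzMaxDomain_le_mul hf

/-- As f is bounded, fgu is obtained by applying M_f to gu. The unbounded case thereby reduces to
the bounded operators P and M_f acting on h = gu, and no bound on g is required. -/
theorem semiCommutatorOn_apply (lam : ℝ) {f : Cn n → ℂ} (hf : MemLp f ∞ (ballMeasure n))
    {g : Cn n → ℂ} (u : (semiCommutatorOn n lam f hf g).domain) :
    ∃ h : Lp ℂ 2 (bergmanMeasure n lam),
      h =ᵐ[bergmanMeasure n lam] (fun z => g z *
        ((u : bergmanSpace n lam) : Lp ℂ 2 (bergmanMeasure n lam)) z) ∧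
      semiCommutatorOn n lam f hf g u =
        bergmanProj n lam (mulOp n lam f hf (bergmanProj n lam h)) -
          bergmanProj n lam (mulOp n lam f hf h) := by
  have hu1 : (u : bergmanSpace n lam) ∈ toeplitzMaxDomain n lam g := u.2.2.1
  have hu2 : (u : bergmanSpace n lam) ∈ toeplitzMaxDomain n lam fun z => f z * g z := u.2.2.2
  have e1 := MemLp.coeFn_toLp hu1
  refine ⟨mulOn n lam g ⟨u, hu1⟩, e1, ?_⟩
  have e2 : mulOn n lam (fun z => f z * g z) ⟨u, hu2⟩ =
      mulOp n lam f hf (mulOn n lam g ⟨u, hu1⟩) := by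
    refine Lp.ext ?_
    filter_upwards [e1, MemLp.coeFn_toLp hu2,
      coeFn_mulOp n lam f hf (mulOn n lam g ⟨u, hu1⟩)] with z h1 h2 h3
    have h1' : mulOn n lam g ⟨u, hu1⟩ z =
      g z * ((u : bergmanSpace n lam) : Lp ℂ 2 (bergmanMeasure n lam)) z := h1
    rw [h3, h1', ← mul_assoc]
    exact h2
  rw [← e2]
  rfl

theorem opENorm_semiCommutatorOn_le {lam : ℝ} {f : Cn n → ℂ} (hf : MemLp f ∞ (ballMeasure n))
    {g : Cn n → ℂ} {K : ℝ≥0∞}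
    (hK : ∀ (u : bergmanSpace n lam) (h : Lp ℂ 2 (bergmanMeasure n lam)),
      h =ᵐ[bergmanMeasure n lam] (fun z => g z * (u : Lp ℂ 2 (bergmanMeasure n lam)) z) →
      ‖h - bergmanProj n lam h‖ₑ ≤ K * ‖u‖ₑ) :
    opENorm (semiCommutatorOn n lam f hf g) ≤
      ENNReal.ofReal ‖hankel n lam (star f) hf.star‖ * K := by
  refine iSup₂_le fun u hu => ?_
  obtain ⟨h, hh, e⟩ := semiCommutatorOn_apply lam hf u
  have hu' : ‖(u : bergmanSpace n lam)‖ₑ ≤ 1 := by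
    rw [← ofReal_norm, ← ENNReal.ofReal_one]
    exact ENNReal.ofReal_le_ofReal hu
  have h1 := ENNReal.ofReal_le_ofReal (norm_bergmanProj_mulOp_sub_le hf h)
  rw [← e, ofReal_norm, ENNReal.ofReal_mul (ContinuousLinearMap.opNorm_nonneg _), ofReal_norm] at h1
  exact h1.trans (mul_le_mul_right ((hK u h hh).trans (mul_le_of_le_one_right' hu')) _)

theorem HasVanishingOsc.tendsto_norm_semiCommutator (hn : 1 ≤ n) {f g : Cn n → ℂ}
    (hf : MemLp f ∞ (ballMeasure n)) (ho : HasVanishingOsc n f) (hg : MemLp g ∞ (ballMeasure n)) :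
    Tendsto (fun lam : ℝ => ‖toeplitz n lam f hf ∘L toeplitz n lam g hg -
      toeplitz n lam (fun z => f z * g z) (memLp_top_mul hf hg)‖) atTop (𝓝 0) := by
  obtain ⟨B, hB0, hB⟩ := exists_ae_norm_le hg
  have h := (ho.conj.tendsto_norm_hankel hn hf.star).mul_const B
  rw [zero_mul] at h
  exact squeeze_zero (fun _ => ContinuousLinearMap.opNorm_nonneg _)
    (fun _ => norm_semiCommutator_le hf hg hB0 hB) h

theorem HasVanishingOsc.tendsto_opENorm_semiCommutatorOn (hn : 1 ≤ n) {f g : Cn n → ℂ}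
    (hf : MemLp f ∞ (ballMeasure n)) (ho : HasVanishingOsc n f) (hg : IsUC n g) :
    Tendsto (fun lam : ℝ => opENorm (semiCommutatorOn n lam f hf g)) atTop (𝓝 0) := by
  obtain ⟨K, hK, hKb⟩ := exists_enorm_sub_bergmanProj_le hn
  obtain ⟨r, hr0, hr1, hr⟩ := hg.exists_norm_mob_le one_pos
  have h1 : Tendsto (fun lam : ℝ => ENNReal.ofReal ‖hankel n lam (star f) hf.star‖ * K) atTop
      (𝓝 0) := by
    have h2 := ENNReal.tendsto_ofReal (ho.conj.tendsto_norm_hankel hn hf.star)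
    have h3 := ENNReal.Tendsto.mul_const h2 (Or.inr hK)
    rwa [ENNReal.ofReal_zero, zero_mul] at h3
  refine tendsto_of_tendsto_of_tendsto_of_le_of_le' tendsto_const_nhds h1
    (Eventually.of_forall fun _ => bot_le) ?_
  filter_upwards [eventually_ge_atTop (8 * ((n : ℝ) + 1)), eventually_ge_atTop (1 / r ^ 2)]
    -- The radius r, at which g oscillates by at most 1, is now fixed. Once λ ≥ 1/r² the Schur
    -- estimate bounds (I-P)M_g uniformly in λ, and the decay comes from the Hankel factor of f
    -- alone.
    with lam h2 h3
  rw [div_le_iff₀ (by positivity)] at h3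
  refine opENorm_semiCommutatorOn_le hf fun u h hh => ?_
  simpa using hKb lam r 1 g h2 hr0 hr1 h3 hr u h hh

end BergmanBall

theorem theorem4p8 (n : ℕ) (hn : 1 ≤ n) (f : Cn n → ℂ) (hf : IsVMO n f) :
    Tendsto (fun lam : ℝ => ‖hankel n lam f hf.memLp‖) atTop (𝓝 0) ∧
    (∀ (g : Cn n → ℂ) (hg : MemLp g ∞ (ballMeasure n)),
      Tendsto (fun lam : ℝ => ‖toeplitz n lam f hf.memLp ∘L toeplitz n lam g hg -
        toeplitz n lam (fun z => f z * g z) (memLp_top_mul hf.memLp hg)‖) atTop (𝓝 0)) ∧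
    (∀ g : Cn n → ℂ, IsUC n g →
      (∀ lam : ℝ, (n : ℝ) < lam →
        Dense (commonDomain n lam : Set (bergmanSpace n lam)) ∧
        (semiCommutatorOn n lam f hf.memLp g).domain = commonDomain n lam) ∧
      Tendsto (fun lam : ℝ => opENorm (semiCommutatorOn n lam f hf.memLp g)) atTop (𝓝 0)) :=
  ⟨hf.hasVanishingOsc.tendsto_norm_hankel hn hf.memLp,
    fun _ hg => hf.hasVanishingOsc.tendsto_norm_semiCommutator hn hf.memLp hg,
    fun _ hg => ⟨fun lam hlam => ⟨dense_commonDomain hn hlam,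
      domain_semiCommutatorOn lam hf.memLp (hg.commonDomain_le hn hlam)⟩,
      hf.hasVanishingOsc.tendsto_opENorm_semiCommutatorOn hn hf.memLp hg⟩⟩
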